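/- **Setting.** Let $D=\{x_1,\dots,x_d\}$ be a finite set of strings over an alphabet of size $\sigma\ge 2$, let $n_i$ be the length of $x_i$, and let $n=\sum_i n_i$ and $N=\sum_{i=1}^d n_i(n_i-1)/2$. Fix a load factor $0<\alpha<1$. All tables below use linear probing; a table for $k$ keys has $t=\max(1,\lceil k/\alpha\rceil)$ slots, an element with key $y$ is inserted at the first empty slot (cyclically) from slot $h(y)\bmod t$ on, and a search scans from that slot to the first empty slot. The *two-error dictionary* for $D$ consists of * an *exact dictionary*: for each length $\ell$, a table of the words of length $\ell$; * a *level-1 substitution store*: for each word $x_i$ and each position $p$, the character $x_i[p]$, inserted under the key obtained from $x_i$ by replacing position $p$ by a wildcard $\phi$; * a *level-2 substitution store*: for each word $x_i$ and each pair of positions $p<q$, the character $x_i[p]$, inserted under the key obtained from $x_i$ by replacing positions $p$ and $q$ by $\phi$. Each entry of a substitution store carries an $r$-bit signature computed from the hash value of its key, and a search in a store returns the scanned characters whose signature is that of the searched key. The tables may or may not be compacted at the end of the construction (a bit vector that marks the non-empty slots, with a rank sample every $\delta$ machine words, and the array of the non-empty slots). Here $r\ge 0$ and $\delta\ge1$ are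 constants. The *substitution list* of a key is the list of the characters inserted under it. A query for a string $x$ of length $m$ goes through all the strings obtained from $x$ by zero, one or two edit operations (insertions, deletions, substitutions), inserted and substituted characters being wildcards. If there are two wildcards, each character returned by the level-2 store is substituted for the first one; if one wildcard is left, each character returned by the level-1 store is substituted for it; each resulting wildcard-free string is looked up in the exact dictionary and reported if found there. **Assumptions.** The cost is counted in a word RAM with word length $w=\Omega(\log n)$, where a character fits in a word and strings are packed $\lfloor w/\lceil\log_2\sigma\rceil\rfloor$ characters per word. Hashing is *fully random*: the hash values of distinct keys are independent, the hash value of a key of a given table is uniform on $\{0,\dots,M-1\}$ for a positive multiple $M=2^{O(w)}$ of the number of slots of that table. Hashing is *incremental*: after a preprocessing of a string $x$ in time $O(|x|+1)$, the hash value of any string (possibly with wildcards) at edit distance at most two from $x$ is computed in time $O(1)$. Every non-empty substitution list, of either level, has a single element. **Theorem.** The query algorithm always returns exactly the words of $D$ at edit distance at most two from $x$. For every query string of length $m\ge1$, the expected query time is $$O\!\left(m^2\left\lceil\frac{m\log_2\sigma}{w}\right\rceil\right),$$ and the expected time of the construction of the dictionary is $O(\max(1,N))$. The implied constants depend only on $\alpha$,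 $\delta$, $r$ and the constants in the assumptions. -/

import Mathlib

open MeasureTheory ProbabilityTheory
open scoped ENNReal

universe u

namespace TwoErrorDict

/-! ## Step counting

Algorithms are written in a monad that carries the number of word-RAM steps. One step is an
arithmetic or logical operation on, or a read or write of, a constant number of machine words. -/

/-- A result together with the number of RAM steps spent on computing it. -/
structure Timed (α : Type) where
  val : α
  cost : ℕ

namespace Timed

instance : Monad Timed where
  pure a := ⟨a, 0⟩
  bind x f := ⟨(f x.val).val, x.cost + (f x.val).cost⟩

/-- Spend `k` steps. -/
def tick (k : ℕ) : Timed Unit := ⟨(), k⟩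

/-- Iterate over a list with an updatable state; one step of overhead per iteration. -/
def loop {S α : Type} (f : S → α → Timed S) : S → List α → Timed S
  | s, [] => pure s
  | s, a :: l => do
    tick 1
    let s₁ ← f s a
    loop f s₁ l

/-- Iterate over a list and emit results; one step of overhead per iteration. -/
def collect {α β : Type} (f : α → Timed (List β)) : List α → Timed (List β)
  | [] => pure []
  | a :: l => do
    tick 1
    let r ← f a
    let rs ← collect f l
    pure (r ++ rs)

/-- Read one cell of an array. -/
def readMem {α : Type} (a : ℕ → α) (i : ℕ) : Timed α := ⟨a i, 1⟩

end Timed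

open Timed

/-! ## Strings, wildcards, hash functions -/

/-- Strings over the alphabet `{0, …, σ - 1}`. -/
abbrev Str (σ : ℕ) := List (Fin σ)

/-- Strings that may contain the wildcard `φ`, written `none`; these are the keys that get hashed. -/
abbrev Key (σ : ℕ) := List (Option (Fin σ))

/-- A string, seen as a key without wildcards. -/
def toKey {σ : ℕ} (x : Str σ) : Key σ := x.map some

/-- Replace the leftmost wildcard by the character `c`. -/
def fill {σ : ℕ} (c : Fin σ) : Key σ → Key σ
  | [] => []
  | none :: l => some c :: l
  | some a :: l => some a :: fill c l

/-- One edit operation: an insertion, a deletion or a substitution of one character. -/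
inductive EditStep {α : Type} : List α → List α → Prop
  | ins (u v : List α) (a : α) : EditStep (u ++ v) (u ++ a :: v)
  | del (u v : List α) (a : α) : EditStep (u ++ a :: v) (u ++ v)
  | sub (u v : List α) (a b : α) : EditStep (u ++ a :: v) (u ++ b :: v)

/-- A sequence of `e` edit operations transforms one string into the other. -/
inductive EditSeq {α : Type} : ℕ → List α → List α → Prop
  | nil (x : List α) : EditSeq 0 x x
  | cons {e : ℕ} {x y z : List α} : EditStep x y → EditSeq e y z → EditSeq (e + 1) x z

/-- The edit distance (Levenshtein distance): the minimum number of edit operations that transform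
`x` into `y`. (Such a sequence always exists.) -/
noncomputable def editDist {α : Type} (x y : List α) : ℕ := sInf {e | EditSeq e x y}

/-- The running times of an implementation of a string hash function: `pre x` is the time to
preprocess `x`, and `eval x y` the time to compute the hash value of `y` once `x` has been
preprocessed. -/
structure HashCost (σ : ℕ) where
  pre : Key σ → ℕ
  eval : Key σ → Key σ → ℕ

/-- The hash function is incremental for `e` errors, with constant `c`: after a preprocessing of `x`
in linear time, the hash value of every string at edit distance at most `e` from `x` is computed in
constant time. -/
def HashCost.Incremental {σ : ℕ} (T : HashCost σ) (e c : ℕ) : Prop :=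
  (∀ x, T.pre x ≤ c * (x.length + 1)) ∧
    ∀ x y, editDist x y ≤ e → T.eval x y ≤ c

/-- `h` is a fully random function on the keys: the values are independent, and the value at `k` is
uniform on `{0, …, range k - 1}`. -/
def FullyRandom {σ : ℕ} {Ω : Type u} [MeasurableSpace Ω] (μ : Measure Ω) (h : Ω → Key σ → ℕ)
    (range : Key σ → ℕ) : Prop :=
  (∀ k, Measurable fun ω => h ω k) ∧
    (∀ k, ∀ v < range k, μ {ω | h ω k = v} = (range k : ℝ≥0∞)⁻¹) ∧
    iIndepFun (fun k ω => h ω k) μ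

/-! ## Substitution lists and sizes -/

/-- The level-1 insertions of a word: for each position, the word with a wildcard there, and the
character that the wildcard hides. -/
def entries1 {σ : ℕ} (x : Str σ) : List (Key σ × Fin σ) :=
  x.zipIdx.map fun cp => ((toKey x).set cp.2 none, cp.1)

/-- The level-2 insertions of a word: for each pair of positions `p < q`, the word with wildcards
at `p` and `q`, and the character at the first position `p`. -/
def entries2 {σ : ℕ} (x : Str σ) : List (Key σ × Fin σ) :=
  x.zipIdx.flatMap fun cp => (List.range' (cp.2 + 1) (x.length - (cp.2 + 1))).map fun q =>
    (((toKey x).set cp.2 none).set q none, cp.1)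

/-- The level-1 substitution list of the key `k`. -/
def subList1 {σ : ℕ} (D : List (Str σ)) (k : Key σ) : List (Fin σ) :=
  ((D.flatMap entries1).filter fun e => e.1 = k).map Prod.snd

/-- The level-2 substitution list of the key `k`. -/
def subList2 {σ : ℕ} (D : List (Str σ)) (k : Key σ) : List (Fin σ) :=
  ((D.flatMap entries2).filter fun e => e.1 = k).map Prod.snd

/-- Every existing (that is, non-empty) substitution list, of either level, has a single element. -/
def SingletonLists {σ : ℕ} (D : List (Str σ)) : Prop :=
  ∀ k, (subList1 D k ≠ [] → (subList1 D k).length = 1) ∧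
    (subList2 D k ≠ [] → (subList2 D k).length = 1)

/-- The number of words of length `l`. -/
def lengthCount {σ : ℕ} (D : List (Str σ)) (l : ℕ) : ℕ := (D.filter fun x => x.length = l).length

/-- The length of a longest word. -/
def maxLength {σ : ℕ} (D : List (Str σ)) : ℕ := (D.map List.length).foldr max 0

/-- `n = ∑ nᵢ`, the number of level-1 insertions. -/
def totalLength {σ : ℕ} (D : List (Str σ)) : ℕ := (D.map List.length).sum

/-- `N = ∑ nᵢ (nᵢ - 1) / 2`, the number of level-2 insertions. -/
def pairCount {σ : ℕ} (D : List (Str σ)) : ℕ :=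
  (D.map fun x => x.length * (x.length - 1) / 2).sum

/-- The capacity of a hash table for `n` keys at load factor `α` (one slot if there are no keys). -/
noncomputable def capacity (α : ℝ) (n : ℕ) : ℕ := max 1 ⌈(n : ℝ) / α⌉₊

/-- The hash tables of the dictionary: one exact table for each word length, and one substitution
store for each of the two levels. -/
inductive TableId where
  | exact (l : ℕ)
  | one
  | two

/-- The table in which a key is looked up. -/
def tableOf {σ : ℕ} (k : Key σ) : TableId :=
  match k.countP Option.isNone with
  | 0 => .exact k.length
  | 1 => .one
  | _ => .two

/-- The number of slots of each table, where `cap n` is the capacity for `n` keys. -/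
def tableSize {σ : ℕ} (cap : ℕ → ℕ) (D : List (Str σ)) : TableId → ℕ
  | .exact l => cap (lengthCount D l)
  | .one => cap (totalLength D)
  | .two => cap (pairCount D)

/-! ## Configuration and packed strings -/

/-- The parameters of the data structure. -/
structure Config (r : ℕ) where
  /-- word length of the RAM, in bits -/
  w : ℕ
  /-- one rank sample for every `δ` words of a compaction bit vector -/
  δ : ℕ
  /-- capacity of a hash table as a function of its number of keys -/
  cap : ℕ → ℕ
  /-- whether the hash tables are compacted at the end of the construction -/
  compacted : Bool
  /-- the `r`-bit signature that is extracted from a hash value -/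
  sig : ℕ → Fin (2 ^ r)

/-- The number of characters, of `⌈log₂ σ⌉` bits each, that are packed into one word. -/
def charsPerWord (w σ : ℕ) : ℕ := w / Nat.clog 2 σ

/-- The number of words of a packed string of length `l`. -/
def wordCount (w σ l : ℕ) : ℕ := (l + (charsPerWord w σ - 1)) / charsPerWord w σ

/-- The contents of word number `j` of a packed string, with `p` characters per word. -/
def wordAt {σ : ℕ} (p : ℕ) (y : Str σ) (j : ℕ) : Str σ := (y.drop (j * p)).take p

/-- Compare the packed strings `y` and `z` word by word, from word number `j` on. -/
def equalFrom {σ : ℕ} (p : ℕ) (y z : Str σ) : ℕ → ℕ → Timed Bool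
  | 0, _ => pure true
  | f + 1, j => do
    tick 1
    if wordAt p y j = wordAt p z j then equalFrom p y z f (j + 1) else pure false

/-! ## Linear probing -/

/-- Insertion by linear probing into a table with `t` slots, starting at slot `i`; an element
occupies `sz` words. The argument after `e` bounds the number of probes. -/
def insertFrom {E : Type} (t sz : ℕ) (e : E) : ℕ → (ℕ → Option E) → ℕ → Timed (ℕ → Option E)
  | 0, a, _ => pure a
  | f + 1, a, i => do
    let s ← readMem a i
    match s with
    | none => do
      tick sz
      pure (Function.update a i (some e))
    | some _ => insertFrom t sz e f a ((i + 1) % t)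

/-- A finished hash table with `size` slots. The plain form is the array of slots. The compacted
form has a bit vector that marks the non-empty slots, a sample of the ranks of this bit vector, and
the array of the non-empty slots. -/
inductive Table (E : Type) where
  | plain (size : ℕ) (slots : ℕ → Option E)
  | compact (size : ℕ) (bits : ℕ → Bool) (samples : ℕ → ℕ) (items : ℕ → Option E)

/-- The number of (virtual) slots. -/
def Table.size {E : Type} : Table E → ℕ
  | .plain t _ => t
  | .compact t _ _ _ => t

/-- The number of ones in positions `a, …, b - 1` of a bit vector. -/
def ones (bits : ℕ → Bool) (a b : ℕ) : ℕ := (List.range' a (b - a)).countP bits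

/-- The rank of position `i` in a bit vector: the sample preceding `i`, plus one popcount for each
`w`-bit word from there to the (masked) word that contains `i`. -/
def rank (w δ : ℕ) (bits : ℕ → Bool) (samples : ℕ → ℕ) (i : ℕ) : Timed ℕ := do
  let s := i / (δ * w)
  let r ← readMem samples s
  loop (fun acc j => do
    tick 1
    pure (acc + ones bits (j * w) (min ((j + 1) * w) i))) r
    (List.range' (δ * s) (i / w - δ * s + 1))

/-- Read slot `i` of a table. -/
def Table.read {E : Type} (w δ : ℕ) : Table E → ℕ → Timed (Option E)
  | .plain _ a, i => readMem a i
  | .compact _ bits samples items, i => do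
    let b ← readMem bits i
    if b then do
      let p ← rank w δ bits samples i
      readMem items p
    else pure none

/-- The state of the compaction pass. -/
structure CompactState (E : Type) where
  count : ℕ
  bits : ℕ → Bool
  samples : ℕ → ℕ
  items : ℕ → Option E

/-- One step of the compaction pass, at slot `i`. -/
def compactStep {E : Type} (w δ sz : ℕ) (a : ℕ → Option E) (st : CompactState E) (i : ℕ) :
    Timed (CompactState E) := do
  let st₁ ← (if i % (δ * w) = 0 then do
      tick 1
      pure { st with samples := Function.update st.samples (i / (δ * w)) st.count }
    else pure st)
  let s ← readMem a i
  tick 1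
  match s with
  | none => pure { st₁ with bits := Function.update st₁.bits i false }
  | some e => do
    tick sz
    pure { st₁ with
      count := st₁.count + 1
      bits := Function.update st₁.bits i true
      items := Function.update st₁.items st₁.count (some e) }

/-- The last stage of the construction of a table with `t` slots: compaction, if it is used. -/
def finish {r : ℕ} {E : Type} (cfg : Config r) (sz t : ℕ) (a : ℕ → Option E) :
    Timed (Table E) :=
  if cfg.compacted then do
    let st ← loop (compactStep cfg.w cfg.δ sz a)
      ⟨0, fun _ => false, fun _ => 0, fun _ => none⟩ (List.range t)
    pure (.compact t st.bits st.samples st.items)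
  else pure (.plain t a)

/-! ## Construction -/

/-- An entry of a substitution store: a character with the signature of its substitution list. -/
abbrev Entry (σ r : ℕ) := Fin σ × Fin (2 ^ r)

/-- The slots of all the tables during the construction. -/
structure Slots (σ r : ℕ) where
  exact : ℕ → ℕ → Option (Str σ)
  one : ℕ → Option (Entry σ r)
  two : ℕ → Option (Entry σ r)

/-- The two-error dictionary. -/
structure Dict (σ r : ℕ) where
  maxLen : ℕ
  exact : ℕ → Table (Str σ)
  one : Table (Entry σ r)
  two : Table (Entry σ r)

/-- Compute the hash value of `k`, where `x` has been preprocessed. -/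
def hashAt {σ : ℕ} (T : HashCost σ) (h : Key σ → ℕ) (x k : Key σ) : Timed ℕ := ⟨h k, T.eval x k⟩

/-- Insert one character into a substitution store with `t` slots, under the key `ec.1`. -/
def insertEntry {σ r : ℕ} (cfg : Config r) (T : HashCost σ) (h : Key σ → ℕ) (x : Key σ) (t : ℕ)
    (a : ℕ → Option (Entry σ r)) (ec : Key σ × Fin σ) : Timed (ℕ → Option (Entry σ r)) := do
  let v ← hashAt T h x ec.1
  insertFrom t 1 (ec.2, cfg.sig v) t a (v % t)

/-- Insert one word into the exact dictionary and into both substitution stores; `size` gives the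
numbers of slots. -/
def insertWord {σ r : ℕ} (cfg : Config r) (T : HashCost σ) (h : Key σ → ℕ) (size : TableId → ℕ)
    (s : Slots σ r) (x : Str σ) : Timed (Slots σ r) := do
  tick (T.pre (toKey x))
  -- packing the word
  tick x.length
  let v ← hashAt T h (toKey x) (toKey x)
  let t := size (.exact x.length)
  let a ← insertFrom t (wordCount cfg.w σ x.length + 1) x t (s.exact x.length) (v % t)
  let b ← loop (insertEntry cfg T h (toKey x) (size .one)) s.one (entries1 x)
  -- the outer loop over the first of the two positions
  tick x.length
  let c ← loop (insertEntry cfg T h (toKey x) (size .two)) s.two (entries2 x)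
  pure ⟨Function.update s.exact x.length a, b, c⟩

/-- The construction of the dictionary. -/
def build {σ r : ℕ} (cfg : Config r) (T : HashCost σ) (h : Key σ → ℕ) (D : List (Str σ)) :
    Timed (Dict σ r) := do
  let size := tableSize cfg.cap D
  let lengths := List.range (maxLength D + 1)
  -- one pass over the input, which counts the words of each length and computes the table sizes
  tick (totalLength D + D.length + maxLength D + 1)
  -- marking all the slots of all the tables as empty
  loop (fun _ l => tick (size (.exact l))) () lengths
  tick (size .one)
  tick (size .two)
  let s ← loop (insertWord cfg T h size)
    ⟨fun _ _ => none, fun _ => none, fun _ => none⟩ D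
  let exact ← loop (fun (tables : ℕ → Table (Str σ)) l => do
      let tb ← finish cfg (wordCount cfg.w σ l + 1) (size (.exact l)) (s.exact l)
      tick 1
      pure (Function.update tables l tb))
    (fun _ => .plain 0 fun _ => none) lengths
  let one ← finish cfg 1 (size .one) s.one
  let two ← finish cfg 1 (size .two) s.two
  pure ⟨maxLength D, exact, one, two⟩

/-! ## Queries -/

/-- Scan a substitution store from slot `i` to the next empty slot, and collect the characters
whose signature is `s`. The first natural number bounds the number of probes. -/
def scanStore {σ r : ℕ} (cfg : Config r) (tb : Table (Entry σ r)) (s : Fin (2 ^ r)) :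
    ℕ → ℕ → Timed (List (Fin σ))
  | 0, _ => pure []
  | f + 1, i => do
    let e ← tb.read cfg.w cfg.δ i
    match e with
    | none => pure []
    | some (c, s₁) => do
      tick 1
      let rest ← scanStore cfg tb s f ((i + 1) % tb.size)
      if s₁ = s then pure (c :: rest) else pure rest

/-- Query a substitution store for the key `k`, where `x` has been preprocessed. -/
def lookupStore {σ r : ℕ} (cfg : Config r) (T : HashCost σ) (h : Key σ → ℕ) (x : Key σ)
    (tb : Table (Entry σ r)) (k : Key σ) : Timed (List (Fin σ)) := do
  let v ← hashAt T h x k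
  scanStore cfg tb (cfg.sig v) tb.size (v % tb.size)

/-- Search an exact table from slot `i` on for the word `y`, up to the next empty slot. The first
natural number bounds the number of probes. -/
def scanExact {σ r : ℕ} (cfg : Config r) (tb : Table (Str σ)) (y : Str σ) : ℕ → ℕ → Timed Bool
  | 0, _ => pure false
  | f + 1, i => do
    let e ← tb.read cfg.w cfg.δ i
    match e with
    | none => pure false
    | some z => do
      let b ← equalFrom (charsPerWord cfg.w σ) y z (wordCount cfg.w σ y.length) 0
      if b then pure true else scanExact cfg tb y f ((i + 1) % tb.size)

/-- Assemble the candidate string described by the wildcard-free key `k`, look it up in the exact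
dictionary, and report it if it is a word. -/
def checkCandidate {σ r : ℕ} (cfg : Config r) (T : HashCost σ) (h : Key σ → ℕ) (x : Key σ)
    (d : Dict σ r) (k : Key σ) : Timed (List (Str σ)) := do
  let y : Str σ := k.reduceOption
  tick (wordCount cfg.w σ y.length + 1)
  if d.maxLen < y.length then pure []
  else do
    let v ← hashAt T h x k
    let tb := d.exact y.length
    let b ← scanExact cfg tb y tb.size (v % tb.size)
    if b then do
      tick 1
      pure [y]
    else pure []

/-- Resolve a key with one wildcard: substitute each character that the level-1 store returns. -/
def resolveOne {σ r : ℕ} (cfg : Config r) (T : HashCost σ) (h : Key σ → ℕ) (x : Key σ)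
    (d : Dict σ r) (k : Key σ) : Timed (List (Str σ)) := do
  let cs ← lookupStore cfg T h x d.one k
  collect (fun c => checkCandidate cfg T h x d (fill c k)) cs

/-- Resolve a key with two wildcards: substitute each character that the level-2 store returns for
the first wildcard, and resolve the remaining wildcard with the level-1 store. -/
def resolveTwo {σ r : ℕ} (cfg : Config r) (T : HashCost σ) (h : Key σ → ℕ) (x : Key σ)
    (d : Dict σ r) (k : Key σ) : Timed (List (Str σ)) := do
  let cs ← lookupStore cfg T h x d.two k
  collect (fun c => resolveOne cfg T h x d (fill c k)) cs

/-- The probes without wildcards: no edit, one deletion, two deletions. -/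
def probes0 {σ : ℕ} (x : Key σ) : List (Key σ) :=
  [x] ++ (List.range x.length).map (fun i => x.eraseIdx i) ++
    (List.range x.length).flatMap fun j =>
      (List.range j).map fun i => (x.eraseIdx j).eraseIdx i

/-- The keys obtained by substituting a wildcard for a character, or by inserting a wildcard. -/
def oneWild {σ : ℕ} (x : Key σ) : List (Key σ) :=
  (List.range x.length).map (fun i => x.set i none) ++
    (List.range (x.length + 1)).map fun i => x.insertIdx i none

/-- The probes with one wildcard: a substitution or an insertion, after at most one deletion. -/
def probes1 {σ : ℕ} (x : Key σ) : List (Key σ) :=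
  oneWild x ++ (List.range x.length).flatMap fun i => oneWild (x.eraseIdx i)

/-- The probes with two wildcards: two substitutions, a substitution and an insertion, or two
insertions. -/
def probes2 {σ : ℕ} (x : Key σ) : List (Key σ) :=
  ((List.range x.length).flatMap fun j =>
      (List.range j).map fun i => (x.set j none).set i none) ++
    ((List.range x.length).flatMap fun j =>
      (List.range (x.length + 1)).map fun i => (x.set j none).insertIdx i none) ++
    (List.range (x.length + 1)).flatMap fun j =>
      (List.range (j + 1)).map fun i => (x.insertIdx j none).insertIdx i none

/-- The query algorithm: all the words at edit distance at most two from `x`. -/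
def query {σ r : ℕ} (cfg : Config r) (T : HashCost σ) (h : Key σ → ℕ) (d : Dict σ r) (x : Str σ) :
    Timed (List (Str σ)) := do
  let k := toKey x
  tick (T.pre k)
  -- packing the query, and the outer loops over the first of two edit positions
  tick (6 * (x.length + 1))
  let r₀ ← collect (checkCandidate cfg T h k d) (probes0 k)
  let r₁ ← collect (resolveOne cfg T h k d) (probes1 k)
  let r₂ ← collect (resolveTwo cfg T h k d) (probes2 k)
  pure (r₀ ++ r₁ ++ r₂)

end TwoErrorDict

/-!
The query algorithm is correct for every hash function, and its cost is governed by the lengths of the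
scans of linear probing.

*Correctness.* The edit distance counts the edited columns of a best left-to-right alignment
(`editDist_le_iff`). An alignment of `x` with `y` in at most two edits, with the inserted and
substituted characters of `y` hidden, is one of the probes of the query (`exists_probe`), and hiding one
or two characters of a word of `D` gives a key under which the hidden character was inserted. Probing
never misses an element that is in the table (`fillTable_reach`), so every word within distance two is
found. Conversely, filling a wildcard keeps the distance from `x` (`editDist_fill_le`), so that false
characters lead only to candidates which the exact dictionary verifies (`mem_query`).

*Search length.* If the slots from the home of a key to `j` slots further are occupied, take the longest
occupied run that contains them: all its elements have their homes in the run, so that some window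
around the home slot contains the homes of as many elements as it has slots (`exists_window`). The length
of a scan is therefore at most the number of overfull windows (`runLen_fillTable_le`,
`runLen_le_overload`). The homes of the other keys are independent and uniform, and the Chernoff bound
with base `1 / α` shows that the window from `i` slots before to `j` slots after the home is overfull
with probability `O(ρ ^ (i + j))`, where `ρ = α e ^ (1 - α) < 1` (`lintegral_overfull_le`). Summing two
geometric series, the expected scan length is bounded in terms of `α` alone (`lintegral_overload_le`).
This uses that the keys of a table are pairwise distinct, which is what single-element substitution
lists provide (`nodup_keys`).

*Query time.* There are `O(m²)` probes. The number of characters that a store yields for a probe is at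
most the scan length, and is determined by the hash values of the keys with as many wildcards as the
probe has, whereas the cost of processing these characters depends on keys with fewer wildcards. By
independence, the expected total cost is at most the product of the expectations
(`FinDep.lintegral_sum_map_le`). Each check in the exact dictionary compares packed words and gives the
factor `⌈m log₂ σ / w⌉` (`wordCount_add_two_le`); see `Setting.lintegral_query_le`.

*Construction time.* Each of the `n + N` insertions into the substitution stores takes expected constant
time, and copying the words takes `O(n)` time. Single-element lists force `n ≤ 2 N + 1`, and with at most
`N + 2` words everything is `O(max 1 N)` (`length_le_pairCount`, `Setting.lintegral_build_le`).
-/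

namespace TwoErrorDict

open Timed

/-! ### Edit sequences and alignments -/

/-- `Align e x y`: a left-to-right alignment of `x` with `y` in which `e` columns are edits. Unlike
`EditSeq`, whose operations come in any order, it can be analysed by recursion on the strings. -/
inductive Align {α : Type} : ℕ → List α → List α → Prop
  | nil : Align 0 [] []
  | keep {e : ℕ} {x y : List α} (a : α) : Align e x y → Align e (a :: x) (a :: y)
  | sub {e : ℕ} {x y : List α} (a b : α) : Align e x y → Align (e + 1) (a :: x) (b :: y)
  | ins {e : ℕ} {x y : List α} (b : α) : Align e x y → Align (e + 1) x (b :: y)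
  | del {e : ℕ} {x y : List α} (a : α) : Align e x y → Align (e + 1) (a :: x) y

theorem EditStep.cons {α : Type} (a : α) {x y : List α} (h : EditStep x y) :
    EditStep (a :: x) (a :: y) := by
  cases h with
  | ins u v b => exact EditStep.ins (a :: u) v b
  | del u v b => exact EditStep.del (a :: u) v b
  | sub u v b c => exact EditStep.sub (a :: u) v b c

theorem EditSeq.map_cons {α : Type} (a : α) {e : ℕ} {x y : List α} (h : EditSeq e x y) :
    EditSeq e (a :: x) (a :: y) := by
  induction h with
  | nil x => exact EditSeq.nil _
  | cons h _ ih => exact EditSeq.cons (h.cons a) ih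

theorem Align.editSeq {α : Type} {e : ℕ} {x y : List α} (h : Align e x y) : EditSeq e x y := by
  induction h with
  | nil => exact EditSeq.nil _
  | keep a _ ih => exact ih.map_cons a
  | sub a b _ ih => exact EditSeq.cons (EditStep.sub [] _ a b) (ih.map_cons b)
  | ins b _ ih => exact EditSeq.cons (EditStep.ins [] _ b) (ih.map_cons b)
  | del a _ ih => exact EditSeq.cons (EditStep.del [] _ a) ih

theorem Align.refl {α : Type} (x : List α) : Align 0 x x := by
  induction x with
  | nil => exact .nil
  | cons a x ih => exact .keep a ih

theorem Align.exists {α : Type} (x y : List α) : ∃ e, Align e x y := by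
  induction x with
  | nil =>
    induction y with
    | nil => exact ⟨0, .nil⟩
    | cons b y ih => exact ⟨_, .ins b ih.choose_spec⟩
  | cons a x ih => exact ⟨_, .del a ih.choose_spec⟩

theorem Align.append {α : Type} {e f : ℕ} {x y z w : List α} (h : Align e x y) (h' : Align f z w) :
    Align (e + f) (x ++ z) (y ++ w) := by
  induction h with
  | nil => simpa using h'
  | keep a _ ih => exact .keep a ih
  | sub a b _ ih => rw [Nat.add_right_comm]; exact .sub a b ih
  | ins b _ ih => rw [Nat.add_right_comm]; exact .ins b ih
  | del a _ ih => rw [Nat.add_right_comm]; exact .del a ih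

/-- The part of an alignment that concerns a prefix of the first string can be cut off. This makes an edit
at any position an edit at the front. -/
theorem Align.split {α : Type} {e : ℕ} {x z : List α} (h : Align e x z) :
    ∀ u w, x = u ++ w → ∃ e₁ e₂ z₁ z₂, e₁ + e₂ = e ∧ z = z₁ ++ z₂ ∧ Align e₁ u z₁ ∧
      Align e₂ w z₂ := by
  induction h with
  | nil =>
    intro u w hx
    obtain ⟨rfl, rfl⟩ := List.append_eq_nil_iff.1 hx.symm
    exact ⟨0, 0, [], [], rfl, rfl, .nil, .nil⟩
  | @keep e x y a h ih =>
    intro u w hx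
    cases u with
    | nil =>
      exact ⟨0, e, [], _, by simp, rfl, .nil, by
        rw [← List.nil_append w, ← hx]; exact Align.keep a h⟩
    | cons b u =>
      simp only [List.cons_append, List.cons.injEq] at hx
      obtain ⟨e₁, e₂, z₁, z₂, he, rfl, h₁, h₂⟩ := ih u w hx.2
      exact ⟨e₁, e₂, a :: z₁, z₂, he, rfl, hx.1 ▸ .keep a h₁, h₂⟩
  | @sub e x y a b h ih =>
    intro u w hx
    cases u with
    | nil =>
      exact ⟨0, e + 1, [], _, by simp, rfl, .nil, by
        rw [← List.nil_append w, ← hx]; exact Align.sub a b h⟩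
    | cons a' u =>
      simp only [List.cons_append, List.cons.injEq] at hx
      obtain ⟨e₁, e₂, z₁, z₂, he, rfl, h₁, h₂⟩ := ih u w hx.2
      exact ⟨e₁ + 1, e₂, b :: z₁, z₂, by omega, rfl, .sub _ b h₁, h₂⟩
  | @ins e x y b h ih =>
    intro u w hx
    obtain ⟨e₁, e₂, z₁, z₂, he, rfl, h₁, h₂⟩ := ih u w hx
    exact ⟨e₁ + 1, e₂, b :: z₁, z₂, by omega, rfl, .ins b h₁, h₂⟩
  | @del e x y a h ih =>
    intro u w hx
    cases u with
    | nil =>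
      exact ⟨0, e + 1, [], _, by simp, rfl, .nil, by
        rw [← List.nil_append w, ← hx]; exact Align.del a h⟩
    | cons a' u =>
      simp only [List.cons_append, List.cons.injEq] at hx
      obtain ⟨e₁, e₂, z₁, z₂, he, rfl, h₁, h₂⟩ := ih u w hx.2
      exact ⟨e₁ + 1, e₂, z₁, z₂, by omega, rfl, .del _ h₁, h₂⟩

theorem Align.remove_head {α : Type} {e : ℕ} {x z : List α} (h : Align e x z) :
    ∀ a v, x = a :: v → ∃ e' ≤ e + 1, Align e' v z := by
  induction h with
  | nil => intro a v hx; cases hx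
  | keep b h _ => intro a v hx; cases hx; exact ⟨_, le_rfl, .ins b h⟩
  | sub c b h _ => intro a v hx; cases hx; exact ⟨_, by omega, .ins b h⟩
  | ins b h ih =>
    intro a v hx
    obtain ⟨e', he, h'⟩ := ih a v hx
    exact ⟨e' + 1, by omega, .ins b h'⟩
  | del b h _ => intro a v hx; cases hx; exact ⟨_, by omega, h⟩

theorem Align.replace_head {α : Type} {e : ℕ} {x z : List α} (h : Align e x z) :
    ∀ a b v, x = b :: v → ∃ e' ≤ e + 1, Align e' (a :: v) z := by
  induction h with
  | nil => intro a b v hx; cases hx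
  | keep b' h _ => intro a b v hx; cases hx; exact ⟨_, le_rfl, .sub a b' h⟩
  | sub c b' h _ => intro a b v hx; cases hx; exact ⟨_, by omega, .sub a b' h⟩
  | ins b' h ih =>
    intro a b v hx
    obtain ⟨e', he, h'⟩ := ih a b v hx
    exact ⟨e' + 1, by omega, .ins b' h'⟩
  | del b' h _ => intro a b v hx; cases hx; exact ⟨_, by omega, .del a h⟩

/-- One more edit at the beginning of an edit sequence costs at most one more column of an alignment: if
the edited character is edited again later on, the two edits are merged. -/
theorem EditStep.align {α : Type} {e : ℕ} {x y z : List α} (h : EditStep x y) (h' : Align e y z) :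
    ∃ e' ≤ e + 1, Align e' x z := by
  cases h with
  | ins u v a =>
    obtain ⟨e₁, e₂, z₁, z₂, he, rfl, h₁, h₂⟩ := h'.split _ _ rfl
    obtain ⟨e', he', h''⟩ := h₂.remove_head _ _ rfl
    exact ⟨e₁ + e', by omega, h₁.append h''⟩
  | del u v a =>
    obtain ⟨e₁, e₂, z₁, z₂, he, rfl, h₁, h₂⟩ := h'.split _ _ rfl
    exact ⟨e₁ + (e₂ + 1), by omega, h₁.append (.del a h₂)⟩
  | sub u v a b =>
    obtain ⟨e₁, e₂, z₁, z₂, he, rfl, h₁, h₂⟩ := h'.split _ _ rfl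
    obtain ⟨e', he', h''⟩ := h₂.replace_head a _ _ rfl
    exact ⟨e₁ + e', by omega, h₁.append h''⟩

theorem EditSeq.align {α : Type} {e : ℕ} {x y : List α} (h : EditSeq e x y) :
    ∃ e' ≤ e, Align e' x y := by
  induction h with
  | nil x => exact ⟨0, le_rfl, Align.refl x⟩
  | cons h _ ih =>
    obtain ⟨e', he, h'⟩ := ih
    obtain ⟨e'', he', h''⟩ := h.align h'
    exact ⟨e'', by omega, h''⟩

/-- The edit distance is the least number of edits in an alignment. -/
theorem editDist_le_iff {α : Type} {x y : List α} {e : ℕ} :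
    editDist x y ≤ e ↔ ∃ e' ≤ e, Align e' x y := by
  constructor
  · intro h
    have hne : {e | EditSeq e x y}.Nonempty :=
      let ⟨e, h⟩ := Align.exists x y
      ⟨e, h.editSeq⟩
    obtain ⟨e', he, h'⟩ := EditSeq.align (Nat.sInf_mem hne)
    exact ⟨e', he.trans h, h'⟩
  · rintro ⟨e', he, h⟩
    exact (Nat.sInf_le h.editSeq).trans he

theorem Align.editDist_le {α : Type} {x y : List α} {e : ℕ} (h : Align e x y) : editDist x y ≤ e :=
  editDist_le_iff.2 ⟨e, le_rfl, h⟩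

theorem EditStep.editDist_le {α : Type} {x y z : List α} {e : ℕ} (h : EditStep x y)
    (h' : editDist y z ≤ e) : editDist x z ≤ e + 1 := by
  obtain ⟨e', he, h'⟩ := editDist_le_iff.1 h'
  obtain ⟨e'', he', h''⟩ := h.align h'
  exact editDist_le_iff.2 ⟨e'', by omega, h''⟩

theorem editDist_self_le {α : Type} (x : List α) : editDist x x ≤ 0 :=
  (Align.refl x).editDist_le

theorem Align.length_le {α : Type} {e : ℕ} {x y : List α} (h : Align e x y) :
    y.length ≤ x.length + e := by
  induction h <;> simp <;> omega

theorem length_le_of_editDist_le {α : Type} {x y : List α} {e : ℕ} (h : editDist x y ≤ e) :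
    y.length ≤ x.length + e := by
  obtain ⟨e', he, h⟩ := editDist_le_iff.1 h
  have := h.length_le
  omega

/-! ### Wildcards -/

@[simp] theorem toKey_nil {σ : ℕ} : toKey ([] : Str σ) = [] := rfl
@[simp] theorem toKey_cons {σ : ℕ} (a : Fin σ) (x : Str σ) :
    toKey (a :: x) = some a :: toKey x := rfl
@[simp] theorem length_toKey {σ : ℕ} (x : Str σ) : (toKey x).length = x.length := by simp [toKey]

theorem toKey_injective {σ : ℕ} : Function.Injective (toKey (σ := σ)) :=
  List.map_injective_iff.2 (Option.some_injective _)

@[simp] theorem reduceOption_toKey {σ : ℕ} (x : Str σ) : (toKey x).reduceOption = x := by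
  induction x with
  | nil => rfl
  | cons a x ih => simp [ih]

/-- The number of wildcards of a key. -/
def wild {σ : ℕ} (k : Key σ) : ℕ := k.countP Option.isNone

@[simp] theorem wild_toKey {σ : ℕ} (x : Str σ) : wild (toKey x) = 0 := by
  simp [wild, toKey, List.countP_eq_zero]

theorem toKey_reduceOption {σ : ℕ} {k : Key σ} (hk : wild k = 0) : toKey k.reduceOption = k := by
  induction k with
  | nil => rfl
  | cons a k ih =>
    cases a with
    | none => simp [wild] at hk
    | some a =>
      have : wild k = 0 := by simpa [wild] using hk
      simp [ih this]

theorem wild_fill {σ : ℕ} (c : Fin σ) (k : Key σ) : wild (fill c k) = wild k - 1 := by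
  induction k with
  | nil => rfl
  | cons a k ih =>
    cases a with
    | none => simp [fill, wild]
    | some a => simpa [fill, wild] using ih

/-- A wildcard of a key aligned with a wildcard-free string sits in an edited column, so replacing it
by any character keeps the number of edits. -/
theorem Align.fill {σ : ℕ} (c : Fin σ) {e : ℕ} {x' k : Key σ} (h : Align e x' k) :
    ∀ x : Str σ, x' = toKey x → Align e x' (fill c k) := by
  induction h with
  | nil => intro x _; exact .nil
  | keep a h ih =>
    intro x hx
    cases x with
    | nil => cases hx
    | cons b x =>
      simp only [toKey_cons, List.cons.injEq] at hx
      rw [hx.1]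
      exact .keep _ (ih x hx.2)
  | sub a b h ih =>
    intro x hx
    cases x with
    | nil => cases hx
    | cons a' x =>
      simp only [toKey_cons, List.cons.injEq] at hx
      cases b with
      | none => exact .sub _ _ h
      | some b => exact .sub _ _ (ih x hx.2)
  | ins b h ih =>
    intro x hx
    cases b with
    | none => exact .ins _ h
    | some b => exact .ins _ (ih x hx)
  | del a h ih =>
    intro x hx
    cases x with
    | nil => cases hx
    | cons a' x =>
      simp only [toKey_cons, List.cons.injEq] at hx
      exact .del _ (ih x hx.2)

theorem editDist_fill_le {σ : ℕ} (c : Fin σ) {e : ℕ} {x : Str σ} {k : Key σ}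
    (h : editDist (toKey x) k ≤ e) : editDist (toKey x) (fill c k) ≤ e := by
  obtain ⟨e', he, h⟩ := editDist_le_iff.1 h
  exact editDist_le_iff.2 ⟨e', he, h.fill c x rfl⟩

theorem Align.of_toKey {σ : ℕ} {e : ℕ} {x' y' : Key σ} (h : Align e x' y') :
    ∀ x y : Str σ, x' = toKey x → y' = toKey y → Align e x y := by
  induction h with
  | nil =>
    intro x y hx hy
    rw [toKey_injective (a₁ := x) (a₂ := []) hx.symm, toKey_injective (a₁ := y) (a₂ := []) hy.symm]
    exact .nil
  | keep a h ih =>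
    intro x y hx hy
    rcases x with _ | ⟨b, x⟩ <;> rcases y with _ | ⟨c, y⟩ <;>
      simp only [toKey_nil, toKey_cons, List.cons.injEq, reduceCtorEq] at hx hy
    obtain rfl : b = c := Option.some_injective _ (hx.1.symm.trans hy.1)
    exact .keep _ (ih _ _ hx.2 hy.2)
  | sub a b h ih =>
    intro x y hx hy
    rcases x with _ | ⟨b, x⟩ <;> rcases y with _ | ⟨c, y⟩ <;>
      simp only [toKey_nil, toKey_cons, List.cons.injEq, reduceCtorEq] at hx hy
    exact .sub _ _ (ih _ _ hx.2 hy.2)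
  | ins b h ih =>
    intro x y hx hy
    rcases y with _ | ⟨c, y⟩ <;>
      simp only [toKey_nil, toKey_cons, List.cons.injEq, reduceCtorEq] at hy
    exact .ins _ (ih _ _ hx hy.2)
  | del a h ih =>
    intro x y hx hy
    rcases x with _ | ⟨b, x⟩ <;>
      simp only [toKey_nil, toKey_cons, List.cons.injEq, reduceCtorEq] at hx
    exact .del _ (ih _ _ hx.2 hy)

theorem editDist_le_of_toKey {σ : ℕ} {e : ℕ} {x y : Str σ}
    (h : editDist (toKey x) (toKey y) ≤ e) : editDist x y ≤ e := by
  obtain ⟨e', he, h⟩ := editDist_le_iff.1 h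
  exact editDist_le_iff.2 ⟨e', he, h.of_toKey x y rfl rfl⟩

/-! ### The probes of a query -/

theorem editStep_eraseIdx {α : Type} {x : List α} {i : ℕ} (hi : i < x.length) :
    EditStep x (x.eraseIdx i) := by
  induction x generalizing i with
  | nil => simp at hi
  | cons a x ih =>
    cases i with
    | zero => exact .del [] x a
    | succ i => exact (ih (by simpa using hi)).cons a

theorem editStep_set {α : Type} {x : List α} {i : ℕ} (hi : i < x.length) (b : α) :
    EditStep x (x.set i b) := by
  induction x generalizing i with
  | nil => simp at hi
  | cons a x ih =>
    cases i with
    | zero => exact .sub [] x a b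
    | succ i => exact (ih (by simpa using hi)).cons a

theorem editStep_insertIdx {α : Type} {x : List α} {i : ℕ} (hi : i ≤ x.length) (b : α) :
    EditStep x (x.insertIdx i b) := by
  induction x generalizing i with
  | nil =>
    obtain rfl : i = 0 := by simpa using hi
    exact .ins [] [] b
  | cons a x ih =>
    cases i with
    | zero => exact .ins [] (a :: x) b
    | succ i => exact (ih (by simpa using hi)).cons a

theorem editDist_le_one {α : Type} {x y : List α} (h : EditStep x y) : editDist x y ≤ 1 :=
  h.editDist_le (editDist_self_le y)

theorem editDist_le_two {α : Type} {x y z : List α} (h : EditStep x y) (h' : EditStep y z) :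
    editDist x z ≤ 2 :=
  h.editDist_le (editDist_le_one h')

theorem wild_insertIdx {σ : ℕ} {k : Key σ} {i : ℕ} (hi : i ≤ k.length) :
    wild (k.insertIdx i none) = wild k + 1 := by
  rw [wild, (List.perm_insertIdx none k hi).countP_eq]
  simp [wild]

theorem wild_set {σ : ℕ} {k : Key σ} {i : ℕ} (hi : i < k.length) (h : k[i] ≠ none) :
    wild (k.set i none) = wild k + 1 := by
  rw [wild, List.countP_set hi]
  simp [wild, h]

theorem wild_eraseIdx {σ : ℕ} {k : Key σ} (h : wild k = 0) (i : ℕ) : wild (k.eraseIdx i) = 0 :=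
  Nat.eq_zero_of_le_zero (((List.eraseIdx_sublist k i).countP_le).trans_eq h)

theorem getElem_ne_none {σ : ℕ} {k : Key σ} (h : wild k = 0) {i : ℕ} (hi : i < k.length) :
    k[i] ≠ none := by
  intro h'
  have := List.countP_eq_zero.1 h k[i] (List.getElem_mem hi)
  simp [h'] at this

/-- Probes have at most two edits, and the number of their wildcards determines the table that is
searched for them. -/
theorem probes0_spec {σ : ℕ} {x k : Key σ} (hx : wild x = 0) (hk : k ∈ probes0 x) :
    editDist x k ≤ 2 ∧ wild k = 0 := by
  simp only [probes0, List.mem_append, List.mem_singleton, List.mem_map, List.mem_flatMap,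
    List.mem_range] at hk
  rcases hk with (rfl | ⟨i, hi, rfl⟩) | ⟨j, hj, i, hi, rfl⟩
  · exact ⟨(editDist_self_le _).trans (by norm_num), hx⟩
  · exact ⟨(editDist_le_one (editStep_eraseIdx hi)).trans (by norm_num), wild_eraseIdx hx _⟩
  · have hi' : i < (x.eraseIdx j).length := by rw [List.length_eraseIdx_of_lt hj]; omega
    exact ⟨editDist_le_two (editStep_eraseIdx hj) (editStep_eraseIdx hi'),
      wild_eraseIdx (wild_eraseIdx hx _) _⟩

theorem oneWild_spec {σ : ℕ} {x k : Key σ} (hx : wild x = 0) (hk : k ∈ oneWild x) :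
    EditStep x k ∧ wild k = 1 := by
  simp only [oneWild, List.mem_append, List.mem_map, List.mem_range] at hk
  rcases hk with ⟨i, hi, rfl⟩ | ⟨i, hi, rfl⟩
  · exact ⟨editStep_set hi _, by rw [wild_set hi (getElem_ne_none hx hi), hx]⟩
  · have hi : i ≤ x.length := by omega
    exact ⟨editStep_insertIdx hi _, by rw [wild_insertIdx hi, hx]⟩

theorem probes1_spec {σ : ℕ} {x k : Key σ} (hx : wild x = 0) (hk : k ∈ probes1 x) :
    editDist x k ≤ 2 ∧ wild k = 1 := by
  simp only [probes1, List.mem_append, List.mem_flatMap, List.mem_range] at hk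
  rcases hk with hk | ⟨i, hi, hk⟩
  · obtain ⟨h, h'⟩ := oneWild_spec hx hk
    exact ⟨(editDist_le_one h).trans (by norm_num), h'⟩
  · obtain ⟨h, h'⟩ := oneWild_spec (wild_eraseIdx hx _) hk
    exact ⟨editDist_le_two (editStep_eraseIdx hi) h, h'⟩

theorem probes2_spec {σ : ℕ} {x k : Key σ} (hx : wild x = 0) (hk : k ∈ probes2 x) :
    editDist x k ≤ 2 ∧ wild k = 2 := by
  simp only [probes2, List.mem_append, List.mem_flatMap, List.mem_map, List.mem_range] at hk
  rcases hk with (⟨j, hj, i, hi, rfl⟩ | ⟨j, hj, i, hi, rfl⟩) | ⟨j, hj, i, hi, rfl⟩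
  · have hi' : i < (x.set j none).length := by rw [List.length_set]; omega
    have hij : (x.set j none)[i] ≠ none := by
      rw [List.getElem_set_ne (by omega)]
      exact getElem_ne_none hx _
    exact ⟨editDist_le_two (editStep_set hj _) (editStep_set hi' _),
      by rw [wild_set hi' hij, wild_set hj (getElem_ne_none hx hj), hx]⟩
  · have hi' : i ≤ (x.set j none).length := by rw [List.length_set]; omega
    exact ⟨editDist_le_two (editStep_set hj _) (editStep_insertIdx hi' _),
      by rw [wild_insertIdx hi', wild_set hj (getElem_ne_none hx hj), hx]⟩
  · have hj : j ≤ x.length := by omega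
    have hi' : i ≤ (x.insertIdx j none).length := by
      rw [List.length_insertIdx_of_le_length hj]; omega
    exact ⟨editDist_le_two (editStep_insertIdx hj _) (editStep_insertIdx hi' _),
      by rw [wild_insertIdx hi', wild_insertIdx hj, hx]⟩

/-- `AlignKey d s i x y k`: an alignment of `x` with `y` with `d` deletions, `s` substitutions and `i`
insertions, where `k` is `y` with the substituted and inserted characters replaced by wildcards. -/
inductive AlignKey {σ : ℕ} : ℕ → ℕ → ℕ → Str σ → Str σ → Key σ → Prop
  | nil : AlignKey 0 0 0 [] [] []
  | keep {d s i : ℕ} {x y : Str σ} {k : Key σ} (a : Fin σ) :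
      AlignKey d s i x y k → AlignKey d s i (a :: x) (a :: y) (some a :: k)
  | sub {d s i : ℕ} {x y : Str σ} {k : Key σ} (a b : Fin σ) :
      AlignKey d s i x y k → AlignKey d (s + 1) i (a :: x) (b :: y) (none :: k)
  | ins {d s i : ℕ} {x y : Str σ} {k : Key σ} (b : Fin σ) :
      AlignKey d s i x y k → AlignKey d s (i + 1) x (b :: y) (none :: k)
  | del {d s i : ℕ} {x y : Str σ} {k : Key σ} (a : Fin σ) :
      AlignKey d s i x y k → AlignKey (d + 1) s i (a :: x) y k

theorem Align.exists_alignKey {σ : ℕ} {e : ℕ} {x y : Str σ} (h : Align e x y) :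
    ∃ d s i k, d + s + i = e ∧ AlignKey d s i x y k := by
  induction h with
  | nil => exact ⟨0, 0, 0, [], rfl, .nil⟩
  | keep a _ ih =>
    obtain ⟨d, s, i, k, he, h⟩ := ih
    exact ⟨d, s, i, _, he, .keep a h⟩
  | sub a b _ ih =>
    obtain ⟨d, s, i, k, he, h⟩ := ih
    exact ⟨d, s + 1, i, _, by omega, .sub a b h⟩
  | ins b _ ih =>
    obtain ⟨d, s, i, k, he, h⟩ := ih
    exact ⟨d, s, i + 1, _, by omega, .ins b h⟩
  | del a _ ih =>
    obtain ⟨d, s, i, k, he, h⟩ := ih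
    exact ⟨d + 1, s, i, _, by omega, .del a h⟩

namespace AlignKey

variable {σ : ℕ} {d s i : ℕ} {x y : Str σ} {k : Key σ}

theorem key_eq_zero (h : AlignKey d s i x y k) (hw : s + i = 0) : k = toKey y := by
  induction h with
  | nil => rfl
  | keep a _ ih => rw [ih hw, toKey_cons]
  | sub => omega
  | ins => omega
  | del a _ ih => exact ih hw

theorem key_eq_one (h : AlignKey d s i x y k) (hw : s + i = 1) :
    ∃ p < y.length, k = (toKey y).set p none := by
  induction h with
  | nil => omega
  | keep a _ ih =>
    obtain ⟨p, hp, rfl⟩ := ih hw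
    exact ⟨p + 1, by simpa using hp, rfl⟩
  | sub a b h _ => exact ⟨0, by simp, by rw [h.key_eq_zero (by omega)]; rfl⟩
  | ins b h _ => exact ⟨0, by simp, by rw [h.key_eq_zero (by omega)]; rfl⟩
  | del a _ ih => exact ih hw

theorem key_eq_two (h : AlignKey d s i x y k) (hw : s + i = 2) :
    ∃ p q, p < q ∧ q < y.length ∧ k = ((toKey y).set p none).set q none := by
  induction h with
  | nil => omega
  | keep a _ ih =>
    obtain ⟨p, q, hp, hq, rfl⟩ := ih hw
    exact ⟨p + 1, q + 1, by omega, by simpa using hq, rfl⟩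
  | sub a b h _ =>
    obtain ⟨q, hq, rfl⟩ := h.key_eq_one (by omega)
    exact ⟨0, q + 1, by omega, by simpa using hq, rfl⟩
  | ins b h _ =>
    obtain ⟨q, hq, rfl⟩ := h.key_eq_one (by omega)
    exact ⟨0, q + 1, by omega, by simpa using hq, rfl⟩
  | del a _ ih => exact ih hw

theorem eq_of_no_edit (h : AlignKey d s i x y k) (hd : d = 0) (hs : s = 0) (hi : i = 0) :
    k = toKey x := by
  induction h with
  | nil => rfl
  | keep a _ ih => rw [ih hd hs hi, toKey_cons]
  | sub => omega
  | ins => omega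
  | del => omega

theorem eq_of_del (h : AlignKey d s i x y k) (hd : d = 1) (hs : s = 0) (hi : i = 0) :
    ∃ p < x.length, k = (toKey x).eraseIdx p := by
  induction h with
  | nil => omega
  | keep a _ ih =>
    obtain ⟨p, hp, rfl⟩ := ih hd hs hi
    exact ⟨p + 1, by simpa using hp, rfl⟩
  | sub => omega
  | ins => omega
  | del a h _ => exact ⟨0, by simp, by rw [h.eq_of_no_edit (by omega) hs hi]; rfl⟩

theorem eq_of_del_del (h : AlignKey d s i x y k) (hd : d = 2) (hs : s = 0) (hi : i = 0) :
    ∃ p q, p < q ∧ q < x.length ∧ k = ((toKey x).eraseIdx q).eraseIdx p := by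
  induction h with
  | nil => omega
  | keep a _ ih =>
    obtain ⟨p, q, hp, hq, rfl⟩ := ih hd hs hi
    exact ⟨p + 1, q + 1, by omega, by simpa using hq, rfl⟩
  | sub => omega
  | ins => omega
  | del a h _ =>
    obtain ⟨q, hq, rfl⟩ := h.eq_of_del (by omega) hs hi
    exact ⟨0, q + 1, by omega, by simpa using hq, rfl⟩

theorem eq_of_sub (h : AlignKey d s i x y k) (hd : d = 0) (hs : s = 1) (hi : i = 0) :
    ∃ p < x.length, k = (toKey x).set p none := by
  induction h with
  | nil => omega
  | keep a _ ih =>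
    obtain ⟨p, hp, rfl⟩ := ih hd hs hi
    exact ⟨p + 1, by simpa using hp, rfl⟩
  | sub a b h _ => exact ⟨0, by simp, by rw [h.eq_of_no_edit hd (by omega) hi]; rfl⟩
  | ins => omega
  | del => omega

theorem eq_of_ins (h : AlignKey d s i x y k) (hd : d = 0) (hs : s = 0) (hi : i = 1) :
    ∃ p ≤ x.length, k = (toKey x).insertIdx p none := by
  induction h with
  | nil => omega
  | keep a _ ih =>
    obtain ⟨p, hp, rfl⟩ := ih hd hs hi
    exact ⟨p + 1, by simpa using hp, rfl⟩
  | sub => omega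
  | ins b h _ => exact ⟨0, by simp, by rw [h.eq_of_no_edit hd hs (by omega)]; rfl⟩
  | del => omega

theorem mem_oneWild (h : AlignKey d s i x y k) (hd : d = 0) (hw : s + i = 1) :
    k ∈ oneWild (toKey x) := by
  simp only [oneWild, List.mem_append, List.mem_map, List.mem_range, length_toKey]
  rcases Nat.eq_zero_or_pos s with hs | hs
  · obtain ⟨p, hp, rfl⟩ := h.eq_of_ins hd hs (by omega)
    exact Or.inr ⟨p, by omega, rfl⟩
  · obtain ⟨p, hp, rfl⟩ := h.eq_of_sub hd (by omega) (by omega)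
    exact Or.inl ⟨p, hp, rfl⟩

theorem eq_of_del_wild (h : AlignKey d s i x y k) (hd : d = 1) (hw : s + i = 1) :
    ∃ p < x.length, k ∈ oneWild ((toKey x).eraseIdx p) := by
  have key : ∀ (a : Fin σ) (x : Key σ) (k : Key σ), k ∈ oneWild x →
      some a :: k ∈ oneWild (some a :: x) := by
    intro a x k hk
    simp only [oneWild, List.mem_append, List.mem_map, List.mem_range, List.length_cons] at hk ⊢
    rcases hk with ⟨p, hp, rfl⟩ | ⟨p, hp, rfl⟩
    · exact Or.inl ⟨p + 1, by omega, rfl⟩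
    · exact Or.inr ⟨p + 1, by omega, rfl⟩
  induction h with
  | nil => omega
  | keep a _ ih =>
    obtain ⟨p, hp, hk⟩ := ih hd hw
    exact ⟨p + 1, by simpa using hp, key a _ _ hk⟩
  | sub a b h _ =>
    obtain ⟨p, hp, rfl⟩ := h.eq_of_del hd (by omega) (by omega)
    refine ⟨p + 1, by simpa using hp, ?_⟩
    simp only [oneWild, List.mem_append, List.mem_map, List.mem_range]
    exact Or.inl ⟨0, by simp, rfl⟩
  | ins b h _ =>
    obtain ⟨p, hp, rfl⟩ := h.eq_of_del hd (by omega) (by omega)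
    refine ⟨p, hp, ?_⟩
    simp only [oneWild, List.mem_append, List.mem_map, List.mem_range]
    exact Or.inr ⟨0, by simp, rfl⟩
  | del a h _ => exact ⟨0, by simp, h.mem_oneWild (by omega) hw⟩

theorem eq_of_sub_sub (h : AlignKey d s i x y k) (hd : d = 0) (hs : s = 2) (hi : i = 0) :
    ∃ p q, p < q ∧ q < x.length ∧ k = ((toKey x).set q none).set p none := by
  induction h with
  | nil => omega
  | keep a _ ih =>
    obtain ⟨p, q, hp, hq, rfl⟩ := ih hd hs hi
    exact ⟨p + 1, q + 1, by omega, by simpa using hq, rfl⟩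
  | sub a b h _ =>
    obtain ⟨q, hq, rfl⟩ := h.eq_of_sub hd (by omega) hi
    exact ⟨0, q + 1, by omega, by simpa using hq, rfl⟩
  | ins => omega
  | del => omega

theorem eq_of_sub_ins (h : AlignKey d s i x y k) (hd : d = 0) (hs : s = 1) (hi : i = 1) :
    ∃ p q, p ≤ x.length ∧ q < x.length ∧ k = ((toKey x).set q none).insertIdx p none := by
  induction h with
  | nil => omega
  | keep a _ ih =>
    obtain ⟨p, q, hp, hq, rfl⟩ := ih hd hs hi
    exact ⟨p + 1, q + 1, by simpa using hp, by simpa using hq, rfl⟩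
  | sub a b h _ =>
    obtain ⟨p, hp, rfl⟩ := h.eq_of_ins hd (by omega) hi
    exact ⟨p + 1, 0, by simpa using hp, by simp, rfl⟩
  | ins b h _ =>
    obtain ⟨q, hq, rfl⟩ := h.eq_of_sub hd hs (by omega)
    exact ⟨0, q, by simp, hq, rfl⟩
  | del => omega

theorem eq_of_ins_ins (h : AlignKey d s i x y k) (hd : d = 0) (hs : s = 0) (hi : i = 2) :
    ∃ p q, p ≤ q ∧ q ≤ x.length ∧ k = ((toKey x).insertIdx q none).insertIdx p none := by
  induction h with
  | nil => omega
  | keep a _ ih =>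
    obtain ⟨p, q, hp, hq, rfl⟩ := ih hd hs hi
    exact ⟨p + 1, q + 1, by omega, by simpa using hq, rfl⟩
  | sub => omega
  | ins b h _ =>
    obtain ⟨q, hq, rfl⟩ := h.eq_of_ins hd hs (by omega)
    exact ⟨0, q, by omega, hq, rfl⟩
  | del => omega

end AlignKey

/-- Every string within distance two of `x` agrees, outside the wildcards, with some probe. -/
theorem exists_probe {σ : ℕ} {x y : Str σ} (h : editDist x y ≤ 2) :
    toKey y ∈ probes0 (toKey x) ∨
    (∃ p < y.length, (toKey y).set p none ∈ probes1 (toKey x)) ∨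
    ∃ p q, p < q ∧ q < y.length ∧ ((toKey y).set p none).set q none ∈ probes2 (toKey x) := by
  obtain ⟨e, he, h'⟩ := editDist_le_iff.1 h
  obtain ⟨d, s, i, k, rfl, h⟩ := h'.exists_alignKey
  obtain hw | hw | hw : s + i = 0 ∨ s + i = 1 ∨ s + i = 2 := by omega
  · left
    rw [← h.key_eq_zero hw]
    simp only [probes0, List.mem_append, List.mem_singleton, List.mem_map, List.mem_flatMap,
      List.mem_range, length_toKey]
    obtain hd | hd | hd : d = 0 ∨ d = 1 ∨ d = 2 := by omega
    · exact Or.inl (Or.inl (h.eq_of_no_edit hd (by omega) (by omega)))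
    · obtain ⟨p, hp, rfl⟩ := h.eq_of_del hd (by omega) (by omega)
      exact Or.inl (Or.inr ⟨p, hp, rfl⟩)
    · obtain ⟨p, q, hp, hq, rfl⟩ := h.eq_of_del_del hd (by omega) (by omega)
      exact Or.inr ⟨q, hq, p, hp, rfl⟩
  · right; left
    obtain ⟨p, hp, hk⟩ := h.key_eq_one hw
    refine ⟨p, hp, ?_⟩
    rw [← hk]
    simp only [probes1, List.mem_append, List.mem_flatMap, List.mem_range, length_toKey]
    obtain hd | hd : d = 0 ∨ d = 1 := by omega
    · exact Or.inl (h.mem_oneWild hd hw)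
    · exact Or.inr (h.eq_of_del_wild hd hw)
  · right; right
    obtain ⟨p, q, hp, hq, hk⟩ := h.key_eq_two hw
    refine ⟨p, q, hp, hq, ?_⟩
    rw [← hk]
    simp only [probes2, List.mem_append, List.mem_flatMap, List.mem_map, List.mem_range,
      length_toKey]
    obtain ⟨hs, hi⟩ | ⟨hs, hi⟩ | ⟨hs, hi⟩ : (s = 2 ∧ i = 0) ∨ (s = 1 ∧ i = 1) ∨ (s = 0 ∧ i = 2) := by
      omega
    · obtain ⟨p, q, hp, hq, rfl⟩ := h.eq_of_sub_sub (by omega) hs hi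
      exact Or.inl (Or.inl ⟨q, hq, p, hp, rfl⟩)
    · obtain ⟨p, q, hp, hq, rfl⟩ := h.eq_of_sub_ins (by omega) hs hi
      exact Or.inl (Or.inr ⟨q, hq, p, by omega, rfl⟩)
    · obtain ⟨p, q, hp, hq, rfl⟩ := h.eq_of_ins_ins (by omega) hs hi
      exact Or.inr ⟨q, by omega, p, by omega, rfl⟩

theorem length_probes0_le {σ : ℕ} (x : Key σ) : (probes0 x).length ≤ (x.length + 1) ^ 2 := by
  simp only [probes0, List.length_append, List.length_map, List.length_flatMap, List.length_range,
    List.length_singleton]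
  have : ((List.range x.length).map fun j => j).sum ≤ x.length • x.length := by
    simpa using List.sum_le_card_nsmul ((List.range x.length).map fun j => j) x.length
      (by simp; intro i hi; omega)
  simp only [smul_eq_mul] at this
  nlinarith

theorem length_oneWild {σ : ℕ} (x : Key σ) : (oneWild x).length = 2 * x.length + 1 := by
  simp [oneWild]; omega

theorem length_probes1_le {σ : ℕ} (x : Key σ) : (probes1 x).length ≤ 2 * (x.length + 1) ^ 2 := by
  simp only [probes1, List.length_append, List.length_flatMap, length_oneWild]
  have : ((List.range x.length).map fun i => 2 * (x.eraseIdx i).length + 1).sum ≤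
      x.length • (2 * x.length) := by
    simpa using List.sum_le_card_nsmul
      ((List.range x.length).map fun i => 2 * (x.eraseIdx i).length + 1) (2 * x.length) (by
        simp only [List.mem_map, List.mem_range]
        rintro _ ⟨i, hi, rfl⟩
        rw [List.length_eraseIdx_of_lt hi]
        omega)
  simp only [smul_eq_mul] at this
  nlinarith

theorem length_probes2_le {σ : ℕ} (x : Key σ) : (probes2 x).length ≤ 3 * (x.length + 1) ^ 2 := by
  simp only [probes2, List.length_append, List.length_map, List.length_flatMap, List.length_range]
  have h₁ : ((List.range x.length).map fun j => j).sum ≤ x.length • x.length := by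
    simpa using List.sum_le_card_nsmul ((List.range x.length).map fun j => j) x.length
      (by simp; intro i hi; omega)
  have h₂ : ((List.range x.length).map fun _ => x.length + 1).sum ≤
      x.length • (x.length + 1) := by simp
  have h₃ : ((List.range (x.length + 1)).map fun j => j + 1).sum ≤
      (x.length + 1) • (x.length + 1) := by
    simpa only [List.length_map, List.length_range] using
      List.sum_le_card_nsmul ((List.range (x.length + 1)).map fun j => j + 1) (x.length + 1)
        (by simp)
  simp only [smul_eq_mul] at h₁ h₂ h₃
  nlinarith

/-! ### Timed computations -/

namespace Timed

variable {α β S : Type}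

@[simp] theorem val_pure (a : α) : (pure a : Timed α).val = a := rfl
@[simp] theorem cost_pure (a : α) : (pure a : Timed α).cost = 0 := rfl
@[simp] theorem val_bind (x : Timed α) (f : α → Timed β) : (x >>= f).val = (f x.val).val := rfl
@[simp] theorem cost_bind (x : Timed α) (f : α → Timed β) :
    (x >>= f).cost = x.cost + (f x.val).cost := rfl
@[simp] theorem cost_tick (k : ℕ) : (tick k).cost = k := rfl
@[simp] theorem val_readMem (a : ℕ → α) (i : ℕ) : (readMem a i).val = a i := rfl
@[simp] theorem cost_readMem (a : ℕ → α) (i : ℕ) : (readMem a i).cost = 1 := rfl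

theorem val_loop (f : S → α → Timed S) (s : S) (l : List α) :
    (loop f s l).val = l.foldl (fun s a => (f s a).val) s := by
  induction l generalizing s with
  | nil => rfl
  | cons a l ih => simp [loop, ih]

theorem cost_loop_le (f : S → α → Timed S) (B : α → ℕ) (s : S) (l : List α)
    (H : ∀ l₁ a l₂, l = l₁ ++ a :: l₂ →
      (f (l₁.foldl (fun s a => (f s a).val) s) a).cost ≤ B a) :
    (loop f s l).cost ≤ (l.map fun a => 1 + B a).sum := by
  induction l generalizing s with
  | nil => simp [loop]
  | cons a l ih =>
    have h₀ := H [] a l rfl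
    have := ih (f s a).val fun l₁ b l₂ h => H (a :: l₁) b l₂ (by rw [h]; rfl)
    simp only [List.foldl_nil] at h₀
    simp only [loop, cost_bind, cost_tick, List.map_cons, List.sum_cons]
    omega

theorem val_collect (f : α → Timed (List β)) (l : List α) :
    (collect f l).val = l.flatMap fun a => (f a).val := by
  induction l with
  | nil => rfl
  | cons a l ih => simp [collect, ih]

theorem cost_collect (f : α → Timed (List β)) (l : List α) :
    (collect f l).cost = (l.map fun a => 1 + (f a).cost).sum := by
  induction l with
  | nil => rfl
  | cons a l ih => simp [collect, ih, add_assoc]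

end Timed

/-! ### Linear probing -/

section LinearProbing

variable {E : Type}

theorem mod_add_succ_mod (t i x : ℕ) : ((i + 1) % t + x) % t = (i + (x + 1)) % t := by
  rw [Nat.mod_add_mod]; congr 1; omega

/-- An insertion puts the element into the first empty slot, if one is met in time. -/
theorem insertFrom_val {t sz : ℕ} (e : E) {f : ℕ} {a : ℕ → Option E} {i : ℕ} (hi : i < t) :
    (∃ j < f, (∀ x < j, a ((i + x) % t) ≠ none) ∧ a ((i + j) % t) = none ∧
      (insertFrom t sz e f a i).val = Function.update a ((i + j) % t) (some e)) ∨
    ((insertFrom t sz e f a i).val = a ∧ ∀ j < f, a ((i + j) % t) ≠ none) := by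
  induction f generalizing i with
  | zero => right; simp [insertFrom]
  | succ f ih =>
    have hmod : (i + 0) % t = i := by simp [Nat.mod_eq_of_lt hi]
    cases h : a i with
    | none =>
      left
      exact ⟨0, by omega, by simp, by rw [hmod, h], by rw [hmod]; simp [insertFrom, h]⟩
    | some b =>
      have hval : (insertFrom t sz e (f + 1) a i).val =
          (insertFrom t sz e f a ((i + 1) % t)).val := by simp [insertFrom, h]
      rw [hval]
      rcases ih (Nat.mod_lt (i + 1) (by omega)) with ⟨j, hj, h₁, h₂, h₃⟩ | ⟨h₁, h₂⟩
      · left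
        refine ⟨j + 1, by omega, ?_, ?_, ?_⟩
        · rintro (_ | x) hx
          · rw [hmod, h]; simp
          · rw [← mod_add_succ_mod]; exact h₁ x (by omega)
        · rwa [← mod_add_succ_mod t i j]
        · rwa [← mod_add_succ_mod t i j]
      · right
        refine ⟨h₁, ?_⟩
        rintro (_ | x) hx
        · rw [hmod, h]; simp
        · rw [← mod_add_succ_mod]; exact h₂ x (by omega)

theorem insertFrom_val_sz (t sz : ℕ) (e : E) (f : ℕ) (a : ℕ → Option E) (i : ℕ) :
    (insertFrom t sz e f a i).val = (insertFrom t 0 e f a i).val := by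
  induction f generalizing i with
  | zero => rfl
  | succ f ih => cases h : a i <;> simp [insertFrom, h, ih]

/-- The number of occupied slots met by a search from slot `i` of a table with `t` slots, where at
most `f` slots are looked at. -/
def runLen (t : ℕ) (a : ℕ → Option E) : ℕ → ℕ → ℕ
  | 0, _ => 0
  | f + 1, i => if (a i).isSome then 1 + runLen t a f ((i + 1) % t) else 0

theorem insertFrom_cost_le (t sz : ℕ) (e : E) (f : ℕ) (a : ℕ → Option E) (i : ℕ) :
    (insertFrom t sz e f a i).cost ≤ runLen t a f i + 1 + sz := by
  induction f generalizing i with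
  | zero => simp [insertFrom]
  | succ f ih =>
    cases h : a i with
    | none => simp [insertFrom, h, runLen]
    | some b =>
      have := ih ((i + 1) % t)
      simp [insertFrom, h, runLen]
      omega

/-- The slots of a table after the insertion of the elements of `L`, each given with its home slot,
where the probing starts. -/
def fillTable (t : ℕ) (L : List (ℕ × E)) : ℕ → Option E :=
  L.foldl (fun a p => (insertFrom t 0 p.2 t a p.1).val) fun _ => none

@[simp] theorem fillTable_nil (t : ℕ) : fillTable t ([] : List (ℕ × E)) = fun _ => none := rfl

@[simp] theorem fillTable_concat (t : ℕ) (L : List (ℕ × E)) (p : ℕ × E) :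
    fillTable t (L ++ [p]) = (insertFrom t 0 p.2 t (fillTable t L) p.1).val := by
  simp [fillTable]

theorem fillTable_eq_some {t : ℕ} {L : List (ℕ × E)} (hL : ∀ p ∈ L, p.1 < t) {i : ℕ} {e : E}
    (h : fillTable t L i = some e) : ∃ v, (v, e) ∈ L := by
  induction L using List.reverseRecOn generalizing i with
  | nil => simp at h
  | append_singleton L p ih =>
    have ih := fun i h => ih (i := i) (fun q hq => hL q (by simp [hq])) h
    rw [fillTable_concat] at h
    rcases insertFrom_val (sz := 0) p.2 (f := t) (a := fillTable t L) (hL p (by simp)) with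
      ⟨j, -, -, -, h₃⟩ | ⟨h₁, -⟩
    · rw [h₃, Function.update_apply] at h
      split at h
      · exact ⟨p.1, by cases h; simp⟩
      · obtain ⟨v, hv⟩ := ih i h
        exact ⟨v, by simp [hv]⟩
    · rw [h₁] at h
      obtain ⟨v, hv⟩ := ih i h
      exact ⟨v, by simp [hv]⟩

/-- If a set `I` of slots can be entered by probing only from `I` itself or from an empty slot, then
every element stored in `I` has its home in `I`. This is stated with numbers of elements. -/
theorem card_occupied_le_countP {t : ℕ} {L : List (ℕ × E)} (hL : ∀ p ∈ L, p.1 < t) {I : Finset ℕ}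
    (hI : ∀ i < t, (i + 1) % t ∈ I → i ∈ I ∨ fillTable t L i = none) :
    (I.filter fun i => (fillTable t L i).isSome).card ≤ L.countP fun p => p.1 ∈ I := by
  induction L using List.reverseRecOn with
  | nil => simp
  | append_singleton L p ih =>
    rw [fillTable_concat] at hI ⊢
    have hp : p.1 < t := hL p (by simp)
    have ih := ih fun q hq => hL q (by simp [hq])
    rw [List.countP_append]
    rcases insertFrom_val (sz := 0) p.2 (f := t) (a := fillTable t L) hp with
      ⟨j, -, h₁, h₂, h₃⟩ | ⟨h₁, -⟩
    · rw [h₃] at hI ⊢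
      set a := fillTable t L
      set q := (p.1 + j) % t with hq
      have hmono : ∀ i, Function.update a q (some p.2) i = none → a i = none := by
        intro i hi
        rw [Function.update_apply] at hi
        split at hi
        · simp at hi
        · exact hi
      have ih := ih fun i hi h => (hI i hi h).imp_right (hmono i)
      by_cases hqI : q ∈ I
      · -- walking backwards along the occupied slots that were probed, one never leaves `I`
        have hback : ∀ x ≤ j, (p.1 + (j - x)) % t ∈ I := by
          intro x hx
          induction x with
          | zero => exact hqI
          | succ x ihx =>
            have hlt : (p.1 + (j - (x + 1))) % t < t := Nat.mod_lt _ (by omega)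
            have hne := h₁ (j - (x + 1)) (by omega)
            refine (hI _ hlt ?_).resolve_right fun h => hne (hmono _ h)
            rw [Nat.mod_add_mod]
            have := ihx (by omega)
            rwa [show p.1 + (j - x) = p.1 + (j - (x + 1)) + 1 by omega] at this
        have hpI : p.1 ∈ I := by
          have := hback j le_rfl
          rwa [Nat.sub_self, Nat.add_zero, Nat.mod_eq_of_lt hp] at this
        have : (I.filter fun i => (Function.update a q (some p.2) i).isSome) ⊆
            insert q (I.filter fun i => (a i).isSome) := by
          intro i hi
          rw [Finset.mem_filter, Function.update_apply] at hi
          rw [Finset.mem_insert, Finset.mem_filter]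
          split at hi
          · left; assumption
          · right; exact hi
        have := (Finset.card_le_card this).trans (Finset.card_insert_le _ _)
        simp [hpI]
        omega
      · have : (I.filter fun i => (Function.update a q (some p.2) i).isSome) =
            I.filter fun i => (a i).isSome := by
          refine Finset.filter_congr fun i hi => ?_
          rw [Function.update_of_ne (fun h : i = q => hqI (h ▸ hi))]
        rw [this]
        omega
    · rw [h₁] at hI ⊢
      exact (ih hI).trans (Nat.le_add_right _ _)

theorem card_occupied_le_length {t : ℕ} {L : List (ℕ × E)} (hL : ∀ p ∈ L, p.1 < t) :
    ((Finset.range t).filter fun i => (fillTable t L i).isSome).card ≤ L.length :=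
  (card_occupied_le_countP hL fun _ hi _ => Or.inl (Finset.mem_range.2 hi)).trans
    List.countP_le_length

theorem exists_empty_slot {t : ℕ} {L : List (ℕ × E)} (hL : ∀ p ∈ L, p.1 < t) (hlen : L.length < t) :
    ∃ e < t, fillTable t L e = none := by
  by_contra! h
  have : (Finset.range t).filter (fun i => (fillTable t L i).isSome) = Finset.range t := by
    rw [Finset.filter_eq_self]
    intro i hi
    exact Option.isSome_iff_ne_none.2 (h i (Finset.mem_range.1 hi))
  have h' := card_occupied_le_length hL
  rw [this, Finset.card_range] at h'
  omega

/-- Every slot is reached by going forward from slot `v`. -/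
theorem exists_add_mod_eq {t v e : ℕ} (he : e < t) (hv : v < t) :
    ∃ j < t, (v + j) % t = e := by
  by_cases h : v ≤ e
  · exact ⟨e - v, by omega, by rw [Nat.add_sub_cancel' h, Nat.mod_eq_of_lt he]⟩
  · refine ⟨e + t - v, by omega, ?_⟩
    rw [show v + (e + t - v) = e + t by omega, Nat.add_mod_right, Nat.mod_eq_of_lt he]

/-- In a table that is not full, every element can be reached from its home slot through occupied
slots. -/
theorem fillTable_reach {t : ℕ} {L : List (ℕ × E)} (hL : ∀ p ∈ L, p.1 < t) (hlen : L.length ≤ t)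
    {p : ℕ × E} (hp : p ∈ L) :
    ∃ j < t, fillTable t L ((p.1 + j) % t) = some p.2 ∧
      ∀ x < j, fillTable t L ((p.1 + x) % t) ≠ none := by
  induction L using List.reverseRecOn with
  | nil => simp at hp
  | append_singleton L q ih =>
    have hL' : ∀ p ∈ L, p.1 < t := fun q hq => hL q (by simp [hq])
    rw [List.length_append, List.length_singleton] at hlen
    have ih := ih hL' (by omega)
    have hq : q.1 < t := hL q (by simp)
    rw [fillTable_concat]
    rcases insertFrom_val (sz := 0) q.2 (f := t) (a := fillTable t L) hq with
      ⟨j, hj, h₁, h₂, h₃⟩ | ⟨-, h₁⟩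
    · rw [h₃]
      have hmono : ∀ i, fillTable t L i ≠ none →
          Function.update (fillTable t L) ((q.1 + j) % t) (some q.2) i = fillTable t L i := by
        intro i hi
        exact Function.update_of_ne (fun h : i = _ => hi (by rw [h]; exact h₂)) _ _
      rcases List.mem_append.1 hp with hp | hp
      · obtain ⟨j', hj', h₄, h₅⟩ := ih hp
        refine ⟨j', hj', ?_, fun x hx => ?_⟩
        · rw [hmono _ (by rw [h₄]; simp), h₄]
        · rw [hmono _ (h₅ x hx)]
          exact h₅ x hx
      · obtain rfl := List.mem_singleton.1 hp
        refine ⟨j, hj, Function.update_self _ _ _, fun x hx => ?_⟩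
        rw [hmono _ (h₁ x hx)]
        exact h₁ x hx
    · obtain ⟨e, he, h₂⟩ := exists_empty_slot hL' (by omega)
      obtain ⟨j, hj, rfl⟩ := exists_add_mod_eq he hq
      exact absurd h₂ (h₁ j hj)

theorem runLen_le_sum (t : ℕ) (a : ℕ → Option E) (f s : ℕ) (hs : s < t) :
    runLen t a f s ≤ ∑ j ∈ Finset.range f, if ∀ x ≤ j, (a ((s + x) % t)).isSome then 1 else 0 := by
  induction f generalizing s with
  | zero => simp [runLen]
  | succ f ih =>
    rw [runLen, Finset.sum_range_succ']
    split_ifs with h h' h'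
    · have := ih ((s + 1) % t) (Nat.mod_lt _ (by omega))
      rw [add_comm]
      refine Nat.add_le_add_right (this.trans (Finset.sum_le_sum fun j _ => ?_)) 1
      split_ifs with h₁ h₂ h₂
      · exact le_rfl
      · refine absurd ?_ h₂
        rintro (_ | x) hx
        · simpa [Nat.mod_eq_of_lt hs] using h
        · rw [← mod_add_succ_mod]; exact h₁ x (by omega)
      · simp
      · simp
    · refine absurd ?_ h'
      intro x hx
      obtain rfl : x = 0 := by omega
      simpa [Nat.mod_eq_of_lt hs] using h
    · simp
    · simp

/-- The cyclic interval of slots that starts `i` slots before slot `s` and ends `j` slots after. -/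
def window (t s i j : ℕ) : Finset ℕ :=
  (Finset.range (i + j + 1)).image fun x => (s + t - i + x) % t

/-- The home slots of at least as many elements of `L` as there are slots in some window around `s`
lie in that window, when the slots from `s` to `s + j` are occupied: take the window that starts right
after the last empty slot before `s`. -/
theorem exists_window {t : ℕ} {L : List (ℕ × E)} (hL : ∀ p ∈ L, p.1 < t) (hlen : L.length < t)
    {s j : ℕ} (hs : s < t) (h : ∀ x ≤ j, (fillTable t L ((s + x) % t)).isSome) :
    ∃ i < t, i + j + 1 ≤ L.countP fun p => p.1 ∈ window t s i j := by
  classical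
  set a := fillTable t L
  have hex : ∃ i, i < t ∧ a ((s + t - 1 - i) % t) = none := by
    obtain ⟨e, he, hea⟩ := exists_empty_slot hL hlen
    by_cases hes : s ≤ e
    · refine ⟨s + t - 1 - e, by omega, ?_⟩
      rw [show s + t - 1 - (s + t - 1 - e) = e by omega, Nat.mod_eq_of_lt he]
      exact hea
    · refine ⟨s - 1 - e, by omega, ?_⟩
      rw [show s + t - 1 - (s - 1 - e) = e + t by omega, Nat.add_mod_right, Nat.mod_eq_of_lt he]
      exact hea
  obtain ⟨hi, hie⟩ := Nat.find_spec hex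
  have hmin := fun m => Nat.find_min hex (m := m)
  set i := Nat.find hex
  have hocc : ∀ x ≤ i + j, (a ((s + t - i + x) % t)).isSome := by
    intro x hx
    by_cases hxi : x < i
    · have := hmin (i - 1 - x) (by omega)
      rw [not_and] at this
      have := this (by omega)
      rw [show s + t - 1 - (i - 1 - x) = s + t - i + x by omega] at this
      exact Option.isSome_iff_ne_none.2 this
    · have := h (x - i) (by omega)
      rwa [← Nat.add_mod_right, show s + (x - i) + t = s + t - i + x by omega] at this
  have hlt : i + j + 1 < t := by
    by_contra hcon
    have := hocc (t - 1) (by omega)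
    rw [show s + t - i + (t - 1) = s + t - 1 - i + t by omega, Nat.add_mod_right, hie] at this
    simp at this
  refine ⟨i, hi, ?_⟩
  have hcard : (window t s i j).card = i + j + 1 := by
    rw [window, Finset.card_image_of_injOn, Finset.card_range]
    intro x hx y hy hxy
    simp only [Finset.coe_range, Set.mem_Iio] at hx hy
    exact Nat.ModEq.eq_of_lt_of_lt (Nat.ModEq.add_left_cancel' _ hxy) (by omega) (by omega)
  have hfilter : (window t s i j).filter (fun i => (a i).isSome) = window t s i j := by
    rw [Finset.filter_eq_self]
    intro u hu
    obtain ⟨x, hx, rfl⟩ := Finset.mem_image.1 hu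
    exact hocc x (by rw [Finset.mem_range] at hx; omega)
  rw [← hcard]
  nth_rw 1 [← hfilter]
  refine card_occupied_le_countP hL fun u hu hu' => ?_
  obtain ⟨x, hx, hxu⟩ := Finset.mem_image.1 hu'
  rw [Finset.mem_range] at hx
  cases x with
  | zero =>
    right
    have : s + t - 1 - i ≡ u [MOD t] := by
      refine Nat.ModEq.add_right_cancel' 1 ?_
      rwa [show s + t - 1 - i + 1 = s + t - i + 0 by omega]
    have : u = (s + t - 1 - i) % t := by rw [this, Nat.mod_eq_of_lt hu]
    rw [this]
    exact hie
  | succ x =>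
    left
    have : s + t - i + x ≡ u [MOD t] := Nat.ModEq.add_right_cancel' 1 hxu
    exact Finset.mem_image.2 ⟨x, by rw [Finset.mem_range]; omega,
      by rw [this, Nat.mod_eq_of_lt hu]⟩

/-- The number of occupied slots met from slot `s` on is at most the number of windows around `s` that
are overfull with home slots. -/
theorem runLen_fillTable_le {t : ℕ} {L : List (ℕ × E)} (hL : ∀ p ∈ L, p.1 < t) (hlen : L.length < t)
    {s : ℕ} (hs : s < t) :
    runLen t (fillTable t L) t s ≤ ∑ i ∈ Finset.range t, ∑ j ∈ Finset.range t,
      if i + j + 1 ≤ L.countP (fun p => p.1 ∈ window t s i j) then 1 else 0 := by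
  refine (runLen_le_sum t _ t s hs).trans ?_
  rw [Finset.sum_comm]
  refine Finset.sum_le_sum fun j _ => ?_
  split_ifs with h
  · obtain ⟨i, hi, h'⟩ := exists_window hL hlen hs h
    refine le_trans ?_ (Finset.single_le_sum (fun _ _ => Nat.zero_le _) (Finset.mem_range.2 hi))
    rw [if_pos h']
  · exact Nat.zero_le _

end LinearProbing

/-! ### Compacted tables -/

/-- The ones between two positions are the difference of the ranks of these positions. -/
theorem ones_add_count {bits : ℕ → Bool} {p : ℕ → Prop} [DecidablePred p] {t a b : ℕ}
    (h : ∀ i < t, (bits i = true ↔ p i)) (hab : a ≤ b) (hb : b ≤ t) :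
    Nat.count p a + ones bits a b = Nat.count p b := by
  obtain ⟨m, rfl⟩ := Nat.exists_eq_add_of_le hab
  rw [Nat.count_add, ones, Nat.add_sub_cancel_left, List.range'_eq_map_range, List.countP_map,
    Nat.count]
  congr 1
  refine List.countP_congr fun x hx => ?_
  rw [List.mem_range] at hx
  simpa using h (a + x) (by omega)

section Compaction

variable {E : Type}

/-- What the compaction pass has computed after the first `n` slots. -/
theorem compact_invariant {w δ : ℕ} (hw : 0 < w) (hδ : 0 < δ) (sz : ℕ) (a : ℕ → Option E) (n : ℕ) :
    let st := (loop (compactStep w δ sz a) ⟨0, fun _ => false, fun _ => 0, fun _ => none⟩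
      (List.range n)).val
    st.count = Nat.count (fun i => (a i).isSome) n ∧
    (∀ i < n, st.bits i = (a i).isSome) ∧
    (∀ s, s * (δ * w) < n → st.samples s = Nat.count (fun i => (a i).isSome) (s * (δ * w))) ∧
    ∀ i < n, (a i).isSome → st.items (Nat.count (fun i => (a i).isSome) i) = a i := by
  induction n with
  | zero => simp [loop]
  | succ n ih =>
    have hpos : 0 < δ * w := Nat.mul_pos hδ hw
    simp only [val_loop, List.range_succ, List.foldl_append, List.foldl_cons, List.foldl_nil]
      at ih ⊢
    set st := (List.range n).foldl (fun s i => (compactStep w δ sz a s i).val)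
      ⟨0, fun _ => false, fun _ => 0, fun _ => none⟩
    obtain ⟨h₁, h₂, h₃, h₄⟩ := ih
    have hsamp : ∀ s, s * (δ * w) < n + 1 →
        (if n % (δ * w) = 0 then Function.update st.samples (n / (δ * w)) st.count
          else st.samples) s = Nat.count (fun i => (a i).isSome) (s * (δ * w)) := by
      intro s hs
      rcases Nat.lt_succ_iff_lt_or_eq.1 hs with hs | hs
      · have hne : s ≠ n / (δ * w) ∨ n % (δ * w) ≠ 0 := by
          by_contra! hcon
          have := Nat.div_add_mod n (δ * w)
          rw [hcon.2, ← hcon.1, mul_comm] at this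
          omega
        split_ifs with hmod
        · rw [Function.update_of_ne (hne.resolve_right (by simpa using hmod)), h₃ s hs]
        · exact h₃ s hs
      · have : n / (δ * w) = s := by rw [← hs, Nat.mul_div_cancel _ hpos]
        rw [if_pos (by rw [← hs]; exact Nat.mul_mod_left _ _), this, Function.update_self, h₁, hs]
    have hlt : ∀ i < n, (a i).isSome → Nat.count (fun i => (a i).isSome) i <
        Nat.count (fun i => (a i).isSome) n := fun i hi hai => Nat.count_strict_mono hai hi
    cases han : a n with
    | none =>
      refine ⟨?_, ?_, ?_, ?_⟩
      · simp only [compactStep, Nat.count_succ, han]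
        by_cases hmod : n % (δ * w) = 0 <;> simp [han, hmod, h₁]
      · intro i hi
        have : (compactStep w δ sz a st n).val.bits = Function.update st.bits n false := by
          simp only [compactStep]
          split_ifs <;> simp [han]
        rw [this, Function.update_apply]
        split_ifs with hin
        · rw [hin, han]; rfl
        · exact h₂ i (by omega)
      · intro s hs
        rw [← hsamp s hs]
        simp only [compactStep]
        split_ifs <;> simp [han]
      · intro i hi hai
        have hin : i ≠ n := by rintro rfl; simp [han] at hai
        rw [← h₄ i (by omega) hai]
        simp only [compactStep]
        split_ifs <;> simp [han]
    | some e =>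
      refine ⟨?_, ?_, ?_, ?_⟩
      · simp only [compactStep, Nat.count_succ, han]
        by_cases hmod : n % (δ * w) = 0 <;> simp [han, hmod, h₁]
      · intro i hi
        have : (compactStep w δ sz a st n).val.bits = Function.update st.bits n true := by
          simp only [compactStep]
          split_ifs <;> simp [han]
        rw [this, Function.update_apply]
        split_ifs with hin
        · rw [hin, han]; rfl
        · exact h₂ i (by omega)
      · intro s hs
        rw [← hsamp s hs]
        simp only [compactStep]
        split_ifs <;> simp [han]
      · intro i hi hai
        have : (compactStep w δ sz a st n).val.items =
            Function.update st.items st.count (some e) := by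
          simp only [compactStep]
          split_ifs <;> simp [han]
        rw [this, h₁]
        rcases Nat.lt_succ_iff_lt_or_eq.1 hi with hi | rfl
        · rw [Function.update_of_ne (hlt i hi hai).ne, h₄ i hi hai]
        · rw [Function.update_self, han]

theorem compactStep_cost_le (w δ sz : ℕ) (a : ℕ → Option E) (st : CompactState E) (i : ℕ) :
    (compactStep w δ sz a st i).cost ≤ 3 + if (a i).isSome then sz else 0 := by
  simp only [compactStep]
  cases h : a i <;> split_ifs <;> simp_all <;> omega

theorem finish_cost_le {r : ℕ} (cfg : Config r) (sz t : ℕ) (a : ℕ → Option E) :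
    (finish cfg sz t a).cost ≤ 4 * t + sz * Nat.count (fun i => (a i).isSome) t := by
  rw [finish]
  split_ifs
  · simp only [cost_bind, cost_pure, add_zero]
    refine (cost_loop_le _ (fun i => 3 + if (a i).isSome then sz else 0) _ _
      fun _ i _ _ => compactStep_cost_le ..).trans_eq ?_
    induction t with
    | zero => simp
    | succ t ih =>
      rw [List.range_succ, List.map_append, List.sum_append, ih, Nat.count_succ]
      simp only [List.map_cons, List.map_nil, List.sum_cons, List.sum_nil]
      split_ifs <;> ring
  · simp

@[simp] theorem size_finish {r : ℕ} (cfg : Config r) (sz t : ℕ) (a : ℕ → Option E) :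
    (finish cfg sz t a).val.size = t := by
  rw [finish]; split_ifs <;> rfl

theorem rank_cost_le {w δ : ℕ} (hw : 0 < w) (hδ : 0 < δ) (bits : ℕ → Bool) (samples : ℕ → ℕ)
    (i : ℕ) : (rank w δ bits samples i).cost ≤ 1 + 2 * δ := by
  simp only [rank, cost_bind, cost_readMem, val_readMem]
  have hlen : i / w - δ * (i / (δ * w)) + 1 ≤ δ := by
    have h₁ : i / w < δ * (i / (δ * w)) + δ := by
      rw [Nat.div_lt_iff_lt_mul hw]
      have := Nat.lt_div_mul_add (a := i) (Nat.mul_pos hδ hw)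
      nlinarith
    omega
  refine Nat.add_le_add_left ((cost_loop_le _ (fun _ => 1) _ _ fun _ _ _ _ => by simp).trans ?_) _
  simp only [List.map_const', List.sum_replicate, List.length_range', smul_eq_mul]
  omega

/-- The words that `rank` adds to the sample cover exactly the positions from the sampled one to `i`. -/
theorem rank_val {w δ t : ℕ} (hw : 0 < w) {p : ℕ → Prop} [DecidablePred p]
    {bits : ℕ → Bool} {samples : ℕ → ℕ} (hb : ∀ i < t, (bits i = true ↔ p i))
    (hs : ∀ s, s * (δ * w) < t → samples s = Nat.count p (s * (δ * w))) {i : ℕ} (hi : i < t) :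
    (rank w δ bits samples i).val = Nat.count p i := by
  simp only [rank, val_bind, val_readMem, val_loop, val_pure]
  set s := i / (δ * w) with hsdef
  have hsi : s * (δ * w) ≤ i := Nat.div_mul_le_self _ _
  have hle : δ * s ≤ i / w := by
    rw [Nat.le_div_iff_mul_le hw]
    nlinarith
  have key : ∀ m ≤ i / w - δ * s + 1,
      (List.range' (δ * s) m).foldl (fun acc j => acc + ones bits (j * w) (min ((j + 1) * w) i))
        (samples s) = Nat.count p (min ((δ * s + m) * w) i) := by
    intro m hm
    induction m with
    | zero =>
      have : min ((δ * s + 0) * w) i = s * (δ * w) := by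
        rw [min_eq_left] <;> nlinarith
      rw [this]
      simpa using hs s (by omega)
    | succ m ih =>
      rw [List.range'_concat, List.foldl_append, ih (by omega)]
      simp only [List.foldl_cons, List.foldl_nil, Nat.one_mul]
      have h₁ : (δ * s + m) * w ≤ i := by
        rw [← Nat.le_div_iff_mul_le hw]; omega
      rw [min_eq_left h₁, ones_add_count hb _ (by omega)]
      · rfl
      · exact le_min (Nat.mul_le_mul_right _ (by omega)) h₁
  rw [key _ le_rfl, min_eq_right]
  rw [show δ * s + (i / w - δ * s + 1) = i / w + 1 by omega]
  exact (Nat.lt_div_mul_add hw (a := i)).le.trans_eq (by ring)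

theorem read_finish_val {r : ℕ} (cfg : Config r) (hw : 0 < cfg.w) (hδ : 0 < cfg.δ) (sz : ℕ) {t : ℕ}
    (a : ℕ → Option E) {i : ℕ} (hi : i < t) :
    ((finish cfg sz t a).val.read cfg.w cfg.δ i).val = a i := by
  rw [finish]
  split_ifs
  · obtain ⟨-, h₂, h₃, h₄⟩ := compact_invariant hw hδ sz a t
    simp only [val_bind, val_pure]
    set st := (loop (compactStep cfg.w cfg.δ sz a) ⟨0, fun _ => false, fun _ => 0, fun _ => none⟩
      (List.range t)).val
    have hb := h₂ i hi
    cases ha : a i with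
    | none =>
      rw [ha, Option.isSome_none] at hb
      simp [Table.read, hb]
    | some e =>
      rw [ha, Option.isSome_some] at hb
      simp only [Table.read, val_bind, val_readMem, hb, if_true]
      rw [rank_val hw (p := fun i => (a i).isSome) (fun i hi => by rw [h₂ i hi]) h₃ hi,
        h₄ i hi (by rw [ha]; rfl), ha]
  · rfl

theorem read_cost_le {w δ : ℕ} (hw : 0 < w) (hδ : 0 < δ) (tb : Table E) (i : ℕ) :
    (tb.read w δ i).cost ≤ 3 + 2 * δ := by
  cases tb with
  | plain t a => simp [Table.read]; omega
  | compact t bits samples items =>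
    have := rank_cost_le hw hδ bits samples i
    cases hb : bits i <;> simp [Table.read, hb] <;> omega

end Compaction

/-! ### Insertions of a word -/

theorem mem_entries1 {σ : ℕ} {x : Str σ} {e : Key σ × Fin σ} :
    e ∈ entries1 x ↔ ∃ p, ∃ hp : p < x.length, e = ((toKey x).set p none, x[p]) := by
  simp only [entries1, List.mem_map, Prod.exists, List.mk_mem_zipIdx_iff_getElem?,
    List.getElem?_eq_some_iff]
  constructor
  · rintro ⟨c, p, ⟨hp, rfl⟩, rfl⟩
    exact ⟨p, hp, rfl⟩
  · rintro ⟨p, hp, rfl⟩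
    exact ⟨_, p, ⟨hp, rfl⟩, rfl⟩

theorem mem_entries2 {σ : ℕ} {x : Str σ} {e : Key σ × Fin σ} :
    e ∈ entries2 x ↔ ∃ p q, ∃ hp : p < q, ∃ hq : q < x.length,
      e = (((toKey x).set p none).set q none, x[p]) := by
  simp only [entries2, List.mem_flatMap, List.mem_map, Prod.exists,
    List.mk_mem_zipIdx_iff_getElem?, List.getElem?_eq_some_iff, List.mem_range'_1]
  constructor
  · rintro ⟨c, p, ⟨hp, rfl⟩, q, hq, rfl⟩
    exact ⟨p, q, by omega, by omega, rfl⟩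
  · rintro ⟨p, q, hp, hq, rfl⟩
    exact ⟨_, p, ⟨by omega, rfl⟩, q, by omega, rfl⟩

theorem entries1_spec {σ : ℕ} {x : Str σ} {e : Key σ × Fin σ} (he : e ∈ entries1 x) :
    editDist (toKey x) e.1 ≤ 2 ∧ wild e.1 = 1 := by
  obtain ⟨p, hp, rfl⟩ := mem_entries1.1 he
  have hp' : p < (toKey x).length := by simpa using hp
  exact ⟨(editDist_le_one (editStep_set hp' _)).trans (by norm_num),
    by rw [wild_set hp' (getElem_ne_none (wild_toKey x) hp'), wild_toKey]⟩

theorem entries2_spec {σ : ℕ} {x : Str σ} {e : Key σ × Fin σ} (he : e ∈ entries2 x) :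
    editDist (toKey x) e.1 ≤ 2 ∧ wild e.1 = 2 := by
  obtain ⟨p, q, hp, hq, rfl⟩ := mem_entries2.1 he
  have hp' : p < (toKey x).length := by simp; omega
  have hq' : q < ((toKey x).set p none).length := by simpa using hq
  have hne : ((toKey x).set p none)[q] ≠ none := by
    rw [List.getElem_set_ne (by omega)]
    exact getElem_ne_none (wild_toKey x) _
  exact ⟨editDist_le_two (editStep_set hp' _) (editStep_set hq' _),
    by rw [wild_set hq' hne, wild_set hp' (getElem_ne_none (wild_toKey x) hp'), wild_toKey]⟩

theorem fill_set {σ : ℕ} {x : Str σ} {p : ℕ} (hp : p < x.length) :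
    fill x[p] ((toKey x).set p none) = toKey x := by
  induction x generalizing p with
  | nil => simp at hp
  | cons a x ih =>
    cases p with
    | zero => rfl
    | succ p => simpa [fill] using ih (by simpa using hp)

theorem fill_set_set {σ : ℕ} {x : Str σ} {p q : ℕ} (hpq : p < q) (hq : q < x.length) :
    fill x[p] (((toKey x).set p none).set q none) = (toKey x).set q none := by
  induction x generalizing p q with
  | nil => simp at hq
  | cons a x ih =>
    cases q with
    | zero => omega
    | succ q =>
      cases p with
      | zero => rfl
      | succ p => simpa [fill] using ih (p := p) (q := q) (by omega) (by simpa using hq)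

theorem length_entries1 {σ : ℕ} (x : Str σ) : (entries1 x).length = x.length := by
  simp [entries1]

theorem length_entries2 {σ : ℕ} (x : Str σ) :
    (entries2 x).length = x.length * (x.length - 1) / 2 := by
  have h : ∀ n : ℕ, ((List.range n).map fun p => n - (p + 1)).sum = n * (n - 1) / 2 := by
    intro n
    have := Finset.sum_range_reflect (fun p => p) n
    rw [Finset.sum_range_id] at this
    rw [← this, ← List.sum_toFinset _ List.nodup_range, List.toFinset_range]
    exact Finset.sum_congr rfl fun p _ => by omega
  rw [entries2, List.length_flatMap, ← h]
  simp only [List.length_map, List.length_range']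
  rw [List.range_eq_range', ← List.zipIdx_map_snd 0 x, List.map_map]
  rfl

theorem length_flatMap_entries1 {σ : ℕ} (D : List (Str σ)) :
    (D.flatMap entries1).length = totalLength D := by
  simp [List.length_flatMap, length_entries1, totalLength]

theorem length_flatMap_entries2 {σ : ℕ} (D : List (Str σ)) :
    (D.flatMap entries2).length = pairCount D := by
  simp [List.length_flatMap, length_entries2, pairCount]

theorem length_le_maxLength {σ : ℕ} {D : List (Str σ)} {x : Str σ} (hx : x ∈ D) :
    x.length ≤ maxLength D := by
  induction D with
  | nil => simp at hx
  | cons y D ih =>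
    simp only [maxLength, List.map_cons, List.foldr_cons, List.mem_cons] at hx ih ⊢
    rcases hx with rfl | hx
    · exact le_max_left _ _
    · exact (ih hx).trans (le_max_right _ _)

/-! ### The result of the construction -/

section Build

variable {σ r : ℕ} (cfg : Config r) (T : HashCost σ) (h : Key σ → ℕ)

/-- The entries of a substitution store with `t` slots, with their home slots. -/
def storeItems (t : ℕ) (L : List (Key σ × Fin σ)) : List (ℕ × Entry σ r) :=
  L.map fun e => (h e.1 % t, e.2, cfg.sig (h e.1))

/-- Words with their home slots in an exact table with `t` slots. -/
def exactItems (t : ℕ) (L : List (Str σ)) : List (ℕ × Str σ) :=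
  L.map fun x => (h (toKey x) % t, x)

/-- The slots of all tables after the insertion of the words of `D`. -/
def slotsAfter (size : TableId → ℕ) (D : List (Str σ)) : Slots σ r where
  exact l := fillTable (size (.exact l))
    (exactItems h (size (.exact l)) (D.filter fun x => x.length = l))
  one := fillTable (size .one) (storeItems cfg h (size .one) (D.flatMap entries1))
  two := fillTable (size .two) (storeItems cfg h (size .two) (D.flatMap entries2))

theorem foldl_insertEntry (x : Key σ) (t : ℕ) (L₀ L : List (Key σ × Fin σ)) :
    L.foldl (fun a e => (insertEntry cfg T h x t a e).val) (fillTable t (storeItems cfg h t L₀)) =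
      fillTable t (storeItems cfg h t (L₀ ++ L)) := by
  induction L using List.reverseRecOn with
  | nil => simp
  | append_singleton L e ih =>
    rw [List.foldl_append, ih, ← List.append_assoc, storeItems, storeItems,
      List.map_append (l₁ := L₀ ++ L)]
    simp only [List.foldl_cons, List.foldl_nil, List.map_cons, List.map_nil, fillTable_concat]
    simp only [insertEntry, val_bind]
    rw [insertFrom_val_sz]
    rfl

theorem insertWord_val (size : TableId → ℕ) (D : List (Str σ)) (x : Str σ) :
    (insertWord cfg T h size (slotsAfter cfg h size D) x).val = slotsAfter cfg h size (D ++ [x]) := by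
  simp only [insertWord, val_bind, val_pure, val_loop, slotsAfter, foldl_insertEntry,
    List.flatMap_append, List.flatMap_singleton]
  congr 1
  funext l
  rw [Function.update_apply]
  split_ifs with hl
  · subst hl
    rw [List.filter_append, List.filter_singleton]
    simp only [decide_true, cond_true, exactItems, List.map_append, List.map_cons, List.map_nil,
      fillTable_concat]
    rw [insertFrom_val_sz]
    rfl
  · rw [List.filter_append, List.filter_singleton]
    simp [Ne.symm hl]

theorem foldl_insertWord (size : TableId → ℕ) (D : List (Str σ)) :
    D.foldl (fun s x => (insertWord cfg T h size s x).val)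
      ⟨fun _ _ => none, fun _ => none, fun _ => none⟩ = slotsAfter cfg h size D := by
  induction D using List.reverseRecOn with
  | nil => simp [slotsAfter, exactItems, storeItems]
  | append_singleton D x ih =>
    rw [List.foldl_append, ih]
    exact insertWord_val cfg T h size D x

/-- The finished substitution store that holds the entries of `L`. -/
def storeTable (t : ℕ) (L : List (Key σ × Fin σ)) : Table (Entry σ r) :=
  (finish cfg 1 t (fillTable t (storeItems cfg h t L))).val

/-- The finished exact table of the words of length `l`. -/
def exactTable (D : List (Str σ)) (l : ℕ) : Table (Str σ) :=
  (finish cfg (wordCount cfg.w σ l + 1) (cfg.cap (lengthCount D l))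
    (fillTable (cfg.cap (lengthCount D l))
      (exactItems h (cfg.cap (lengthCount D l)) (D.filter fun x => x.length = l)))).val

@[simp] theorem build_maxLen (D : List (Str σ)) :
    (build cfg T h D).val.maxLen = maxLength D := rfl

@[simp] theorem build_one (D : List (Str σ)) :
    (build cfg T h D).val.one = storeTable cfg h (cfg.cap (totalLength D)) (D.flatMap entries1) := by
  simp only [build, val_bind, val_pure, val_loop, foldl_insertWord]
  rfl

@[simp] theorem build_two (D : List (Str σ)) :
    (build cfg T h D).val.two = storeTable cfg h (cfg.cap (pairCount D)) (D.flatMap entries2) := by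
  simp only [build, val_bind, val_pure, val_loop, foldl_insertWord]
  rfl

theorem foldl_update {β : Type} (g : ℕ → β) (f₀ : ℕ → β) (n l : ℕ) (hl : l < n) :
    (List.range n).foldl (fun f i => Function.update f i (g i)) f₀ l = g l := by
  induction n with
  | zero => omega
  | succ n ih =>
    rw [List.range_succ, List.foldl_append]
    simp only [List.foldl_cons, List.foldl_nil]
    by_cases hln : l = n
    · rw [hln, Function.update_self]
    · rw [Function.update_of_ne hln, ih (by omega)]

theorem build_exact (D : List (Str σ)) {l : ℕ} (hl : l ≤ maxLength D) :
    (build cfg T h D).val.exact l = exactTable cfg h D l := by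
  simp only [build, val_bind, val_pure, val_loop, foldl_insertWord]
  exact foldl_update (fun l => exactTable cfg h D l) _ _ _ (by omega)

end Build

/-! ### Searches -/

section Search

variable {σ r : ℕ} {cfg : Config r}

theorem equalFrom_val {p : ℕ} {y z : Str σ} {f j : ℕ} :
    (equalFrom p y z f j).val = true ↔ ∀ i < f, wordAt p y (j + i) = wordAt p z (j + i) := by
  induction f generalizing j with
  | zero => simp [equalFrom]
  | succ f ih =>
    simp only [equalFrom, val_bind]
    split_ifs with h
    · rw [ih]
      constructor
      · rintro h' (_ | i) hi
        · exact h
        · have := h' i (by omega)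
          rwa [show j + (i + 1) = j + 1 + i by omega]
      · intro h' i hi
        have := h' (i + 1) (by omega)
        rwa [show j + (i + 1) = j + 1 + i by omega] at this
    · exact iff_of_false id fun h' => h (h' 0 (by omega))

theorem equalFrom_cost_le (p : ℕ) (y z : Str σ) (f j : ℕ) : (equalFrom p y z f j).cost ≤ f := by
  induction f generalizing j with
  | zero => simp [equalFrom]
  | succ f ih =>
    have := ih (j + 1)
    simp only [equalFrom, cost_bind, cost_tick]
    split_ifs
    · omega
    · simp

theorem le_wordCount_mul {w : ℕ} (hp : 0 < charsPerWord w σ) (l : ℕ) :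
    l ≤ wordCount w σ l * charsPerWord w σ := by
  have := Nat.lt_div_mul_add (a := l + (charsPerWord w σ - 1)) hp
  rw [wordCount]
  omega

/-- Strings of equal length are equal if they agree in all their packed words. -/
theorem equalFrom_eq_true {w : ℕ} (hp : 0 < charsPerWord w σ) {y z : Str σ}
    (hyz : y.length = z.length) :
    (equalFrom (charsPerWord w σ) y z (wordCount w σ y.length) 0).val = true ↔ y = z := by
  rw [equalFrom_val]
  constructor
  · intro h
    have key : ∀ m ≤ wordCount w σ y.length,
        y.take (m * charsPerWord w σ) = z.take (m * charsPerWord w σ) := by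
      intro m hm
      induction m with
      | zero => simp
      | succ m ih =>
        have := h m (by omega)
        rw [Nat.zero_add, wordAt, wordAt] at this
        rw [Nat.succ_mul, List.take_add, List.take_add, ih (by omega), this]
    have := key _ le_rfl
    have hle := le_wordCount_mul hp y.length
    rwa [List.take_of_length_le hle, List.take_of_length_le (hyz ▸ hle)] at this
  · rintro rfl i _
    rfl

/-- The table `tb` has `t` slots, with contents `a`. -/
def Table.Represents {E : Type} (cfg : Config r) (tb : Table E) (t : ℕ) (a : ℕ → Option E) : Prop :=
  tb.size = t ∧ ∀ i < t, (tb.read cfg.w cfg.δ i).val = a i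

theorem represents_finish {E : Type} (hw : 0 < cfg.w) (hδ : 0 < cfg.δ) (sz t : ℕ)
    (a : ℕ → Option E) : (finish cfg sz t a).val.Represents cfg t a :=
  ⟨size_finish cfg sz t a, fun _ hi => read_finish_val cfg hw hδ sz a hi⟩

section Store

variable {tb : Table (Entry σ r)} {t : ℕ} {a : ℕ → Option (Entry σ r)}

theorem mem_scanStore (htb : tb.Represents cfg t a) {s : Fin (2 ^ r)} {c : Fin σ} {f i j : ℕ}
    (hi : i < t) (hj : j < f) (h : a ((i + j) % t) = some (c, s))
    (h' : ∀ x < j, a ((i + x) % t) ≠ none) : c ∈ (scanStore cfg tb s f i).val := by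
  induction f generalizing i j with
  | zero => omega
  | succ f ih =>
    have hmod : (i + 0) % t = i := by simp [Nat.mod_eq_of_lt hi]
    simp only [scanStore, val_bind, htb.2 i hi, htb.1]
    cases j with
    | zero =>
      rw [hmod] at h
      simp [h]
    | succ j =>
      have h₀ := h' 0 (by omega)
      rw [hmod] at h₀
      obtain ⟨⟨c₁, s₁⟩, hc⟩ := Option.ne_none_iff_exists'.1 h₀
      have := ih (Nat.mod_lt (i + 1) (by omega)) (j := j) (by omega)
        (by rwa [mod_add_succ_mod]) fun x hx => by
          rw [mod_add_succ_mod]; exact h' (x + 1) (by omega)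
      simp only [hc, val_bind]
      split_ifs
      · exact List.mem_cons_of_mem _ this
      · exact this

theorem length_scanStore_le (htb : tb.Represents cfg t a) (s : Fin (2 ^ r)) (f : ℕ) {i : ℕ}
    (hi : i < t) : (scanStore cfg tb s f i).val.length ≤ runLen t a f i := by
  induction f generalizing i with
  | zero => simp [scanStore]
  | succ f ih =>
    have := ih (Nat.mod_lt (i + 1) (by omega))
    simp only [scanStore, val_bind, htb.2 i hi, htb.1, runLen]
    cases a i with
    | none => simp
    | some e =>
      simp only [val_bind, Option.isSome_some, if_true]
      split_ifs <;> simp <;> omega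

theorem scanStore_cost_le (hw : 0 < cfg.w) (hδ : 0 < cfg.δ) (htb : tb.Represents cfg t a)
    (s : Fin (2 ^ r)) (f : ℕ) {i : ℕ} (hi : i < t) :
    (scanStore cfg tb s f i).cost ≤ (runLen t a f i + 1) * (4 + 2 * cfg.δ) := by
  induction f generalizing i with
  | zero => simp [scanStore]
  | succ f ih =>
    have := ih (Nat.mod_lt (i + 1) (by omega))
    have hr := read_cost_le hw hδ tb i
    simp only [scanStore, cost_bind, htb.2 i hi, htb.1, runLen]
    cases a i with
    | none => simp; omega
    | some e =>
      simp only [cost_bind, cost_tick, Option.isSome_some, if_true]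
      split_ifs <;> simp only [cost_pure] <;> nlinarith

end Store

section Exact

variable {tb : Table (Str σ)} {t : ℕ} {a : ℕ → Option (Str σ)} {y : Str σ}

theorem scanExact_sound (hp : 0 < charsPerWord cfg.w σ) (htb : tb.Represents cfg t a)
    (ha : ∀ i z, a i = some z → z.length = y.length) {f i : ℕ} (hi : i < t)
    (h : (scanExact cfg tb y f i).val = true) : ∃ j, a j = some y := by
  induction f generalizing i with
  | zero => simp [scanExact] at h
  | succ f ih =>
    simp only [scanExact, val_bind, htb.2 i hi, htb.1] at h
    cases hai : a i with
    | none => simp [hai] at h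
    | some z =>
      simp only [hai, val_bind] at h
      split_ifs at h with hz
      · rw [equalFrom_eq_true hp (ha i z hai).symm] at hz
        exact ⟨i, by rw [hai, hz]⟩
      · exact ih (Nat.mod_lt (i + 1) (by omega)) h

theorem scanExact_complete (hp : 0 < charsPerWord cfg.w σ) (htb : tb.Represents cfg t a)
    {f i j : ℕ} (hi : i < t) (hj : j < f) (h : a ((i + j) % t) = some y)
    (h' : ∀ x < j, a ((i + x) % t) ≠ none) : (scanExact cfg tb y f i).val = true := by
  induction f generalizing i j with
  | zero => omega
  | succ f ih =>
    have hmod : (i + 0) % t = i := by simp [Nat.mod_eq_of_lt hi]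
    simp only [scanExact, val_bind, htb.2 i hi, htb.1]
    cases j with
    | zero =>
      rw [hmod] at h
      have := (equalFrom_eq_true hp (y := y) (z := y) rfl).2 rfl
      simp [h, this]
    | succ j =>
      have h₀ := h' 0 (by omega)
      rw [hmod] at h₀
      obtain ⟨z, hz⟩ := Option.ne_none_iff_exists'.1 h₀
      simp only [hz, val_bind]
      split_ifs
      · rfl
      · exact ih (Nat.mod_lt (i + 1) (by omega)) (j := j) (by omega)
          (by rwa [mod_add_succ_mod]) fun x hx => by
            rw [mod_add_succ_mod]; exact h' (x + 1) (by omega)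

theorem scanExact_cost_le (hw : 0 < cfg.w) (hδ : 0 < cfg.δ) (htb : tb.Represents cfg t a)
    (y : Str σ) (f : ℕ) {i : ℕ} (hi : i < t) :
    (scanExact cfg tb y f i).cost ≤
      (runLen t a f i + 1) * (3 + 2 * cfg.δ + wordCount cfg.w σ y.length) := by
  induction f generalizing i with
  | zero => simp [scanExact]
  | succ f ih =>
    have := ih (Nat.mod_lt (i + 1) (by omega))
    have hr := read_cost_le hw hδ tb i
    simp only [scanExact, cost_bind, htb.2 i hi, htb.1, runLen]
    cases a i with
    | none => simp; omega
    | some z =>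
      have he := equalFrom_cost_le (charsPerWord cfg.w σ) y z (wordCount cfg.w σ y.length) 0
      simp only [cost_bind, Option.isSome_some, if_true]
      split_ifs <;> (try simp only [cost_pure]) <;> nlinarith

end Exact

end Search

/-! ### Correctness of the query algorithm -/

section Correct

variable {σ r : ℕ} {cfg : Config r} {T : HashCost σ} {h : Key σ → ℕ} {D : List (Str σ)}

theorem storeItems_lt {t : ℕ} (ht : 0 < t) {L : List (Key σ × Fin σ)} :
    ∀ p ∈ storeItems cfg h t L, p.1 < t := by
  intro p hp
  obtain ⟨e, -, rfl⟩ := List.mem_map.1 hp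
  exact Nat.mod_lt _ ht

theorem exactItems_lt {t : ℕ} (ht : 0 < t) {L : List (Str σ)} :
    ∀ p ∈ exactItems h t L, p.1 < t := by
  intro p hp
  obtain ⟨e, -, rfl⟩ := List.mem_map.1 hp
  exact Nat.mod_lt _ ht

/-- A substitution store returns every character that was inserted under the key. -/
theorem mem_lookupStore (hw : 0 < cfg.w) (hδ : 0 < cfg.δ) (x : Key σ) {t : ℕ}
    {L : List (Key σ × Fin σ)} (hL : L.length < t) {e : Key σ × Fin σ} (he : e ∈ L) :
    e.2 ∈ (lookupStore cfg T h x (storeTable cfg h t L) e.1).val := by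
  have ht : 0 < t := by omega
  have hrep := represents_finish hw hδ 1 t (fillTable t (storeItems cfg h t L))
  obtain ⟨j, hj, h₁, h₂⟩ := fillTable_reach (storeItems_lt ht) (by simpa [storeItems] using hL.le)
    (List.mem_map_of_mem (f := fun e => (h e.1 % t, e.2, cfg.sig (h e.1))) he)
  simp only [lookupStore, val_bind, hashAt, storeTable, size_finish]
  exact mem_scanStore hrep (Nat.mod_lt _ ht) hj h₁ h₂

theorem mem_checkCandidate (hw : 0 < cfg.w) (hδ : 0 < cfg.δ) (hp : 0 < charsPerWord cfg.w σ)
    (hcap : ∀ k, k < cfg.cap k) (x : Key σ) {y z : Str σ} :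
    z ∈ (checkCandidate cfg T h x (build cfg T h D).val (toKey y)).val ↔ z = y ∧ y ∈ D := by
  simp only [checkCandidate, val_bind, reduceOption_toKey, build_maxLen]
  split_ifs with hlen
  · simp only [val_pure, List.not_mem_nil, false_iff, not_and]
    intro _ hy
    exact absurd (length_le_maxLength hy) (by omega)
  · rw [build_exact cfg T h D (by omega)]
    simp only [val_bind]
    set t := cfg.cap (lengthCount D y.length) with ht
    have hlt : (exactItems h t (D.filter fun x => x.length = y.length)).length < t := by
      rw [exactItems, List.length_map]; exact hcap (lengthCount D y.length)
    have ht0 : 0 < t := by omega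
    have hrep := represents_finish hw hδ (wordCount cfg.w σ y.length + 1) t
      (fillTable t (exactItems h t (D.filter fun x => x.length = y.length)))
    have hsz : (exactTable cfg h D y.length).size = t := size_finish ..
    rw [hsz]
    have key : (scanExact cfg (exactTable cfg h D y.length) y t
        ((hashAt T h x (toKey y)).val % t)).val = true ↔ y ∈ D := by
      constructor
      · intro hs
        have hmem : ∀ i z, fillTable t
            (exactItems h t (D.filter fun x => x.length = y.length)) i = some z →
            z ∈ D ∧ z.length = y.length := by
          intro i z hz
          obtain ⟨v, hv⟩ := fillTable_eq_some (exactItems_lt ht0) hz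
          obtain ⟨z', hz', heq⟩ := List.mem_map.1 hv
          obtain rfl : z' = z := congrArg Prod.snd heq
          simpa using hz'
        obtain ⟨j, hj⟩ := scanExact_sound hp hrep (fun i z hz => (hmem i z hz).2)
          (Nat.mod_lt _ ht0) hs
        exact (hmem j y hj).1
      · intro hy
        obtain ⟨j, hj, h₁, h₂⟩ := fillTable_reach (exactItems_lt ht0) hlt.le
          (List.mem_map_of_mem (f := fun x => (h (toKey x) % t, x))
            (List.mem_filter.2 ⟨hy, by simp⟩ : y ∈ D.filter fun x => x.length = y.length))
        exact scanExact_complete hp hrep (Nat.mod_lt _ ht0) hj h₁ h₂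
    split_ifs with hs
    · simp [key.1 hs]
    · simp only [val_pure, List.not_mem_nil, false_iff, not_and]
      exact fun _ hy => hs (key.2 hy)

/-- The query algorithm is correct for every hash function. Characters that a store returns for other
keys of the same signature do no harm, as they only lead to further candidates within distance two,
which are looked up in the exact dictionary. -/
theorem mem_query (hw : 0 < cfg.w) (hδ : 0 < cfg.δ) (hp : 0 < charsPerWord cfg.w σ)
    (hcap : ∀ k, k < cfg.cap k) {x y : Str σ} :
    y ∈ (query cfg T h (build cfg T h D).val x).val ↔ y ∈ D ∧ editDist x y ≤ 2 := by
  have sound₀ : ∀ k, editDist (toKey x) k ≤ 2 → wild k = 0 →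
      y ∈ (checkCandidate cfg T h (toKey x) (build cfg T h D).val k).val →
      y ∈ D ∧ editDist x y ≤ 2 := by
    intro k hk hk' hy
    rw [← toKey_reduceOption hk'] at hy hk
    obtain ⟨hyk, hD⟩ := (mem_checkCandidate hw hδ hp hcap _).1 hy
    exact hyk ▸ ⟨hD, editDist_le_of_toKey hk⟩
  have sound₁ : ∀ k, editDist (toKey x) k ≤ 2 → wild k = 1 →
      y ∈ (resolveOne cfg T h (toKey x) (build cfg T h D).val k).val →
      y ∈ D ∧ editDist x y ≤ 2 := by
    intro k hk hk' hy
    simp only [resolveOne, val_bind, val_collect, List.mem_flatMap] at hy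
    obtain ⟨c, -, hy⟩ := hy
    exact sound₀ _ (editDist_fill_le c hk) (by rw [wild_fill, hk']) hy
  have sound₂ : ∀ k, editDist (toKey x) k ≤ 2 → wild k = 2 →
      y ∈ (resolveTwo cfg T h (toKey x) (build cfg T h D).val k).val →
      y ∈ D ∧ editDist x y ≤ 2 := by
    intro k hk hk' hy
    simp only [resolveTwo, val_bind, val_collect, List.mem_flatMap] at hy
    obtain ⟨c, -, hy⟩ := hy
    exact sound₁ _ (editDist_fill_le c hk) (by rw [wild_fill, hk']) hy
  simp only [query, val_bind, val_pure, val_collect, List.mem_append, List.mem_flatMap]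
  constructor
  · rintro ((⟨k, hk, hy⟩ | ⟨k, hk, hy⟩) | ⟨k, hk, hy⟩)
    · obtain ⟨h₁, h₂⟩ := probes0_spec (wild_toKey x) hk
      exact sound₀ k h₁ h₂ hy
    · obtain ⟨h₁, h₂⟩ := probes1_spec (wild_toKey x) hk
      exact sound₁ k h₁ h₂ hy
    · obtain ⟨h₁, h₂⟩ := probes2_spec (wild_toKey x) hk
      exact sound₂ k h₁ h₂ hy
  · rintro ⟨hy, hd⟩
    have check : y ∈ (checkCandidate cfg T h (toKey x) (build cfg T h D).val (toKey y)).val :=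
      (mem_checkCandidate hw hδ hp hcap _).2 ⟨rfl, hy⟩
    have resolve : ∀ p < y.length, y ∈ (resolveOne cfg T h (toKey x) (build cfg T h D).val
        ((toKey y).set p none)).val := by
      intro p hpy
      simp only [resolveOne, val_bind, val_collect, List.mem_flatMap, build_one]
      refine ⟨y[p], ?_, by rwa [fill_set hpy]⟩
      exact mem_lookupStore hw hδ _ (by rw [length_flatMap_entries1]; exact hcap _)
        (List.mem_flatMap.2 ⟨y, hy, mem_entries1.2 ⟨p, hpy, rfl⟩⟩)
    rcases exists_probe hd with hk | ⟨p, hpy, hk⟩ | ⟨p, q, hpq, hq, hk⟩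
    · exact Or.inl (Or.inl ⟨_, hk, check⟩)
    · exact Or.inl (Or.inr ⟨_, hk, resolve p hpy⟩)
    · refine Or.inr ⟨_, hk, ?_⟩
      simp only [resolveTwo, val_bind, val_collect, List.mem_flatMap, build_two]
      refine ⟨y[p], ?_, by rw [fill_set_set hpq hq]; exact resolve q hq⟩
      exact mem_lookupStore hw hδ _ (by rw [length_flatMap_entries2]; exact hcap _)
        (List.mem_flatMap.2 ⟨y, hy, mem_entries2.2 ⟨p, q, hpq, hq, rfl⟩⟩)

end Correct

/-! ### Overfull windows under fully random hashing -/

section Overload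

variable {ι : Type}

/-- The number of windows around the home slot of the key `k`, of `i + j + 1` slots each, that contain
the home slots of at least `i + j` keys of `S` other than `k`. One key less than the number of slots is
asked for, so that this bounds the length of a search for `k` even if `k` itself is in the table, and
conditioning on the home slot of `k` leaves the home slots of the keys that are counted
independent. -/
def overload [DecidableEq ι] (t : ℕ) (S : Finset ι) (home : ι → ℕ) (k : ι) : ℕ :=
  ∑ i ∈ Finset.range t, ∑ j ∈ Finset.range t,
    if i + j ≤ ((S.erase k).filter fun k' => home k' ∈ window t (home k) i j).card then 1 else 0

theorem runLen_le_overload [DecidableEq ι] {E F : Type} {t : ℕ} {home : ι → ℕ}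
    (hhome : ∀ k, home k < t) {L : List F} (key : F → ι) (g : F → E) {S : Finset ι} (hnd : (L.map key).Nodup) (hS : ∀ e ∈ L, key e ∈ S)
    (hlen : L.length < t) (k : ι) :
    runLen t (fillTable t (L.map fun e => (home (key e), g e))) t (home k) ≤
      overload t S home k := by
  refine (runLen_fillTable_le (fun p hp => ?_) (by simpa using hlen) (hhome k)).trans ?_
  · obtain ⟨e, -, rfl⟩ := List.mem_map.1 hp
    exact hhome _
  · refine Finset.sum_le_sum fun i _ => Finset.sum_le_sum fun j _ => ?_
    set W := window t (home k) i j
    have hcount : (L.map fun e => (home (key e), g e)).countP (fun p => p.1 ∈ W) ≤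
        ((S.erase k).filter fun k' => home k' ∈ W).card + 1 := by
      have h₁ : (L.map fun e => (home (key e), g e)).countP (fun p => p.1 ∈ W) =
          ((L.map key).filter fun k' => home k' ∈ W).length := by
        rw [← List.countP_eq_length_filter, List.countP_map, List.countP_map]
        rfl
      rw [h₁, ← List.toFinset_card_of_nodup (hnd.filter _), List.toFinset_filter]
      have h₂ : (L.map key).toFinset.filter (fun k' => decide (home k' ∈ W) = true) ⊆
          insert k ((S.erase k).filter fun k' => home k' ∈ W) := by
        intro k' hk'
        simp only [Finset.mem_filter, List.mem_toFinset, List.mem_map, decide_eq_true_eq] at hk'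
        obtain ⟨⟨e, he, rfl⟩, hW⟩ := hk'
        simp only [Finset.mem_insert, Finset.mem_filter, Finset.mem_erase]
        by_cases hek : key e = k
        · exact Or.inl hek
        · exact Or.inr ⟨⟨hek, hS e he⟩, hW⟩
      exact (Finset.card_le_card h₂).trans (Finset.card_insert_le _ _)
    split_ifs with h₁ h₂ h₂ <;> omega

/-- The bound on the expected number of overfull windows at load factor `α`: the sum over `i` and `j`
of the Chernoff bounds for the single windows. -/
noncomputable def overloadBound (α : ℝ) : ℝ≥0∞ :=
  ENNReal.ofReal (Real.exp (1 - α)) * (1 - ENNReal.ofReal (α * Real.exp (1 - α)))⁻¹ ^ 2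

/-- The ratio `α e ^ (1 - α)` of the geometric series is less than one. -/
theorem overloadBound_ne_top {α : ℝ} (h₁ : α < 1) : overloadBound α ≠ ∞ := by
  have hlt : α * Real.exp (1 - α) < 1 := by
    have := Real.add_one_lt_exp (x := α - 1) (by linarith)
    have hpos := Real.exp_pos (1 - α)
    have hmul : Real.exp (α - 1) * Real.exp (1 - α) = 1 := by
      rw [← Real.exp_add]; simp
    nlinarith
  refine ENNReal.mul_ne_top ENNReal.ofReal_ne_top (ENNReal.pow_ne_top (ENNReal.inv_ne_top.2 ?_))
  rw [Ne, tsub_eq_zero_iff_le, not_le]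
  exact ENNReal.ofReal_lt_one.2 hlt

theorem card_window_le (t s i j : ℕ) : (window t s i j).card ≤ i + j + 1 :=
  Finset.card_image_le.trans_eq (Finset.card_range _)

variable {Ω : Type u} [MeasurableSpace Ω] {μ : Measure Ω} {X : ι → Ω → ℕ}

theorem lintegral_ite_eq (hX : ∀ k, Measurable (X k)) (k : ι) (v : ℕ) :
    ∫⁻ ω, (if X k ω = v then (1 : ℝ≥0∞) else 0) ∂μ = μ {ω | X k ω = v} := by
  refine Eq.trans (lintegral_congr fun ω => ?_)
    (lintegral_indicator_one (μ := μ) (hX k (measurableSet_singleton v)))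
  simp [Set.indicator_apply]

variable [IsProbabilityMeasure μ]

/-- The moment generating function of the number of keys of `S` whose home lies in a window. -/
theorem lintegral_prod_window_le {α : ℝ} (h₀ : 0 < α) (h₁ : α < 1) (hX : ∀ k, Measurable (X k))
    {t : ℕ} (ht : 0 < t) {S : Finset ι} (hS : (S.card : ℝ) ≤ α * t)
    (hunif : ∀ k ∈ S, ∀ v < t, μ {ω | X k ω = v} ≤ (t : ℝ≥0∞)⁻¹) (s i j : ℕ) :
    ∏ k ∈ S, ∫⁻ ω, (1 + ENNReal.ofReal (1 / α - 1) *
        if X k ω ∈ window t s i j then 1 else 0) ∂μ ≤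
      ENNReal.ofReal (Real.exp ((1 - α) * (i + j + 1))) := by
  have hy : 0 ≤ 1 / α - 1 := by
    rw [sub_nonneg, le_div_iff₀ h₀]; linarith
  have ht' : (0 : ℝ) < t := by exact_mod_cast ht
  have hfac : ∀ k ∈ S, ∫⁻ ω, (1 + ENNReal.ofReal (1 / α - 1) *
      if X k ω ∈ window t s i j then 1 else 0) ∂μ ≤
      ENNReal.ofReal (1 + (1 / α - 1) * ((i + j + 1) / t)) := by
    intro k hk
    have hind : ∀ ω, (if X k ω ∈ window t s i j then (1 : ℝ≥0∞) else 0) ≤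
        ∑ v ∈ window t s i j, if X k ω = v then 1 else 0 := by
      intro ω
      split_ifs with hω
      · rw [Finset.sum_ite_eq, if_pos hω]
      · exact zero_le
    have hmeas : ∀ v, Measurable fun ω => if X k ω = v then (1 : ℝ≥0∞) else 0 := fun v =>
      Measurable.ite (hX k (measurableSet_singleton v)) measurable_const measurable_const
    have hprob : ∫⁻ ω, (if X k ω ∈ window t s i j then (1 : ℝ≥0∞) else 0) ∂μ ≤
        ENNReal.ofReal ((i + j + 1) / t) := by
      refine (lintegral_mono hind).trans ?_
      rw [lintegral_finsetSum _ fun v _ => hmeas v]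
      have : ∀ v ∈ window t s i j, ∫⁻ ω, (if X k ω = v then (1 : ℝ≥0∞) else 0) ∂μ ≤
          (t : ℝ≥0∞)⁻¹ := by
        intro v hv
        obtain ⟨x, -, rfl⟩ := Finset.mem_image.1 hv
        rw [lintegral_ite_eq hX]
        exact hunif k hk _ (Nat.mod_lt _ ht)
      refine (Finset.sum_le_sum this).trans ?_
      rw [Finset.sum_const, nsmul_eq_mul,
        ENNReal.ofReal_div_of_pos ht', ENNReal.ofReal_natCast, ENNReal.div_eq_inv_mul, mul_comm]
      gcongr
      rw [show (i + j + 1 : ℝ) = ((i + j + 1 : ℕ) : ℝ) by push_cast; ring, ENNReal.ofReal_natCast]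
      exact_mod_cast card_window_le t s i j
    rw [lintegral_add_left measurable_const, lintegral_const_mul' _ _ ENNReal.ofReal_ne_top,
      lintegral_const, measure_univ, mul_one, ENNReal.ofReal_add zero_le_one (by positivity),
      ENNReal.ofReal_one, ENNReal.ofReal_mul hy]
    gcongr
  refine (Finset.prod_le_prod' hfac).trans ?_
  rw [Finset.prod_const, ← ENNReal.ofReal_pow (by positivity)]
  refine ENNReal.ofReal_le_ofReal ?_
  set u := (1 / α - 1) * (((i : ℝ) + j + 1) / t) with hu
  have hu0 : 0 ≤ u := by positivity
  calc (1 + u) ^ S.card ≤ Real.exp u ^ S.card := by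
        gcongr
        linarith [Real.add_one_le_exp u]
    _ = Real.exp (S.card * u) := by rw [Real.exp_nat_mul]
    _ ≤ Real.exp ((1 - α) * (i + j + 1)) := by
        refine Real.exp_le_exp.2 ((mul_le_mul_of_nonneg_right hS hu0).trans_eq ?_)
        rw [hu]
        field_simp

/-- One window is overfull with exponentially small probability. This is the Chernoff bound with base
`1 / α`, after splitting by the home slot of `k`. -/
theorem lintegral_overfull_le [DecidableEq ι] {α : ℝ} (h₀ : 0 < α) (h₁ : α < 1)
    (hX : ∀ k, Measurable (X k)) (hind : iIndepFun X μ) {t : ℕ} (ht : 0 < t) (hlt : ∀ k ω, X k ω < t) {S : Finset ι}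
    (hS : (S.card : ℝ) ≤ α * t) {k : ι}
    (hunif : ∀ k' ∈ insert k S, ∀ v < t, μ {ω | X k' ω = v} ≤ (t : ℝ≥0∞)⁻¹) (i j : ℕ) :
    ∫⁻ ω, (if i + j ≤ ((S.erase k).filter fun k' => X k' ω ∈ window t (X k ω) i j).card then 1
      else 0) ∂μ ≤ ENNReal.ofReal (Real.exp (1 - α)) * ENNReal.ofReal (α * Real.exp (1 - α)) ^ i *
        ENNReal.ofReal (α * Real.exp (1 - α)) ^ j := by
  have hy : 0 ≤ 1 / α - 1 := by
    rw [sub_nonneg, le_div_iff₀ h₀]; linarith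
  set y := ENNReal.ofReal (1 / α - 1) with hydef
  have hone : ENNReal.ofReal α * (1 + y) = 1 := by
    rw [hydef, ← ENNReal.ofReal_one, ← ENNReal.ofReal_add zero_le_one hy,
      ← ENNReal.ofReal_mul h₀.le]
    congr 1
    field_simp
    ring
  -- the factor of the key `k'` in the product, when the home slot of `k` is `s`
  let G : ℕ → ι → ℕ → ℝ≥0∞ := fun s k' v =>
    if k' = k then (if v = s then 1 else 0) else 1 + y * if v ∈ window t s i j then 1 else 0
  have hG : ∀ s k', Measurable (G s k') := fun s k' => Measurable.of_discrete
  have hpoint : ∀ ω,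
      (if i + j ≤ ((S.erase k).filter fun k' => X k' ω ∈ window t (X k ω) i j).card then 1
        else 0 : ℝ≥0∞) ≤
      ∑ s ∈ Finset.range t, ENNReal.ofReal α ^ (i + j) *
        ∏ k' ∈ insert k (S.erase k), G s k' (X k' ω) := by
    intro ω
    split_ifs with hω
    · refine le_trans ?_ (Finset.single_le_sum (f := fun s => ENNReal.ofReal α ^ (i + j) *
        ∏ k' ∈ insert k (S.erase k), G s k' (X k' ω)) (fun _ _ => zero_le)
        (Finset.mem_range.2 (hlt k ω)))
      rw [Finset.prod_insert (Finset.notMem_erase k S)]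
      have hprod : ∏ k' ∈ S.erase k, G (X k ω) k' (X k' ω) =
          (1 + y) ^ ((S.erase k).filter fun k' => X k' ω ∈ window t (X k ω) i j).card := by
        rw [← Finset.prod_const, Finset.prod_filter]
        refine Finset.prod_congr rfl fun k' hk' => ?_
        simp only [G, if_neg (Finset.ne_of_mem_erase hk')]
        split_ifs <;> simp
      rw [hprod]
      simp only [G, if_true, one_mul]
      calc (1 : ℝ≥0∞) = ENNReal.ofReal α ^ (i + j) * (1 + y) ^ (i + j) := by
            rw [← mul_pow, hone, one_pow]
        _ ≤ _ := by
            gcongr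
            exact le_self_add
    · exact zero_le
  refine (lintegral_mono hpoint).trans ?_
  have hmeas : ∀ s k', Measurable fun ω => G s k' (X k' ω) := fun s k' => (hG s k').comp (hX k')
  rw [lintegral_finsetSum _ fun s _ => (Finset.measurable_fun_prod _ fun k' _ =>
    hmeas s k').const_mul _]
  have hterm : ∀ s ∈ Finset.range t, ∫⁻ ω, ENNReal.ofReal α ^ (i + j) *
      ∏ k' ∈ insert k (S.erase k), G s k' (X k' ω) ∂μ ≤
      (t : ℝ≥0∞)⁻¹ * (ENNReal.ofReal (Real.exp (1 - α)) *
        ENNReal.ofReal (α * Real.exp (1 - α)) ^ i * ENNReal.ofReal (α * Real.exp (1 - α)) ^ j) := by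
    intro s hs
    rw [lintegral_const_mul' _ _ (ENNReal.pow_ne_top ENNReal.ofReal_ne_top),
      lintegral_prod_eq_prod_lintegral_of_indepFun _ (fun k' ω => G s k' (X k' ω))
        (hind.comp _ (hG s)) (hmeas s),
      Finset.prod_insert (Finset.notMem_erase k S)]
    have hk : ∫⁻ ω, G s k (X k ω) ∂μ ≤ (t : ℝ≥0∞)⁻¹ := by
      simp only [G, if_true]
      rw [lintegral_ite_eq hX]
      exact hunif k (Finset.mem_insert_self _ _) s (Finset.mem_range.1 hs)
    have hrest : ∏ k' ∈ S.erase k, ∫⁻ ω, G s k' (X k' ω) ∂μ ≤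
        ENNReal.ofReal (Real.exp ((1 - α) * (i + j + 1))) := by
      refine le_trans (le_of_eq (Finset.prod_congr rfl fun k' hk' => ?_))
        (lintegral_prod_window_le h₀ h₁ hX ht (S := S.erase k) (le_trans ?_ hS) (fun k' hk' =>
          hunif k' (Finset.mem_insert_of_mem (Finset.mem_of_mem_erase hk'))) s i j)
      · simp only [G, if_neg (Finset.ne_of_mem_erase hk'), hydef]
      · exact_mod_cast Finset.card_le_card (Finset.erase_subset k S)
    rw [mul_left_comm]
    refine mul_le_mul' hk ((mul_le_mul_right hrest _).trans_eq ?_)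
    rw [← ENNReal.ofReal_pow h₀.le, ← ENNReal.ofReal_pow (by positivity),
      ← ENNReal.ofReal_pow (by positivity), ← ENNReal.ofReal_mul (by positivity),
      ← ENNReal.ofReal_mul (by positivity), ← ENNReal.ofReal_mul (by positivity)]
    congr 1
    rw [mul_pow, mul_pow, pow_add, ← Real.exp_nat_mul, ← Real.exp_nat_mul,
      show (1 - α) * ((i : ℝ) + j + 1) = i * (1 - α) + j * (1 - α) + (1 - α) by ring,
      Real.exp_add, Real.exp_add]
    ring
  refine (Finset.sum_le_sum hterm).trans_eq ?_
  rw [Finset.sum_const, Finset.card_range, nsmul_eq_mul, ← mul_assoc, ENNReal.mul_inv_cancel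
    (by exact_mod_cast ht.ne') (ENNReal.natCast_ne_top t), one_mul]

theorem measurableSet_overfull [DecidableEq ι] (hX : ∀ k, Measurable (X k)) (t : ℕ) (S : Finset ι)
    (k : ι) (i j : ℕ) : MeasurableSet
      {ω | i + j ≤ ((S.erase k).filter fun k' => X k' ω ∈ window t (X k ω) i j).card} := by
  have : Measurable fun ω => ((S.erase k).filter fun k' => X k' ω ∈ window t (X k ω) i j).card := by
    simp_rw [Finset.card_filter]
    refine Finset.measurable_fun_sum _ fun k' _ => Measurable.ite ?_ measurable_const
      measurable_const
    exact ((hX k').prodMk (hX k)) (MeasurableSet.of_discrete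
      (s := {p : ℕ × ℕ | p.1 ∈ window t p.2 i j}))
  exact this (MeasurableSet.of_discrete (s := {n | i + j ≤ n}))

theorem measurable_overload [DecidableEq ι] (hX : ∀ k, Measurable (X k)) (t : ℕ) (S : Finset ι)
    (k : ι) : Measurable fun ω => overload t S (fun k => X k ω) k :=
  Finset.measurable_fun_sum _ fun i _ => Finset.measurable_fun_sum _ fun j _ =>
    Measurable.ite (measurableSet_overfull hX t S k i j) measurable_const measurable_const

theorem lintegral_overload_le [DecidableEq ι] {α : ℝ} (h₀ : 0 < α) (h₁ : α < 1)
    (hX : ∀ k, Measurable (X k)) (hind : iIndepFun X μ) {t : ℕ} (ht : 0 < t) (hlt : ∀ k ω, X k ω < t) {S : Finset ι}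
    (hS : (S.card : ℝ) ≤ α * t) {k : ι}
    (hunif : ∀ k' ∈ insert k S, ∀ v < t, μ {ω | X k' ω = v} ≤ (t : ℝ≥0∞)⁻¹) :
    ∫⁻ ω, (overload t S (fun k => X k ω) k : ℝ≥0∞) ∂μ ≤ overloadBound α := by
  set ρ := ENNReal.ofReal (α * Real.exp (1 - α))
  have hmeas : ∀ i j, Measurable fun ω => (if i + j ≤
      ((S.erase k).filter fun k' => X k' ω ∈ window t (X k ω) i j).card
        then (1 : ℝ≥0∞) else 0) := fun i j => Measurable.ite (measurableSet_overfull hX t S k i j) measurable_const measurable_const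
  have hgeo : ∑ i ∈ Finset.range t, ρ ^ i ≤ (1 - ρ)⁻¹ := by
    rw [← ENNReal.tsum_geometric]
    exact ENNReal.sum_le_tsum _
  calc ∫⁻ ω, (overload t S (fun k => X k ω) k : ℝ≥0∞) ∂μ
      = ∑ i ∈ Finset.range t, ∑ j ∈ Finset.range t, ∫⁻ ω, (if i + j ≤
          ((S.erase k).filter fun k' => X k' ω ∈ window t (X k ω) i j).card
          then (1 : ℝ≥0∞) else 0) ∂μ := by
        simp only [overload, Nat.cast_sum, Nat.cast_ite, Nat.cast_one, Nat.cast_zero]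
        rw [lintegral_finsetSum _ fun i _ => Finset.measurable_fun_sum _ fun j _ => hmeas i j]
        exact Finset.sum_congr rfl fun i _ => lintegral_finsetSum _ fun j _ => hmeas i j
    _ ≤ ∑ i ∈ Finset.range t, ∑ j ∈ Finset.range t,
          ENNReal.ofReal (Real.exp (1 - α)) * ρ ^ i * ρ ^ j :=
        Finset.sum_le_sum fun i _ => Finset.sum_le_sum fun j _ =>
          lintegral_overfull_le h₀ h₁ hX hind ht hlt hS hunif i j
    _ = ENNReal.ofReal (Real.exp (1 - α)) *
          ((∑ i ∈ Finset.range t, ρ ^ i) * ∑ j ∈ Finset.range t, ρ ^ j) := by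
        rw [Finset.sum_mul_sum, Finset.mul_sum]
        refine Finset.sum_congr rfl fun i _ => ?_
        rw [Finset.mul_sum]
        exact Finset.sum_congr rfl fun j _ => mul_assoc _ _ _
    _ ≤ overloadBound α := by
        rw [overloadBound, sq]
        gcongr

end Overload

/-! ### Functions of finitely many hash values -/

section FinDep

variable {ι β γ δ : Type}

/-- `F` depends only on the hash values of finitely many keys, all in `P`. -/
def FinDep (P : Set ι) (F : (ι → ℕ) → β) : Prop := ∃ S : Finset ι, ↑S ⊆ P ∧ DependsOn F ↑S

namespace FinDep

variable {P Q : Set ι} {F : (ι → ℕ) → β} {G : (ι → ℕ) → γ}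

theorem const (P : Set ι) (b : β) : FinDep P fun _ => b :=
  ⟨∅, by simp, fun _ _ _ => rfl⟩

theorem eval {k : ι} (hk : k ∈ P) : FinDep P fun h => h k :=
  ⟨{k}, by simpa using hk, fun _ _ h => h k (by simp)⟩

theorem comp (φ : β → γ) (hF : FinDep P F) : FinDep P fun h => φ (F h) := by
  obtain ⟨S, hS, hF⟩ := hF
  exact ⟨S, hS, fun _ _ h => congrArg φ (hF h)⟩

theorem prod (hF : FinDep P F) (hG : FinDep P G) : FinDep P fun h => (F h, G h) := by
  classical
  obtain ⟨S, hS, hF⟩ := hF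
  obtain ⟨S', hS', hG⟩ := hG
  refine ⟨S ∪ S', by simp [hS, hS'], fun x y h => ?_⟩
  exact Prod.ext (hF fun i hi => h i (by simp at hi; simp [hi]))
    (hG fun i hi => h i (by simp at hi; simp [hi]))

theorem comp₂ (φ : β → γ → δ) (hF : FinDep P F) (hG : FinDep P G) :
    FinDep P fun h => φ (F h) (G h) :=
  (hF.prod hG).comp fun p => φ p.1 p.2

theorem pi [Fintype δ] {F : δ → (ι → ℕ) → β} (hF : ∀ c, FinDep P (F c)) :
    FinDep P fun h c => F c h := by
  classical
  choose S hS hF using hF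
  refine ⟨Finset.univ.biUnion S, by simpa using hS, fun x y h => funext fun c => hF c fun i hi => ?_⟩
  exact h i (by simpa using ⟨c, hi⟩)

theorem mono (hF : FinDep P F) (hPQ : P ⊆ Q) : FinDep Q F := by
  obtain ⟨S, hS, hF⟩ := hF
  exact ⟨S, hS.trans hPQ, hF⟩

theorem list_map {l : List γ} {F : γ → (ι → ℕ) → β} (hF : ∀ c ∈ l, FinDep P (F c)) :
    FinDep P fun h => l.map fun c => F c h := by
  induction l with
  | nil => exact const P []
  | cons c l ih =>
    exact (hF c (by simp)).comp₂ List.cons (ih fun c hc => hF c (by simp [hc]))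

theorem exists_eq (hF : FinDep P F) : ∃ S : Finset ι, ↑S ⊆ P ∧ ∃ F' : (S → ℕ) → β,
    ∀ h, F h = F' fun i => h i := by
  classical
  obtain ⟨S, hS, hF⟩ := hF
  refine ⟨S, hS, fun g => F fun i => if hi : i ∈ S then g ⟨i, hi⟩ else 0, fun h => hF ?_⟩
  intro i hi
  rw [dif_pos (by exact_mod_cast hi)]

variable {Ω : Type u} [MeasurableSpace Ω] {μ : Measure Ω} {h : Ω → ι → ℕ}

/-- The values of finitely many keys range over a countable discrete space, where every function is
measurable. -/
theorem measurable [MeasurableSpace β] (hF : FinDep P F) (hh : ∀ k, Measurable fun ω => h ω k) :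
    Measurable fun ω => F (h ω) := by
  obtain ⟨S, -, F', hF'⟩ := hF.exists_eq
  simp_rw [hF']
  exact (Measurable.of_discrete (f := F')).comp (measurable_pi_lambda _ fun i => hh i)

theorem indepFun [MeasurableSpace β] [MeasurableSpace γ] (hF : FinDep P F) (hG : FinDep Q G)
    (hPQ : Disjoint P Q) (hh : ∀ k, Measurable fun ω => h ω k)
    (hind : iIndepFun (fun k ω => h ω k) μ) :
    IndepFun (fun ω => F (h ω)) (fun ω => G (h ω)) μ := by
  obtain ⟨S, hS, F', hF'⟩ := hF.exists_eq
  obtain ⟨S', hS', G', hG'⟩ := hG.exists_eq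
  simp_rw [hF', hG']
  have hdisj : Disjoint S S' := by
    rw [← Finset.disjoint_coe]
    exact hPQ.mono hS hS'
  exact (hind.indepFun_finset S S' hdisj hh).comp (Measurable.of_discrete (f := F'))
    (Measurable.of_discrete (f := G'))

/-- A version of Wald's identity: if a random list and the costs of its possible elements depend on
different keys, the expected total cost is at most the expected length times the largest expected cost
of an element. -/
theorem lintegral_sum_map_le [Fintype γ] [DecidableEq γ] [IsProbabilityMeasure μ]
    {l : (ι → ℕ) → List γ} {C : γ → (ι → ℕ) → ℕ} (hl : FinDep P l) (hC : ∀ c, FinDep Q (C c))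
    (hPQ : Disjoint P Q) (hh : ∀ k, Measurable fun ω => h ω k)
    (hind : iIndepFun (fun k ω => h ω k) μ) {A B : ℝ≥0∞}
    (hA : ∫⁻ ω, ((l (h ω)).length : ℝ≥0∞) ∂μ ≤ A) (hB : ∀ c, ∫⁻ ω, (C c (h ω) : ℝ≥0∞) ∂μ ≤ B) :
    ∫⁻ ω, (((l (h ω)).map fun c => C c (h ω)).sum : ℝ≥0∞) ∂μ ≤ A * B := by
  have hsum : ∀ (l : List γ) (f : γ → ℕ), (l.map f).sum = ∑ c, l.count c * f c := by
    intro l f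
    rw [Finset.sum_list_map_count]
    refine Finset.sum_subset (Finset.subset_univ _) fun c _ hc => ?_
    rw [List.mem_toFinset] at hc
    simp [List.count_eq_zero_of_not_mem hc]
  have hlen : ∀ l : List γ, l.length = ∑ c, l.count c := by
    intro l
    simpa using hsum l fun _ => 1
  have hcount : ∀ c, FinDep P fun h => ((l h).count c : ℝ≥0∞) := fun c =>
    hl.comp fun l => (l.count c : ℝ≥0∞)
  have hcost : ∀ c, FinDep Q fun h => (C c h : ℝ≥0∞) := fun c => (hC c).comp (Nat.cast : ℕ → ℝ≥0∞)
  have hmul : ∀ c, ∫⁻ ω, ((l (h ω)).count c : ℝ≥0∞) * (C c (h ω) : ℝ≥0∞) ∂μ =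
      (∫⁻ ω, ((l (h ω)).count c : ℝ≥0∞) ∂μ) * ∫⁻ ω, (C c (h ω) : ℝ≥0∞) ∂μ := fun c =>
    lintegral_mul_eq_lintegral_mul_lintegral_of_indepFun ((hcount c).measurable hh)
      ((hcost c).measurable hh) ((hcount c).indepFun (hcost c) hPQ hh hind)
  simp_rw [hsum, Nat.cast_sum, Nat.cast_mul]
  rw [lintegral_finsetSum _ fun c _ =>
    ((hcount c).measurable hh).fun_mul ((hcost c).measurable hh)]
  simp_rw [hmul]
  calc ∑ c, (∫⁻ ω, ((l (h ω)).count c : ℝ≥0∞) ∂μ) * ∫⁻ ω, (C c (h ω) : ℝ≥0∞) ∂μ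
      ≤ ∑ c, (∫⁻ ω, ((l (h ω)).count c : ℝ≥0∞) ∂μ) * B :=
        Finset.sum_le_sum fun c _ => by gcongr; exact hB c
    _ = (∫⁻ ω, ((l (h ω)).length : ℝ≥0∞) ∂μ) * B := by
        simp_rw [hlen, Nat.cast_sum]
        rw [← Finset.sum_mul, lintegral_finsetSum _ fun c _ => (hcount c).measurable hh]
    _ ≤ A * B := by gcongr

end FinDep

end FinDep

/-! ### The capacity of the tables -/

theorem capacity_pos (α : ℝ) (n : ℕ) : 0 < capacity α n := lt_max_of_lt_left one_pos

theorem le_mul_capacity {α : ℝ} (h₀ : 0 < α) (n : ℕ) : (n : ℝ) ≤ α * capacity α n := by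
  have : (n : ℝ) / α ≤ capacity α n :=
    (Nat.le_ceil _).trans (by exact_mod_cast le_max_right 1 ⌈(n : ℝ) / α⌉₊)
  rwa [div_le_iff₀' h₀] at this

theorem lt_capacity {α : ℝ} (h₀ : 0 < α) (h₁ : α < 1) (n : ℕ) : n < capacity α n := by
  have hpos : (0 : ℝ) < capacity α n := by exact_mod_cast capacity_pos α n
  have := le_mul_capacity h₀ n
  have : (n : ℝ) < capacity α n := by nlinarith
  exact_mod_cast this

theorem capacity_le (α : ℝ) (n : ℕ) : capacity α n ≤ 1 + ⌈α⁻¹⌉₊ * n := by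
  refine max_le (by omega) (Nat.ceil_le.2 ?_)
  push_cast
  have := Nat.le_ceil α⁻¹
  have hn : (0 : ℝ) ≤ n := Nat.cast_nonneg n
  rw [div_eq_mul_inv]
  nlinarith

theorem wordCount_le {w σ : ℕ} (hp : 0 < charsPerWord w σ) (l : ℕ) : wordCount w σ l ≤ l := by
  rw [wordCount]
  refine Nat.le_of_lt_succ ((Nat.div_lt_iff_lt_mul hp).2 ?_)
  rw [Nat.succ_mul]
  have := Nat.le_mul_of_pos_right l hp
  omega

theorem wordCount_mono (w σ : ℕ) {l l' : ℕ} (h : l ≤ l') : wordCount w σ l ≤ wordCount w σ l' :=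
  Nat.div_le_div_right (by omega)

theorem tableOf_of_wild_zero {σ : ℕ} {k : Key σ} (hk : wild k = 0) :
    tableOf k = .exact k.length := by
  rw [wild] at hk
  simp [tableOf, hk]

theorem tableOf_of_wild_one {σ : ℕ} {k : Key σ} (hk : wild k = 1) : tableOf k = .one := by
  rw [wild] at hk
  simp [tableOf, hk]

theorem tableOf_of_wild_two {σ : ℕ} {k : Key σ} (hk : wild k = 2) : tableOf k = .two := by
  rw [wild] at hk
  simp [tableOf, hk]

/-! ### Expected search costs -/

/-- A hash value that is uniform on a multiple of `t` many values is uniform modulo `t`. -/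
theorem measure_mod_le {Ω : Type u} [MeasurableSpace Ω] {μ : Measure Ω} [IsProbabilityMeasure μ]
    {X : Ω → ℕ} (hX : Measurable X) {t q : ℕ} (ht : 0 < t) (hq : 0 < q)
    (hunif : ∀ v < t * q, μ {ω | X ω = v} = ((t * q : ℕ) : ℝ≥0∞)⁻¹) {v : ℕ} (hv : v < t) :
    μ {ω | X ω % t = v} ≤ (t : ℝ≥0∞)⁻¹ := by
  have hne : ((t * q : ℕ) : ℝ≥0∞) ≠ 0 := by exact_mod_cast (Nat.mul_pos ht hq).ne'
  have hmeas : ∀ u, MeasurableSet {ω | X ω = u} := fun u => hX (measurableSet_singleton u)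
  -- the values outside the range have probability zero
  have hnull : μ (⋃ u ∈ Finset.range (t * q), {ω | X ω = u})ᶜ = 0 := by
    rw [prob_compl_eq_zero_iff (Finset.measurableSet_biUnion _ fun u _ => hmeas u),
      measure_biUnion_finset _ fun u _ => hmeas u]
    · rw [Finset.sum_congr rfl fun u hu => hunif u (Finset.mem_range.1 hu), Finset.sum_const,
        Finset.card_range, nsmul_eq_mul, ENNReal.mul_inv_cancel hne (ENNReal.natCast_ne_top _)]
    · intro u _ u' _ huu'
      exact Set.disjoint_left.2 fun ω hω hω' => huu' (hω.symm.trans hω')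
  have hsub : {ω | X ω % t = v} ⊆ (⋃ u ∈ Finset.range (t * q), {ω | X ω = u})ᶜ ∪
      ⋃ i ∈ Finset.range q, {ω | X ω = v + t * i} := by
    intro ω hω
    by_cases hlt : X ω < t * q
    · right
      simp only [Set.mem_iUnion, Finset.mem_range, exists_prop, Set.mem_ofPred_eq]
      refine ⟨X ω / t, Nat.div_lt_of_lt_mul hlt, ?_⟩
      rw [← hω]
      exact (Nat.mod_add_div _ _).symm
    · left
      simp only [Set.mem_compl_iff, Set.mem_iUnion, Finset.mem_range, exists_prop, not_exists,
        not_and]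
      rintro u hu rfl
      exact hlt hu
  calc μ {ω | X ω % t = v}
      ≤ μ (⋃ u ∈ Finset.range (t * q), {ω | X ω = u})ᶜ +
        μ (⋃ i ∈ Finset.range q, {ω | X ω = v + t * i}) :=
        (measure_mono hsub).trans (measure_union_le _ _)
    _ ≤ ∑ i ∈ Finset.range q, μ {ω | X ω = v + t * i} := by
        rw [hnull, zero_add]
        exact measure_biUnion_finset_le _ _
    _ = q * ((t * q : ℕ) : ℝ≥0∞)⁻¹ := by
        rw [Finset.sum_congr rfl fun i hi => hunif (v + t * i) ?_, Finset.sum_const,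
          Finset.card_range, nsmul_eq_mul]
        have := Finset.mem_range.1 hi
        nlinarith
    _ = (t : ℝ≥0∞)⁻¹ := by
        have hq' : (q : ℝ≥0∞) ≠ 0 := by exact_mod_cast hq.ne'
        rw [Nat.cast_mul, ENNReal.mul_inv (Or.inr (ENNReal.natCast_ne_top q)) (Or.inr hq'),
          mul_left_comm, ENNReal.mul_inv_cancel hq' (ENNReal.natCast_ne_top q), mul_one]

/-- The standing assumptions of the cost analysis: load factor `α`, hash evaluation time `c`, pairwise
distinct keys in every table, independent hash values that are uniform modulo the table size, and an
upper bound `K` for the expected number of overfull windows. -/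
structure Setting {σ r : ℕ} (α : ℝ) (c K : ℕ) (cfg : Config r) (T : HashCost σ) (D : List (Str σ))
    {Ω : Type u} [MeasurableSpace Ω] (μ : Measure Ω) (h : Ω → Key σ → ℕ) : Prop where
  alpha_pos : 0 < α
  alpha_lt : α < 1
  w_pos : 0 < cfg.w
  delta_pos : 0 < cfg.δ
  cap_eq : cfg.cap = capacity α
  chars_pos : 0 < charsPerWord cfg.w σ
  nodup : D.Nodup
  nodup1 : ((D.flatMap entries1).map Prod.fst).Nodup
  nodup2 : ((D.flatMap entries2).map Prod.fst).Nodup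
  incremental : T.Incremental 2 c
  measurable : ∀ k, Measurable fun ω => h ω k
  indep : iIndepFun (fun k ω => h ω k) μ
  unif : ∀ k, ∀ v < tableSize cfg.cap D (tableOf k),
    μ {ω | h ω k % tableSize cfg.cap D (tableOf k) = v} ≤
      (tableSize cfg.cap D (tableOf k) : ℝ≥0∞)⁻¹
  bound : overloadBound α ≤ K

/-- The overload of the level-1 store, for a search with the key `k`. -/
def overload1 {σ : ℕ} (cap : ℕ → ℕ) (D : List (Str σ)) (h : Key σ → ℕ) (k : Key σ) : ℕ :=
  overload (cap (totalLength D)) ((D.flatMap entries1).map Prod.fst).toFinset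
    (fun k => h k % cap (totalLength D)) k

/-- The overload of the level-2 store, for a search with the key `k`. -/
def overload2 {σ : ℕ} (cap : ℕ → ℕ) (D : List (Str σ)) (h : Key σ → ℕ) (k : Key σ) : ℕ :=
  overload (cap (pairCount D)) ((D.flatMap entries2).map Prod.fst).toFinset
    (fun k => h k % cap (pairCount D)) k

/-- The overload of the exact table that is searched for the word `y`. -/
def overload0 {σ : ℕ} (cap : ℕ → ℕ) (D : List (Str σ)) (h : Key σ → ℕ) (y : Str σ) : ℕ :=
  overload (cap (lengthCount D y.length)) ((D.filter fun x => x.length = y.length).map toKey).toFinset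
    (fun k => h k % cap (lengthCount D y.length)) (toKey y)

namespace Setting

variable {σ r : ℕ} {α : ℝ} {c K : ℕ} {cfg : Config r} {T : HashCost σ} {D : List (Str σ)}
  {Ω : Type u} [MeasurableSpace Ω] {μ : Measure Ω} {h : Ω → Key σ → ℕ}

theorem cap_pos (H : Setting α c K cfg T D μ h) (n : ℕ) : 0 < cfg.cap n := by
  rw [H.cap_eq]; exact capacity_pos α n

theorem lt_cap (H : Setting α c K cfg T D μ h) (n : ℕ) : n < cfg.cap n := by
  rw [H.cap_eq]; exact lt_capacity H.alpha_pos H.alpha_lt n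

section Overload

theorem measurable_home (H : Setting α c K cfg T D μ h) (t : ℕ) (k : Key σ) :
    Measurable fun ω => h ω k % t :=
  (Measurable.of_discrete (f := fun v : ℕ => v % t)).comp (H.measurable k)

theorem lintegral_overload [IsProbabilityMeasure μ] (H : Setting α c K cfg T D μ h) {τ : TableId}
    {n : ℕ} (hn : tableSize cfg.cap D τ = cfg.cap n) {S : Finset (Key σ)} (hcard : S.card ≤ n)
    {k : Key σ} (hS : ∀ k' ∈ insert k S, tableOf k' = τ) :
    ∫⁻ ω, (overload (cfg.cap n) S (fun k => h ω k % cfg.cap n) k : ℝ≥0∞) ∂μ ≤ K := by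
  have hind := H.indep.comp (fun _ v => v % cfg.cap n) fun _ => Measurable.of_discrete
  refine (lintegral_overload_le H.alpha_pos H.alpha_lt (H.measurable_home _) hind
    (H.cap_pos n) (fun k ω => Nat.mod_lt _ (H.cap_pos n)) ?_ fun k' hk' v hv => ?_).trans H.bound
  · rw [H.cap_eq]
    exact le_trans (by exact_mod_cast hcard) (le_mul_capacity H.alpha_pos n)
  · have := H.unif k' v
    rw [hS k' hk', hn] at this
    exact this hv

theorem lintegral_overload0 [IsProbabilityMeasure μ] (H : Setting α c K cfg T D μ h) (y : Str σ) :
    ∫⁻ ω, (overload0 cfg.cap D (h ω) y : ℝ≥0∞) ∂μ ≤ K := by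
  refine H.lintegral_overload (τ := .exact y.length) rfl
    ((List.toFinset_card_le _).trans_eq (List.length_map _)) fun k' hk' => ?_
  simp only [Finset.mem_insert, List.mem_toFinset, List.mem_map, List.mem_filter,
    decide_eq_true_eq] at hk'
  rcases hk' with rfl | ⟨x, ⟨-, hx⟩, rfl⟩
  · rw [tableOf_of_wild_zero (wild_toKey y), length_toKey]
  · rw [tableOf_of_wild_zero (wild_toKey x), length_toKey, hx]

theorem lintegral_overload1 [IsProbabilityMeasure μ] (H : Setting α c K cfg T D μ h) {k : Key σ}
    (hk : wild k = 1) : ∫⁻ ω, (overload1 cfg.cap D (h ω) k : ℝ≥0∞) ∂μ ≤ K := by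
  refine H.lintegral_overload (τ := .one) rfl ((List.toFinset_card_le _).trans_eq (by
    rw [List.length_map, length_flatMap_entries1])) fun k' hk' => ?_
  simp only [Finset.mem_insert, List.mem_toFinset, List.mem_map, List.mem_flatMap] at hk'
  rcases hk' with rfl | ⟨e, ⟨x, -, he⟩, rfl⟩
  · exact tableOf_of_wild_one hk
  · exact tableOf_of_wild_one (entries1_spec he).2

theorem lintegral_overload2 [IsProbabilityMeasure μ] (H : Setting α c K cfg T D μ h) {k : Key σ}
    (hk : wild k = 2) : ∫⁻ ω, (overload2 cfg.cap D (h ω) k : ℝ≥0∞) ∂μ ≤ K := by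
  refine H.lintegral_overload (τ := .two) rfl ((List.toFinset_card_le _).trans_eq (by
    rw [List.length_map, length_flatMap_entries2])) fun k' hk' => ?_
  simp only [Finset.mem_insert, List.mem_toFinset, List.mem_map, List.mem_flatMap] at hk'
  rcases hk' with rfl | ⟨e, ⟨x, -, he⟩, rfl⟩
  · exact tableOf_of_wild_two hk
  · exact tableOf_of_wild_two (entries2_spec he).2

theorem measurable_overload0 (H : Setting α c K cfg T D μ h) (y : Str σ) :
    Measurable fun ω => overload0 cfg.cap D (h ω) y :=
  measurable_overload (H.measurable_home _) _ _ _

theorem measurable_overload1 (H : Setting α c K cfg T D μ h) (k : Key σ) :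
    Measurable fun ω => overload1 cfg.cap D (h ω) k :=
  measurable_overload (H.measurable_home _) _ _ _

theorem measurable_overload2 (H : Setting α c K cfg T D μ h) (k : Key σ) :
    Measurable fun ω => overload2 cfg.cap D (h ω) k :=
  measurable_overload (H.measurable_home _) _ _ _

theorem runLen_store_le {t : ℕ} (ht : 0 < t) {L L' : List (Key σ × Fin σ)} (hL : L' <+: L)
    (hnd : (L.map Prod.fst).Nodup) (hlen : L.length < t) (g : Key σ → ℕ) (k : Key σ) :
    runLen t (fillTable t (storeItems cfg g t L')) t (g k % t) ≤
      overload t (L.map Prod.fst).toFinset (fun k => g k % t) k :=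
  runLen_le_overload (home := fun k => g k % t) (fun _ => Nat.mod_lt _ ht) Prod.fst
    (fun e => (e.2, cfg.sig (g e.1))) (hnd.sublist (hL.sublist.map _))
    (fun _ he => List.mem_toFinset.2 (List.mem_map_of_mem (hL.subset he)))
    (hL.length_le.trans_lt hlen) k

theorem runLen_store1_le (H : Setting α c K cfg T D μ h) {L : List (Key σ × Fin σ)}
    (hL : L <+: D.flatMap entries1) (g : Key σ → ℕ) (k : Key σ) :
    runLen (cfg.cap (totalLength D)) (fillTable (cfg.cap (totalLength D))
      (storeItems cfg g (cfg.cap (totalLength D)) L)) (cfg.cap (totalLength D))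
      (g k % cfg.cap (totalLength D)) ≤ overload1 cfg.cap D g k :=
  runLen_store_le (H.cap_pos _) hL H.nodup1 (by rw [length_flatMap_entries1]; exact H.lt_cap _) g k

theorem runLen_store2_le (H : Setting α c K cfg T D μ h) {L : List (Key σ × Fin σ)}
    (hL : L <+: D.flatMap entries2) (g : Key σ → ℕ) (k : Key σ) :
    runLen (cfg.cap (pairCount D)) (fillTable (cfg.cap (pairCount D))
      (storeItems cfg g (cfg.cap (pairCount D)) L)) (cfg.cap (pairCount D))
      (g k % cfg.cap (pairCount D)) ≤ overload2 cfg.cap D g k :=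
  runLen_store_le (H.cap_pos _) hL H.nodup2 (by rw [length_flatMap_entries2]; exact H.lt_cap _) g k

theorem runLen_exact_le (H : Setting α c K cfg T D μ h) {D' : List (Str σ)} (hD : D' <+: D)
    (g : Key σ → ℕ) (y : Str σ) :
    runLen (cfg.cap (lengthCount D y.length)) (fillTable (cfg.cap (lengthCount D y.length))
      (exactItems g (cfg.cap (lengthCount D y.length)) (D'.filter fun x => x.length = y.length)))
      (cfg.cap (lengthCount D y.length)) (g (toKey y) % cfg.cap (lengthCount D y.length)) ≤
      overload0 cfg.cap D g y := by
  have hpre : (D'.filter fun x => x.length = y.length) <+: D.filter fun x => x.length = y.length :=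
    hD.filter _
  refine runLen_le_overload (home := fun k => g k % cfg.cap (lengthCount D y.length))
    (fun _ => Nat.mod_lt _ (H.cap_pos _)) toKey (fun x => x)
    (((H.nodup.sublist hD.sublist).filter _).map toKey_injective)
    (fun x hx => List.mem_toFinset.2 (List.mem_map_of_mem (hpre.subset hx)))
    (hpre.length_le.trans_lt (H.lt_cap _)) (toKey y)

end Overload

section Query

variable {x : Str σ} {k : Key σ}

theorem eval_le (H : Setting α c K cfg T D μ h) (hd : editDist (toKey x) k ≤ 2) :
    T.eval (toKey x) k ≤ c := H.incremental.2 _ _ hd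

theorem lookup1_le (H : Setting α c K cfg T D μ h) (hd : editDist (toKey x) k ≤ 2) (g : Key σ → ℕ) :
    (lookupStore cfg T g (toKey x) (build cfg T g D).val.one k).val.length ≤
      overload1 cfg.cap D g k ∧
    (lookupStore cfg T g (toKey x) (build cfg T g D).val.one k).cost ≤
      c + (overload1 cfg.cap D g k + 1) * (4 + 2 * cfg.δ) := by
  rw [build_one]
  set t := cfg.cap (totalLength D)
  have hlt : g k % t < t := Nat.mod_lt _ (H.cap_pos _)
  have hrep := represents_finish H.w_pos H.delta_pos 1 t
    (fillTable t (storeItems cfg g t (D.flatMap entries1)))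
  have hrun := H.runLen_store1_le List.prefix_rfl g k
  have hsz : (storeTable cfg g t (D.flatMap entries1)).size = t := size_finish ..
  simp only [lookupStore, val_bind, cost_bind, hashAt, hsz]
  exact ⟨(length_scanStore_le hrep _ t hlt).trans hrun, Nat.add_le_add (H.eval_le hd)
    ((scanStore_cost_le H.w_pos H.delta_pos hrep _ t hlt).trans
      (Nat.mul_le_mul_right _ (Nat.add_le_add_right hrun 1)))⟩

theorem lookup2_le (H : Setting α c K cfg T D μ h) (hd : editDist (toKey x) k ≤ 2) (g : Key σ → ℕ) :
    (lookupStore cfg T g (toKey x) (build cfg T g D).val.two k).val.length ≤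
      overload2 cfg.cap D g k ∧
    (lookupStore cfg T g (toKey x) (build cfg T g D).val.two k).cost ≤
      c + (overload2 cfg.cap D g k + 1) * (4 + 2 * cfg.δ) := by
  rw [build_two]
  set t := cfg.cap (pairCount D)
  have hlt : g k % t < t := Nat.mod_lt _ (H.cap_pos _)
  have hrep := represents_finish H.w_pos H.delta_pos 1 t
    (fillTable t (storeItems cfg g t (D.flatMap entries2)))
  have hrun := H.runLen_store2_le List.prefix_rfl g k
  have hsz : (storeTable cfg g t (D.flatMap entries2)).size = t := size_finish ..
  simp only [lookupStore, val_bind, cost_bind, hashAt, hsz]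
  exact ⟨(length_scanStore_le hrep _ t hlt).trans hrun, Nat.add_le_add (H.eval_le hd)
    ((scanStore_cost_le H.w_pos H.delta_pos hrep _ t hlt).trans
      (Nat.mul_le_mul_right _ (Nat.add_le_add_right hrun 1)))⟩

theorem check_cost_le (H : Setting α c K cfg T D μ h) {y : Str σ}
    (hd : editDist (toKey x) (toKey y) ≤ 2) (g : Key σ → ℕ) :
    (checkCandidate cfg T g (toKey x) (build cfg T g D).val (toKey y)).cost ≤
      wordCount cfg.w σ y.length + 2 + c +
        (overload0 cfg.cap D g y + 1) * (3 + 2 * cfg.δ + wordCount cfg.w σ y.length) := by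
  simp only [checkCandidate, cost_bind, reduceOption_toKey, build_maxLen, cost_tick]
  split_ifs with hlen
  · simp only [cost_pure]; omega
  · rw [build_exact cfg T g D (by omega)]
    simp only [cost_bind]
    set t := cfg.cap (lengthCount D y.length)
    have hlt : g (toKey y) % t < t := Nat.mod_lt _ (H.cap_pos _)
    have hrep := represents_finish H.w_pos H.delta_pos (wordCount cfg.w σ y.length + 1) t
      (fillTable t (exactItems g t (D.filter fun x => x.length = y.length)))
    have hrun := H.runLen_exact_le List.prefix_rfl g y
    have hsz : (exactTable cfg g D y.length).size = t := size_finish ..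
    have hscan : (scanExact cfg (exactTable cfg g D y.length) y t (g (toKey y) % t)).cost ≤
        (overload0 cfg.cap D g y + 1) * (3 + 2 * cfg.δ + wordCount cfg.w σ y.length) :=
      (scanExact_cost_le H.w_pos H.delta_pos hrep y t hlt).trans
        (Nat.mul_le_mul_right _ (Nat.add_le_add_right hrun 1))
    have hev := H.eval_le hd
    simp only [hashAt, hsz]
    split_ifs <;> simp only [cost_bind, cost_tick, cost_pure] <;> omega

end Query

end Setting

/-! ### The expected query time -/

theorem measurable_natCast {Ω : Type u} [MeasurableSpace Ω] {f : Ω → ℕ} (hf : Measurable f) :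
    Measurable fun ω => (f ω : ℝ≥0∞) :=
  (Measurable.of_discrete (f := (Nat.cast : ℕ → ℝ≥0∞))).comp hf

theorem lintegral_list_sum_le {Ω : Type u} [MeasurableSpace Ω] {μ : Measure Ω} {α : Type}
    (l : List α) (f : α → Ω → ℕ) (B : α → ℕ) (hf : ∀ a ∈ l, Measurable (f a))
    (hB : ∀ a ∈ l, ∫⁻ ω, (f a ω : ℝ≥0∞) ∂μ ≤ B a) :
    ∫⁻ ω, (((l.map fun a => f a ω).sum : ℕ) : ℝ≥0∞) ∂μ ≤ ((l.map B).sum : ℕ) := by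
  induction l with
  | nil => simp
  | cons a l ih =>
    simp only [List.map_cons, List.sum_cons, Nat.cast_add]
    rw [lintegral_add_left (measurable_natCast (hf a (by simp)))]
    exact add_le_add (hB a (by simp))
      (ih (fun b hb => hf b (by simp [hb])) fun b hb => hB b (by simp [hb]))

theorem measurable_list_sum {Ω : Type u} [MeasurableSpace Ω] {α : Type} {l : List α} {f : α → Ω → ℕ}
    (hf : ∀ a ∈ l, Measurable (f a)) : Measurable fun ω => (l.map fun a => f a ω).sum := by
  induction l with
  | nil => exact measurable_const
  | cons a l ih =>
    simp only [List.map_cons, List.sum_cons]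
    exact (hf a (by simp)).fun_add (ih fun b hb => hf b (by simp [hb]))

theorem lintegral_list_sum_const_le {Ω : Type u} [MeasurableSpace Ω] {μ : Measure Ω} {α : Type}
    (l : List α) (f : α → Ω → ℕ) (B : ℕ) (hf : ∀ a ∈ l, Measurable (f a))
    (hB : ∀ a ∈ l, ∫⁻ ω, (f a ω : ℝ≥0∞) ∂μ ≤ B) :
    ∫⁻ ω, (((l.map fun a => f a ω).sum : ℕ) : ℝ≥0∞) ∂μ ≤ (l.length * B : ℕ) := by
  refine (lintegral_list_sum_le l f (fun _ => B) hf hB).trans_eq ?_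
  simp

section FinDep

variable {σ r : ℕ} (cfg : Config r) (T : HashCost σ) (D : List (Str σ))

theorem finDep_storeTable (t : ℕ) {P : Set (Key σ)} {L : List (Key σ × Fin σ)}
    (hL : ∀ e ∈ L, e.1 ∈ P) : FinDep P fun h => storeTable cfg h t L := by
  have : FinDep P fun h => storeItems cfg h t L :=
    FinDep.list_map (F := fun e h => (h e.1 % t, e.2, cfg.sig (h e.1))) fun e he =>
      (FinDep.eval (hL e he)).comp fun v => (v % t, e.2, cfg.sig v)
  exact this.comp fun items => (finish cfg 1 t (fillTable t items)).val

theorem finDep_exactTable (l : ℕ) :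
    FinDep {k : Key σ | wild k = 0} fun h => exactTable cfg h D l := by
  have : FinDep {k : Key σ | wild k = 0} fun h => exactItems h (cfg.cap (lengthCount D l))
      (D.filter fun x => x.length = l) :=
    FinDep.list_map (F := fun x h => (h (toKey x) % cfg.cap (lengthCount D l), x)) fun x _ =>
      (FinDep.eval (k := toKey x) (wild_toKey x)).comp fun v => (v % cfg.cap (lengthCount D l), x)
  exact this.comp fun items => (finish cfg (wordCount cfg.w σ l + 1) (cfg.cap (lengthCount D l))
    (fillTable (cfg.cap (lengthCount D l)) items)).val

theorem finDep_lookup1 (x : Key σ) {k : Key σ} (hk : wild k = 1) :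
    FinDep {k : Key σ | wild k = 1} fun h =>
      lookupStore cfg T h x (build cfg T h D).val.one k := by
  simp only [build_one]
  refine (finDep_storeTable cfg _ fun e he => ?_).comp₂ (fun tb v =>
    (⟨v, T.eval x k⟩ : Timed ℕ) >>= fun v => scanStore cfg tb (cfg.sig v) tb.size (v % tb.size))
    (FinDep.eval hk)
  obtain ⟨y, -, he⟩ := List.mem_flatMap.1 he
  exact (entries1_spec he).2

theorem finDep_lookup2 (x : Key σ) {k : Key σ} (hk : wild k = 2) :
    FinDep {k : Key σ | wild k = 2} fun h =>
      lookupStore cfg T h x (build cfg T h D).val.two k := by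
  simp only [build_two]
  refine (finDep_storeTable cfg _ fun e he => ?_).comp₂ (fun tb v =>
    (⟨v, T.eval x k⟩ : Timed ℕ) >>= fun v => scanStore cfg tb (cfg.sig v) tb.size (v % tb.size))
    (FinDep.eval hk)
  obtain ⟨y, -, he⟩ := List.mem_flatMap.1 he
  exact (entries2_spec he).2

theorem finDep_check (x : Key σ) {k : Key σ} (hk : wild k = 0) :
    FinDep {k : Key σ | wild k = 0} fun h =>
      (checkCandidate cfg T h x (build cfg T h D).val k).cost := by
  simp only [checkCandidate, build_maxLen, cost_bind]
  by_cases hlen : maxLength D < k.reduceOption.length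
  · simp only [hlen, ↓reduceIte]
    exact FinDep.const _ _
  · simp only [hlen, ↓reduceIte]
    simp only [build_exact cfg T _ D (not_lt.1 hlen)]
    exact (finDep_exactTable cfg D k.reduceOption.length).comp₂ (fun tb v => (do
      tick (wordCount cfg.w σ k.reduceOption.length + 1)
      let v ← (⟨v, T.eval x k⟩ : Timed ℕ)
      let b ← scanExact cfg tb k.reduceOption tb.size (v % tb.size)
      if b then do
        tick 1
        pure [k.reduceOption]
      else pure [] : Timed (List (Str σ))).cost) (FinDep.eval hk)

theorem cost_resolveOne (h : Key σ → ℕ) (x k : Key σ) (d : Dict σ r) :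
    (resolveOne cfg T h x d k).cost = (lookupStore cfg T h x d.one k).cost +
      ((lookupStore cfg T h x d.one k).val.map fun c =>
        1 + (checkCandidate cfg T h x d (fill c k)).cost).sum := by
  simp only [resolveOne, cost_bind, cost_collect]

theorem cost_resolveTwo (h : Key σ → ℕ) (x k : Key σ) (d : Dict σ r) :
    (resolveTwo cfg T h x d k).cost = (lookupStore cfg T h x d.two k).cost +
      ((lookupStore cfg T h x d.two k).val.map fun c =>
        1 + (resolveOne cfg T h x d (fill c k)).cost).sum := by
  simp only [resolveTwo, cost_bind, cost_collect]

theorem finDep_resolveOne (x : Key σ) {k : Key σ} (hk : wild k = 1) :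
    FinDep {k : Key σ | wild k ≤ 1} fun h =>
      (resolveOne cfg T h x (build cfg T h D).val k).cost := by
  simp only [cost_resolveOne]
  exact ((finDep_lookup1 cfg T D x hk).mono fun k (hk : wild k = 1) => hk.le).comp₂
    (fun l f => l.cost + (l.val.map fun c => 1 + f c).sum)
    (FinDep.pi (F := fun c h => (checkCandidate cfg T h x (build cfg T h D).val (fill c k)).cost)
      fun c => (finDep_check cfg T D x (k := fill c k) (by rw [wild_fill, hk])).mono
        fun k (hk : wild k = 0) => hk.le.trans zero_le_one)

theorem finDep_resolveTwo (x : Key σ) {k : Key σ} (hk : wild k = 2) :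
    FinDep Set.univ fun h => (resolveTwo cfg T h x (build cfg T h D).val k).cost := by
  simp only [cost_resolveTwo]
  exact ((finDep_lookup2 cfg T D x hk).mono (Set.subset_univ _)).comp₂
    (fun l f => l.cost + (l.val.map fun c => 1 + f c).sum)
    (FinDep.pi (F := fun c h => (resolveOne cfg T h x (build cfg T h D).val (fill c k)).cost)
      fun c => (finDep_resolveOne cfg T D x (k := fill c k) (by rw [wild_fill, hk])).mono
        (Set.subset_univ _))

end FinDep

namespace Setting

variable {σ r : ℕ} {α : ℝ} {c K : ℕ} {cfg : Config r} {T : HashCost σ} {D : List (Str σ)}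
  {Ω : Type u} [MeasurableSpace Ω] {μ : Measure Ω} [IsProbabilityMeasure μ] {h : Ω → Key σ → ℕ}

/-- The expected value of an affine function of a random number of expected value at most `K`. -/
theorem lintegral_affine_le {f : Ω → ℕ} (hf : Measurable f) {K : ℕ}
    (hK : ∫⁻ ω, (f ω : ℝ≥0∞) ∂μ ≤ K) (a b : ℕ) :
    ∫⁻ ω, ((a + (f ω + 1) * b : ℕ) : ℝ≥0∞) ∂μ ≤ (a + (K + 1) * b : ℕ) := by
  have hf' := measurable_natCast hf
  push_cast
  rw [lintegral_add_left measurable_const, lintegral_mul_const' _ _ (ENNReal.natCast_ne_top b),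
    lintegral_add_right _ measurable_const]
  simp only [lintegral_const, measure_univ, mul_one]
  gcongr

/-- The bound for the expected cost of a search of a substitution store, and, up to a factor of the
order of the number of words of the packed string, of the check of a candidate. -/
def searchBound (c K δ : ℕ) : ℕ := c + 2 + (K + 1) * (4 + 2 * δ)

variable {x : Str σ} {k : Key σ}

theorem lintegral_check_le (H : Setting α c K cfg T D μ h) (hk : wild k = 0)
    (hd : editDist (toKey x) k ≤ 2) :
    ∫⁻ ω, ((checkCandidate cfg T (h ω) (toKey x) (build cfg T (h ω) D).val k).cost : ℝ≥0∞) ∂μ ≤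
      (searchBound c K cfg.δ * (wordCount cfg.w σ (x.length + 2) + 1) : ℕ) := by
  obtain ⟨y, rfl⟩ : ∃ y, toKey y = k := ⟨_, toKey_reduceOption hk⟩
  have hW : wordCount cfg.w σ y.length ≤ wordCount cfg.w σ (x.length + 2) :=
    wordCount_mono _ _ (by simpa using length_le_of_editDist_le hd)
  refine (lintegral_mono fun ω => Nat.cast_le.2 (H.check_cost_le hd (h ω))).trans
    ((lintegral_affine_le (H.measurable_overload0 y) (H.lintegral_overload0 y) _ _).trans ?_)
  rw [Nat.cast_le, searchBound]
  set W := wordCount cfg.w σ (x.length + 2)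
  calc wordCount cfg.w σ y.length + 2 + c + (K + 1) * (3 + 2 * cfg.δ + wordCount cfg.w σ y.length)
      ≤ W + 2 + c + (K + 1) * (3 + 2 * cfg.δ + W) := by gcongr
    _ ≤ (c + 2 + (K + 1) * (4 + 2 * cfg.δ)) * (W + 1) := by
        have := Nat.zero_le (c * W + W + (K + 1) * (3 + 2 * cfg.δ) * W + (K + 1))
        nlinarith

theorem lintegral_lookup1_le (H : Setting α c K cfg T D μ h) (hk : wild k = 1)
    (hd : editDist (toKey x) k ≤ 2) :
    ∫⁻ ω, ((lookupStore cfg T (h ω) (toKey x) (build cfg T (h ω) D).val.one k).cost : ℝ≥0∞) ∂μ ≤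
      (searchBound c K cfg.δ : ℕ) := by
  refine (lintegral_mono fun ω => Nat.cast_le.2 (H.lookup1_le hd (h ω)).2).trans
    ((lintegral_affine_le (H.measurable_overload1 k) (H.lintegral_overload1 hk) _ _).trans ?_)
  rw [Nat.cast_le, searchBound]
  omega

theorem lintegral_lookup2_le (H : Setting α c K cfg T D μ h) (hk : wild k = 2)
    (hd : editDist (toKey x) k ≤ 2) :
    ∫⁻ ω, ((lookupStore cfg T (h ω) (toKey x) (build cfg T (h ω) D).val.two k).cost : ℝ≥0∞) ∂μ ≤
      (searchBound c K cfg.δ : ℕ) := by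
  refine (lintegral_mono fun ω => Nat.cast_le.2 (H.lookup2_le hd (h ω)).2).trans
    ((lintegral_affine_le (H.measurable_overload2 k) (H.lintegral_overload2 hk) _ _).trans ?_)
  rw [Nat.cast_le, searchBound]
  omega

theorem lintegral_const_add_le (a : ℕ) {f : Ω → ℕ} {B : ℕ}
    (hB : ∫⁻ ω, (f ω : ℝ≥0∞) ∂μ ≤ B) : ∫⁻ ω, ((a + f ω : ℕ) : ℝ≥0∞) ∂μ ≤ (a + B : ℕ) := by
  push_cast
  rw [lintegral_add_left measurable_const]
  simp only [lintegral_const, measure_univ, mul_one]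
  gcongr

/-- The candidates that the level-1 store yields are independent of the costs of their checks, as the
former depend on keys with one wildcard and the latter on keys without wildcards. -/
theorem lintegral_resolveOne_le (H : Setting α c K cfg T D μ h) (hk : wild k = 1)
    (hd : editDist (toKey x) k ≤ 2) :
    ∫⁻ ω, ((resolveOne cfg T (h ω) (toKey x) (build cfg T (h ω) D).val k).cost : ℝ≥0∞) ∂μ ≤
      (searchBound c K cfg.δ + K * (1 + searchBound c K cfg.δ *
        (wordCount cfg.w σ (x.length + 2) + 1)) : ℕ) := by
  have hl := finDep_lookup1 cfg T D (toKey x) hk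
  have hcost := (hl.comp fun l => (l.cost : ℝ≥0∞)).measurable H.measurable
  simp only [cost_resolveOne, Nat.cast_add (lookupStore _ _ _ _ _ _).cost]
  rw [lintegral_add_left hcost, Nat.cast_add, Nat.cast_mul]
  refine add_le_add (H.lintegral_lookup1_le hk hd) ?_
  refine FinDep.lintegral_sum_map_le (hl.comp fun l => l.val)
    (C := fun c g => 1 + (checkCandidate cfg T g (toKey x) (build cfg T g D).val (fill c k)).cost)
    (fun c => (finDep_check cfg T D (toKey x) (k := fill c k) (by rw [wild_fill, hk])).comp
      fun n => 1 + n) ?_ H.measurable H.indep ?_ fun c => lintegral_const_add_le 1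
      (H.lintegral_check_le (by rw [wild_fill, hk]) (editDist_fill_le c hd))
  · exact Set.disjoint_left.2 fun k (h₁ : wild k = 1) (h₂ : wild k = 0) => by omega
  · exact (lintegral_mono fun ω => Nat.cast_le.2 (H.lookup1_le hd (h ω)).1).trans
      (H.lintegral_overload1 hk)

/-- The same as `lintegral_resolveOne_le`, one level up: the characters that the level-2 store yields
depend on keys with two wildcards, and the cost of their resolution on keys with at most one. -/
theorem lintegral_resolveTwo_le (H : Setting α c K cfg T D μ h) (hk : wild k = 2)
    (hd : editDist (toKey x) k ≤ 2) :
    ∫⁻ ω, ((resolveTwo cfg T (h ω) (toKey x) (build cfg T (h ω) D).val k).cost : ℝ≥0∞) ∂μ ≤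
      (searchBound c K cfg.δ + K * (1 + (searchBound c K cfg.δ + K * (1 + searchBound c K cfg.δ *
        (wordCount cfg.w σ (x.length + 2) + 1)))) : ℕ) := by
  have hl := finDep_lookup2 cfg T D (toKey x) hk
  have hcost := (hl.comp fun l => (l.cost : ℝ≥0∞)).measurable H.measurable
  simp only [cost_resolveTwo, Nat.cast_add (lookupStore _ _ _ _ _ _).cost]
  rw [lintegral_add_left hcost, Nat.cast_add, Nat.cast_mul]
  refine add_le_add (H.lintegral_lookup2_le hk hd) ?_
  refine FinDep.lintegral_sum_map_le (hl.comp fun l => l.val)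
    (C := fun c g => 1 + (resolveOne cfg T g (toKey x) (build cfg T g D).val (fill c k)).cost)
    (fun c => (finDep_resolveOne cfg T D (toKey x) (k := fill c k) (by rw [wild_fill, hk])).comp
      fun n => 1 + n) ?_ H.measurable H.indep ?_ fun c => lintegral_const_add_le 1
      (H.lintegral_resolveOne_le (by rw [wild_fill, hk]) (editDist_fill_le c hd))
  · exact Set.disjoint_left.2 fun k (h₁ : wild k = 2) (h₂ : wild k ≤ 1) => by omega
  · exact (lintegral_mono fun ω => Nat.cast_le.2 (H.lookup2_le hd (h ω)).1).trans
      (H.lintegral_overload2 hk)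

/-- The constant of the query time, in units of the number of words of a packed candidate. -/
def queryBound (c K δ : ℕ) : ℕ :=
  c + 12 + 6 * (1 + searchBound c K δ) * (1 + K) ^ 2

theorem lintegral_query_le (H : Setting α c K cfg T D μ h) (x : Str σ) :
    ∫⁻ ω, ((query cfg T (h ω) (build cfg T (h ω) D).val x).cost : ℝ≥0∞) ∂μ ≤
      (queryBound c K cfg.δ * ((x.length + 1) ^ 2 *
        (wordCount cfg.w σ (x.length + 2) + 1)) : ℕ) := by
  set Q := searchBound c K cfg.δ with hQ
  set V := wordCount cfg.w σ (x.length + 2) + 1 with hV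
  set m := x.length with hm
  have hpre : T.pre (toKey x) ≤ c * (m + 1) := by simpa [hm] using H.incremental.1 (toKey x)
  have one_meas : ∀ {f : Ω → ℕ}, Measurable f → Measurable fun ω => 1 + f ω := fun hf =>
    (Measurable.of_discrete (f := fun n : ℕ => 1 + n)).comp hf
  have m₀ : ∀ k ∈ probes0 (toKey x), Measurable fun ω =>
      1 + (checkCandidate cfg T (h ω) (toKey x) (build cfg T (h ω) D).val k).cost := fun k hk =>
    one_meas ((finDep_check cfg T D _ (probes0_spec (wild_toKey x) hk).2).measurable H.measurable)
  have m₁ : ∀ k ∈ probes1 (toKey x), Measurable fun ω =>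
      1 + (resolveOne cfg T (h ω) (toKey x) (build cfg T (h ω) D).val k).cost := fun k hk =>
    one_meas ((finDep_resolveOne cfg T D _ (probes1_spec (wild_toKey x) hk).2).measurable
      H.measurable)
  have m₂ : ∀ k ∈ probes2 (toKey x), Measurable fun ω =>
      1 + (resolveTwo cfg T (h ω) (toKey x) (build cfg T (h ω) D).val k).cost := fun k hk =>
    one_meas ((finDep_resolveTwo cfg T D _ (probes2_spec (wild_toKey x) hk).2).measurable
      H.measurable)
  have b₀ := lintegral_list_sum_const_le (μ := μ) (probes0 (toKey x)) _ _ m₀ fun k hk =>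
    lintegral_const_add_le 1 (H.lintegral_check_le (probes0_spec (wild_toKey x) hk).2
      (probes0_spec (wild_toKey x) hk).1)
  have b₁ := lintegral_list_sum_const_le (μ := μ) (probes1 (toKey x)) _ _ m₁ fun k hk =>
    lintegral_const_add_le 1 (H.lintegral_resolveOne_le (probes1_spec (wild_toKey x) hk).2
      (probes1_spec (wild_toKey x) hk).1)
  have b₂ := lintegral_list_sum_const_le (μ := μ) (probes2 (toKey x)) _ _ m₂ fun k hk =>
    lintegral_const_add_le 1 (H.lintegral_resolveTwo_le (probes2_spec (wild_toKey x) hk).2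
      (probes2_spec (wild_toKey x) hk).1)
  have hcost : ∀ ω, (query cfg T (h ω) (build cfg T (h ω) D).val x).cost =
      (T.pre (toKey x) + 6 * (m + 1)) + (((probes0 (toKey x)).map fun k =>
        1 + (checkCandidate cfg T (h ω) (toKey x) (build cfg T (h ω) D).val k).cost).sum +
      (((probes1 (toKey x)).map fun k =>
        1 + (resolveOne cfg T (h ω) (toKey x) (build cfg T (h ω) D).val k).cost).sum +
      ((probes2 (toKey x)).map fun k =>
        1 + (resolveTwo cfg T (h ω) (toKey x) (build cfg T (h ω) D).val k).cost).sum)) := by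
    intro ω
    simp only [query, cost_bind, cost_tick, cost_collect, cost_pure]
    omega
  simp only [hcost, Nat.cast_add (_ + _) (_ + _), Nat.cast_add (List.sum _) (_ + _),
    Nat.cast_add (List.sum _) (List.sum _)]
  rw [lintegral_add_left measurable_const,
    lintegral_add_left (measurable_natCast (measurable_list_sum m₀)),
    lintegral_add_left (measurable_natCast (measurable_list_sum m₁)), lintegral_const,
    measure_univ, mul_one]
  refine (add_le_add le_rfl (add_le_add b₀ (add_le_add b₁ b₂))).trans ?_
  rw [← Nat.cast_add, ← Nat.cast_add, ← Nat.cast_add, Nat.cast_le]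
  have l₀ := length_probes0_le (toKey x)
  have l₁ := length_probes1_le (toKey x)
  have l₂ := length_probes2_le (toKey x)
  rw [length_toKey, ← hm] at l₀ l₁ l₂
  have hV1 : 1 ≤ V := by omega
  have hm1 : m + 1 ≤ (m + 1) ^ 2 * V := by nlinarith
  -- each of the three per-probe bounds is at most `(1 + Q) (1 + K)² V`
  have e₀ : 1 + Q * V ≤ (1 + Q) * V := by nlinarith
  have e₁ : 1 + (Q + K * (1 + Q * V)) ≤ (1 + Q) * (1 + K) * V := by
    have := Nat.mul_le_mul_left K e₀
    nlinarith
  have e₂ : 1 + (Q + K * (1 + (Q + K * (1 + Q * V)))) ≤ (1 + Q) * (1 + K) ^ 2 * V := by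
    have := Nat.mul_le_mul_left K e₁
    nlinarith [Nat.zero_le (Q * K * V), Nat.zero_le (K * V)]
  have hK1 : (1 + Q) * V ≤ (1 + Q) * (1 + K) ^ 2 * V :=
    Nat.mul_le_mul_right _ (Nat.le_mul_of_pos_right _ (by positivity))
  have hK2 : (1 + Q) * (1 + K) * V ≤ (1 + Q) * (1 + K) ^ 2 * V :=
    Nat.mul_le_mul_right _ (Nat.mul_le_mul_left _ (Nat.le_self_pow two_ne_zero _))
  have f₀ := Nat.mul_le_mul l₀ (e₀.trans hK1)
  have f₁ := Nat.mul_le_mul l₁ (e₁.trans hK2)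
  have f₂ := Nat.mul_le_mul l₂ e₂
  have f₃ : T.pre (toKey x) + 6 * (m + 1) ≤ (c + 12) * ((m + 1) ^ 2 * V) := by
    calc T.pre (toKey x) + 6 * (m + 1) ≤ (c + 12) * (m + 1) := by nlinarith
      _ ≤ _ := Nat.mul_le_mul_left _ hm1
  calc _ ≤ (c + 12) * ((m + 1) ^ 2 * V) + ((m + 1) ^ 2 * ((1 + Q) * (1 + K) ^ 2 * V) +
        (2 * (m + 1) ^ 2 * ((1 + Q) * (1 + K) ^ 2 * V) +
        3 * (m + 1) ^ 2 * ((1 + Q) * (1 + K) ^ 2 * V))) :=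
        Nat.add_le_add f₃ (Nat.add_le_add f₀ (Nat.add_le_add f₁ f₂))
    _ = queryBound c K cfg.δ * ((m + 1) ^ 2 * V) := by
        rw [queryBound, ← hQ]
        ring

end Setting

/-! ### Sizes under the assumption on the substitution lists -/

section Sizes

variable {σ : ℕ} {D : List (Str σ)}

/-- If every non-empty list of the characters with a common key has a single element, the keys are
pairwise distinct. -/
theorem nodup_keys {L : List (Key σ × Fin σ)}
    (hL : ∀ k, ((L.filter fun e => e.1 = k).map Prod.snd) ≠ [] →
      ((L.filter fun e => e.1 = k).map Prod.snd).length = 1) : (L.map Prod.fst).Nodup := by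
  rw [List.nodup_iff_count_le_one]
  intro k
  have hcount : (L.map Prod.fst).count k = (L.filter fun e => e.1 = k).length := by
    rw [List.count, List.countP_map, List.countP_eq_length_filter]
    congr 1
    exact List.filter_congr fun e _ => by rw [Function.comp, Bool.beq_eq_decide_eq]
  rw [hcount]
  by_cases hk : (L.filter fun e => e.1 = k).map Prod.snd = []
  · rw [List.map_eq_nil_iff.1 hk]
    exact Nat.zero_le _
  · have := hL k hk
    rw [List.length_map] at this
    exact this.le

theorem lengthCount_cons (x : Str σ) (l : ℕ) :
    lengthCount (x :: D) l = (if x.length = l then 1 else 0) + lengthCount D l := by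
  rw [lengthCount, lengthCount, List.filter_cons]
  split_ifs <;> simp_all [add_comm]

theorem lengthCount_zero_le (hD : D.Nodup) : lengthCount D 0 ≤ 1 := by
  have : lengthCount D 0 = D.count [] := by
    rw [lengthCount, List.count, List.countP_eq_length_filter]
    congr 1
    exact List.filter_congr fun x _ => by cases x <;> simp
  rw [this]
  exact List.nodup_iff_count_le_one.1 hD []

/-- All the words of length one are inserted under the same key, a single wildcard. -/
theorem lengthCount_one_le (hD : SingletonLists D) : lengthCount D 1 ≤ 1 := by
  -- stated for all `D`, as the assumption on the lists is not needed in this induction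
  have hle : ∀ D : List (Str σ), lengthCount D 1 ≤ (subList1 D [none]).length := by
    intro D
    induction D with
    | nil => simp [lengthCount]
    | cons x D ih =>
      rw [lengthCount_cons]
      have hsplit : (subList1 (x :: D) [none]).length =
          ((entries1 x).filter fun e => e.1 = [none]).length + (subList1 D [none]).length := by
        simp [subList1]
      rw [hsplit]
      refine Nat.add_le_add ?_ ih
      split_ifs with hx
      · obtain ⟨a, rfl⟩ := List.length_eq_one_iff.1 hx
        simp [entries1]
      · exact Nat.zero_le _
  have := (hD [none]).1
  by_cases hne : subList1 D [none] = []
  · have h := hle D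
    rw [hne] at h
    exact h.trans zero_le_one
  · exact (hle D).trans (this hne).le

/-- A word of length at least two has at least one pair of positions, and at least half as many pairs as
positions, so only the words of length zero and one are not accounted for by the pairs. -/
theorem length_le_pairCount : D.length ≤ pairCount D + lengthCount D 0 + lengthCount D 1 ∧
    totalLength D ≤ 2 * pairCount D + lengthCount D 1 := by
  induction D with
  | nil => simp [pairCount, totalLength]
  | cons x D ih =>
    have h₁ : pairCount (x :: D) = x.length * (x.length - 1) / 2 + pairCount D := by simp [pairCount]
    have h₂ : totalLength (x :: D) = x.length + totalLength D := by simp [totalLength]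
    rw [h₁, h₂, lengthCount_cons, lengthCount_cons, List.length_cons]
    generalize hl : x.length = l
    match l with
    | 0 => simp; omega
    | 1 => simp; omega
    | l + 2 =>
      have : l + 1 ≤ (l + 2) * (l + 2 - 1) / 2 := by
        rw [Nat.le_div_iff_mul_le two_pos, show l + 2 - 1 = l + 1 by omega]
        nlinarith
      simp
      simp at this
      omega

theorem maxLength_le_totalLength : maxLength D ≤ totalLength D := by
  induction D with
  | nil => simp [maxLength]
  | cons x D ih =>
    simp only [maxLength, totalLength, List.map_cons, List.foldr_cons, List.sum_cons] at ih ⊢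
    omega

/-- Summing over the lengths and then over the words of each length counts every word at most once. -/
theorem sum_lengthCount_le (g : ℕ → ℕ) (n : ℕ) (D : List (Str σ)) :
    ((List.range n).map fun l => lengthCount D l * g l).sum ≤ (D.map fun x => g x.length).sum := by
  induction D with
  | nil => simp [lengthCount]
  | cons x D ih =>
    have : ((List.range n).map fun l => lengthCount (x :: D) l * g l).sum =
        ((List.range n).map fun l => if x.length = l then g l else 0).sum +
        ((List.range n).map fun l => lengthCount D l * g l).sum := by
      rw [← List.sum_map_add]
      congr 1
      refine List.map_congr_left fun l _ => ?_
      rw [lengthCount_cons]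
      split_ifs <;> ring
    rw [this, List.map_cons, List.sum_cons]
    refine Nat.add_le_add ?_ ih
    rw [← List.sum_toFinset _ List.nodup_range, List.toFinset_range, Finset.sum_ite_eq]
    split_ifs
    · exact le_rfl
    · exact Nat.zero_le _

theorem count_fillTable_le {E : Type} {t : ℕ} {L : List (ℕ × E)} (hL : ∀ p ∈ L, p.1 < t) :
    Nat.count (fun i => (fillTable t L i).isSome) t ≤ L.length := by
  rw [Nat.count_eq_card_filter_range]
  exact card_occupied_le_length hL

end Sizes

/-! ### The expected construction time -/

/-- A bound for the cost of the insertion of one word, in terms of overloads of the tables. -/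
def wordCost {σ : ℕ} (c : ℕ) (cap : ℕ → ℕ) (D : List (Str σ)) (h : Key σ → ℕ) (x : Str σ) : ℕ :=
  c * (x.length + 2) + 3 * x.length + 2 + (overload0 cap D h x +
    (((entries1 x).map fun e => c + 3 + overload1 cap D h e.1).sum +
      ((entries2 x).map fun e => c + 3 + overload2 cap D h e.1).sum))

namespace Setting

variable {σ r : ℕ} {α : ℝ} {c K : ℕ} {cfg : Config r} {T : HashCost σ} {D : List (Str σ)}
  {Ω : Type u} [MeasurableSpace Ω] {μ : Measure Ω} {h : Ω → Key σ → ℕ}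

theorem insertWord_cost_le (H : Setting α c K cfg T D μ h) (g : Key σ → ℕ) {D₁ D₂ : List (Str σ)}
    {x : Str σ} (hD : D = D₁ ++ x :: D₂) :
    (insertWord cfg T g (tableSize cfg.cap D) (slotsAfter cfg g (tableSize cfg.cap D) D₁) x).cost ≤
      wordCost c cfg.cap D g x := by
  have hpre : T.pre (toKey x) ≤ c * (x.length + 1) := by
    simpa using H.incremental.1 (toKey x)
  have hself : T.eval (toKey x) (toKey x) ≤ c := H.eval_le ((editDist_self_le _).trans (by norm_num))
  have hW := wordCount_le H.chars_pos x.length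
  have h₀ := insertFrom_cost_le (cfg.cap (lengthCount D x.length)) (wordCount cfg.w σ x.length + 1) x
    (cfg.cap (lengthCount D x.length)) (fillTable (cfg.cap (lengthCount D x.length)) (exactItems g
      (cfg.cap (lengthCount D x.length)) (D₁.filter fun y => y.length = x.length)))
    (g (toKey x) % cfg.cap (lengthCount D x.length))
  have h₀' := H.runLen_exact_le (D' := D₁) ⟨x :: D₂, hD.symm⟩ g x
  have h₁ : (loop (insertEntry cfg T g (toKey x) (cfg.cap (totalLength D)))
      (fillTable (cfg.cap (totalLength D)) (storeItems cfg g (cfg.cap (totalLength D))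
        (D₁.flatMap entries1))) (entries1 x)).cost ≤
      ((entries1 x).map fun e => c + 3 + overload1 cfg.cap D g e.1).sum := by
    refine (cost_loop_le _ (fun e => c + 2 + overload1 cfg.cap D g e.1) _ _
      fun l₁ e l₂ hl => ?_).trans_eq (congrArg List.sum (List.map_congr_left fun e _ => by omega))
    rw [foldl_insertEntry]
    have hpre : D₁.flatMap entries1 ++ l₁ <+: D.flatMap entries1 :=
      ⟨e :: l₂ ++ D₂.flatMap entries1, by rw [hD]; simp [hl]⟩
    have hins := insertFrom_cost_le (cfg.cap (totalLength D)) 1 (e.2, cfg.sig (g e.1))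
      (cfg.cap (totalLength D)) (fillTable (cfg.cap (totalLength D)) (storeItems cfg g
        (cfg.cap (totalLength D)) (D₁.flatMap entries1 ++ l₁))) (g e.1 % cfg.cap (totalLength D))
    have hrun := H.runLen_store1_le hpre g e.1
    have hev := H.eval_le (x := x) (k := e.1) (entries1_spec (by rw [hl]; simp)).1
    simp only [insertEntry, cost_bind, hashAt]
    omega
  have h₂ : (loop (insertEntry cfg T g (toKey x) (cfg.cap (pairCount D)))
      (fillTable (cfg.cap (pairCount D)) (storeItems cfg g (cfg.cap (pairCount D))
        (D₁.flatMap entries2))) (entries2 x)).cost ≤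
      ((entries2 x).map fun e => c + 3 + overload2 cfg.cap D g e.1).sum := by
    refine (cost_loop_le _ (fun e => c + 2 + overload2 cfg.cap D g e.1) _ _
      fun l₁ e l₂ hl => ?_).trans_eq (congrArg List.sum (List.map_congr_left fun e _ => by omega))
    rw [foldl_insertEntry]
    have hpre : D₁.flatMap entries2 ++ l₁ <+: D.flatMap entries2 :=
      ⟨e :: l₂ ++ D₂.flatMap entries2, by rw [hD]; simp [hl]⟩
    have hins := insertFrom_cost_le (cfg.cap (pairCount D)) 1 (e.2, cfg.sig (g e.1))
      (cfg.cap (pairCount D)) (fillTable (cfg.cap (pairCount D)) (storeItems cfg g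
        (cfg.cap (pairCount D)) (D₁.flatMap entries2 ++ l₁))) (g e.1 % cfg.cap (pairCount D))
    have hrun := H.runLen_store2_le hpre g e.1
    have hev := H.eval_le (x := x) (k := e.1) (entries2_spec (by rw [hl]; simp)).1
    simp only [insertEntry, cost_bind, hashAt]
    omega
  have hcost : (insertWord cfg T g (tableSize cfg.cap D)
      (slotsAfter cfg g (tableSize cfg.cap D) D₁) x).cost =
      T.pre (toKey x) + (x.length + (T.eval (toKey x) (toKey x) +
        ((insertFrom (cfg.cap (lengthCount D x.length)) (wordCount cfg.w σ x.length + 1) x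
          (cfg.cap (lengthCount D x.length)) (fillTable (cfg.cap (lengthCount D x.length))
          (exactItems g (cfg.cap (lengthCount D x.length)) (D₁.filter fun y => y.length = x.length)))
          (g (toKey x) % cfg.cap (lengthCount D x.length))).cost +
        ((loop (insertEntry cfg T g (toKey x) (cfg.cap (totalLength D)))
          (fillTable (cfg.cap (totalLength D)) (storeItems cfg g (cfg.cap (totalLength D))
          (D₁.flatMap entries1))) (entries1 x)).cost +
        (x.length + (loop (insertEntry cfg T g (toKey x) (cfg.cap (pairCount D)))
          (fillTable (cfg.cap (pairCount D)) (storeItems cfg g (cfg.cap (pairCount D))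
          (D₁.flatMap entries2))) (entries2 x)).cost))))) := rfl
  rw [hcost, wordCost, Nat.mul_add c x.length 2]
  rw [Nat.mul_add c x.length 1] at hpre
  omega

theorem measurable_wordCost (H : Setting α c K cfg T D μ h) (x : Str σ) :
    Measurable fun ω => wordCost c cfg.cap D (h ω) x := by
  have h₁ := measurable_list_sum (l := entries1 x) fun e _ =>
    (measurable_const (a := c + 3)).fun_add (H.measurable_overload1 e.1)
  have h₂ := measurable_list_sum (l := entries2 x) fun e _ =>
    (measurable_const (a := c + 3)).fun_add (H.measurable_overload2 e.1)
  exact measurable_const.fun_add ((H.measurable_overload0 x).fun_add (h₁.fun_add h₂))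

theorem lintegral_wordCost_le [IsProbabilityMeasure μ] (H : Setting α c K cfg T D μ h) (x : Str σ) :
    ∫⁻ ω, (wordCost c cfg.cap D (h ω) x : ℝ≥0∞) ∂μ ≤
      ((2 * c + K + 6) * (1 + x.length + x.length * (x.length - 1) / 2) : ℕ) := by
  have hc1 : ∀ e ∈ entries1 x, Measurable fun ω => c + 3 + overload1 cfg.cap D (h ω) e.1 :=
    fun e _ => measurable_const.fun_add (H.measurable_overload1 e.1)
  have hc2 : ∀ e ∈ entries2 x, Measurable fun ω => c + 3 + overload2 cfg.cap D (h ω) e.1 :=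
    fun e _ => measurable_const.fun_add (H.measurable_overload2 e.1)
  have b₁ := lintegral_list_sum_const_le (μ := μ) (entries1 x) _ (c + 3 + K) hc1 fun e he =>
    lintegral_const_add_le _ (H.lintegral_overload1 (entries1_spec he).2)
  have b₂ := lintegral_list_sum_const_le (μ := μ) (entries2 x) _ (c + 3 + K) hc2 fun e he =>
    lintegral_const_add_le _ (H.lintegral_overload2 (entries2_spec he).2)
  have hsum1 : Measurable fun ω =>
      ((entries1 x).map fun e => c + 3 + overload1 cfg.cap D (h ω) e.1).sum :=
    measurable_list_sum hc1
  have key : ∫⁻ ω, ((overload0 cfg.cap D (h ω) x +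
      (((entries1 x).map fun e => c + 3 + overload1 cfg.cap D (h ω) e.1).sum +
        ((entries2 x).map fun e => c + 3 + overload2 cfg.cap D (h ω) e.1).sum) : ℕ) : ℝ≥0∞) ∂μ ≤
      (K + ((entries1 x).length * (c + 3 + K) + (entries2 x).length * (c + 3 + K)) : ℕ) := by
    simp only [Nat.cast_add (overload0 _ _ _ _), Nat.cast_add (List.sum _) (List.sum _)]
    rw [lintegral_add_left (measurable_natCast (H.measurable_overload0 x)),
      lintegral_add_left (measurable_natCast hsum1), Nat.cast_add K, Nat.cast_add (_ * _) (_ * _)]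
    exact add_le_add (H.lintegral_overload0 x) (add_le_add b₁ b₂)
  refine (lintegral_const_add_le _ key).trans ?_
  rw [Nat.cast_le, length_entries1, length_entries2]
  generalize x.length * (x.length - 1) / 2 = p
  have := Nat.zero_le (p * (c + 3) + c * p)
  nlinarith

theorem build_cost_le (H : Setting α c K cfg T D μ h) (g : Key σ → ℕ) :
    (build cfg T g D).cost ≤
      (21 + 10 * ⌈α⁻¹⌉₊) * (D.length + totalLength D + maxLength D + pairCount D + 1) +
        (D.map fun x => 1 + wordCost c cfg.cap D g x).sum := by
  set A := ⌈α⁻¹⌉₊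
  set n := totalLength D
  set N := pairCount D
  set M := maxLength D
  set d := D.length with hd
  have hcap : ∀ k, cfg.cap k ≤ 1 + A * k := fun k => by rw [H.cap_eq]; exact capacity_le α k
  have hcount : ((List.range (M + 1)).map fun l => lengthCount D l).sum ≤ d := by
    simpa using sum_lengthCount_le (fun _ => 1) (M + 1) D
  have hwords : ((List.range (M + 1)).map fun l => lengthCount D l * (l + 1)).sum ≤ n + d := by
    refine (sum_lengthCount_le (fun l => l + 1) (M + 1) D).trans_eq ?_
    rw [List.sum_map_add]
    simp [n, hd, totalLength]
  have hsplit : ∀ (a b : ℕ), ((List.range (M + 1)).map fun l => a + b * lengthCount D l).sum ≤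
      a * (M + 1) + b * d := by
    intro a b
    rw [List.sum_map_add, List.sum_map_mul_left]
    refine Nat.add_le_add ?_ (Nat.mul_le_mul_left b hcount)
    simp [mul_comm]
  have c₁ : (loop (fun _ l => tick (tableSize cfg.cap D (.exact l))) ()
      (List.range (M + 1))).cost ≤ 2 * (M + 1) + A * d := by
    refine (cost_loop_le _ (fun l => 1 + A * lengthCount D l) _ _ fun _ l _ _ => hcap _).trans
      (le_trans (le_of_eq ?_) (hsplit 2 A))
    exact congrArg List.sum (List.map_congr_left fun l _ => by omega)
  have c₂ : (loop (insertWord cfg T g (tableSize cfg.cap D))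
      ⟨fun _ _ => none, fun _ => none, fun _ => none⟩ D).cost ≤
      (D.map fun x => 1 + wordCost c cfg.cap D g x).sum := by
    refine cost_loop_le _ _ _ _ fun D₁ x D₂ hD => ?_
    rw [foldl_insertWord]
    exact H.insertWord_cost_le g hD
  set s := slotsAfter cfg g (tableSize cfg.cap D) D with hs
  have c₃ : (loop (fun (tables : ℕ → Table (Str σ)) l => do
      let tb ← finish cfg (wordCount cfg.w σ l + 1) (tableSize cfg.cap D (.exact l)) (s.exact l)
      tick 1
      pure (Function.update tables l tb)) (fun _ => .plain 0 fun _ => none)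
      (List.range (M + 1))).cost ≤ 6 * (M + 1) + 4 * A * d + (n + d) := by
    refine (cost_loop_le _ (fun l => 5 + 4 * A * lengthCount D l + lengthCount D l * (l + 1)) _ _
      fun _ l _ _ => ?_).trans ?_
    · simp only [cost_bind, cost_tick, cost_pure]
      have hf := finish_cost_le cfg (wordCount cfg.w σ l + 1) (cfg.cap (lengthCount D l)) (s.exact l)
      have hocc : Nat.count (fun i => (s.exact l i).isSome) (cfg.cap (lengthCount D l)) ≤
          lengthCount D l :=
        (count_fillTable_le (exactItems_lt (H.cap_pos _))).trans_eq (List.length_map _)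
      have hm := Nat.mul_le_mul (Nat.add_le_add_right (wordCount_le H.chars_pos l) 1) hocc
      have hc := hcap (lengthCount D l)
      have : (l + 1) * lengthCount D l = lengthCount D l * (l + 1) := mul_comm _ _
      have h4 : 4 * (1 + A * lengthCount D l) = 4 + 4 * A * lengthCount D l := by ring
      simp only [tableSize]
      omega
    · have e : ∀ l, 1 + (5 + 4 * A * lengthCount D l + lengthCount D l * (l + 1)) =
          (6 + 4 * A * lengthCount D l) + lengthCount D l * (l + 1) := fun l => by ring
      simp only [e]
      rw [List.sum_map_add]
      exact Nat.add_le_add (hsplit 6 (4 * A)) hwords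
  have c₄ : (finish cfg 1 (cfg.cap n) s.one).cost ≤ 4 * (1 + A * n) + n := by
    have hf := finish_cost_le cfg 1 (cfg.cap n) s.one
    have hocc : Nat.count (fun i => (s.one i).isSome) (cfg.cap n) ≤ n :=
      (count_fillTable_le (storeItems_lt (H.cap_pos _))).trans_eq (by
        rw [storeItems, List.length_map, length_flatMap_entries1])
    have := hcap n
    omega
  have c₅ : (finish cfg 1 (cfg.cap N) s.two).cost ≤ 4 * (1 + A * N) + N := by
    have hf := finish_cost_le cfg 1 (cfg.cap N) s.two
    have hocc : Nat.count (fun i => (s.two i).isSome) (cfg.cap N) ≤ N :=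
      (count_fillTable_le (storeItems_lt (H.cap_pos _))).trans_eq (by
        rw [storeItems, List.length_map, length_flatMap_entries2])
    have := hcap N
    omega
  have hcost : (build cfg T g D).cost = (n + d + M + 1) +
      ((loop (fun _ l => tick (tableSize cfg.cap D (.exact l))) () (List.range (M + 1))).cost +
      (cfg.cap n + (cfg.cap N + ((loop (insertWord cfg T g (tableSize cfg.cap D))
        ⟨fun _ _ => none, fun _ => none, fun _ => none⟩ D).cost +
      ((loop (fun (tables : ℕ → Table (Str σ)) l => do
        let tb ← finish cfg (wordCount cfg.w σ l + 1) (tableSize cfg.cap D (.exact l)) (s.exact l)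
        tick 1
        pure (Function.update tables l tb)) (fun _ => .plain 0 fun _ => none)
        (List.range (M + 1))).cost +
      ((finish cfg 1 (cfg.cap n) s.one).cost + (finish cfg 1 (cfg.cap N) s.two).cost)))))) := by
    rw [hs, ← foldl_insertWord cfg T g, ← val_loop]
    rfl
  rw [hcost]
  have hn := hcap n
  have hN := hcap N
  have hA := Nat.zero_le (A * M + A * d)
  nlinarith

/-- The constant of the construction time. The factor 11 bounds the number of words, their total length,
the largest length and the number of level-2 insertions, all together, by `max 1 (pairCount D)`. -/
noncomputable def buildBound (α : ℝ) (c K : ℕ) : ℕ := 11 * (28 + 10 * ⌈α⁻¹⌉₊ + 2 * c + K)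

theorem lintegral_build_le [IsProbabilityMeasure μ] (H : Setting α c K cfg T D μ h)
    (hS : SingletonLists D) :
    ∫⁻ ω, ((build cfg T (h ω) D).cost : ℝ≥0∞) ∂μ ≤ (buildBound α c K * max 1 (pairCount D) : ℕ) := by
  refine (lintegral_mono fun ω => Nat.cast_le.2 (H.build_cost_le (h ω))).trans ?_
  refine (lintegral_const_add_le _ (lintegral_list_sum_le D _
    (fun x => 1 + (2 * c + K + 6) * (1 + x.length + x.length * (x.length - 1) / 2))
    (fun x _ => measurable_const.fun_add (H.measurable_wordCost x)) fun x _ =>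
      lintegral_const_add_le _ (H.lintegral_wordCost_le x))).trans ?_
  rw [Nat.cast_le, List.sum_map_add, List.sum_map_mul_left, List.sum_map_add, List.sum_map_add]
  have e₁ : (D.map fun _ => 1).sum = D.length := by simp
  have e₂ : (D.map fun x => x.length).sum = totalLength D := rfl
  have e₃ : (D.map fun x => x.length * (x.length - 1) / 2).sum = pairCount D := rfl
  rw [e₁, e₂, e₃, buildBound]
  obtain ⟨h₁, h₂⟩ := length_le_pairCount (D := D)
  have h₃ := lengthCount_zero_le H.nodup
  have h₄ := lengthCount_one_le hS
  have h₅ := maxLength_le_totalLength (D := D)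
  set A := ⌈α⁻¹⌉₊
  set d := D.length
  set n := totalLength D
  set M := maxLength D
  set N := pairCount D
  have hs : d + n + M + N + 1 ≤ 11 * max 1 N := by
    have := le_max_left 1 N
    have := le_max_right 1 N
    omega
  calc (21 + 10 * A) * (d + n + M + N + 1) + (d + (2 * c + K + 6) * (d + n + N))
      ≤ (21 + 10 * A) * (d + n + M + N + 1) + ((d + n + M + N + 1) +
          (2 * c + K + 6) * (d + n + M + N + 1)) := by
        exact Nat.add_le_add_left (Nat.add_le_add (by omega)
          (Nat.mul_le_mul_left _ (by omega))) _
    _ = (28 + 10 * A + 2 * c + K) * (d + n + M + N + 1) := by ring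
    _ ≤ (28 + 10 * A + 2 * c + K) * (11 * max 1 N) := Nat.mul_le_mul_left _ hs
    _ = _ := by ring

end Setting

/-! ### Words of packed strings -/

/-- The number of words of a packed candidate is of the order of the number of words of bits of the
query string. -/
theorem wordCount_add_two_le {w σ m : ℕ} (hσ : 2 ≤ σ) (hw : 0 < w) (hp : 0 < charsPerWord w σ)
    (hm : 1 ≤ m) :
    wordCount w σ (m + 2) + 1 ≤ 14 * ⌈m * Real.logb 2 σ / w⌉₊ := by
  set p := charsPerWord w σ with hpdef
  set z := ⌈m * Real.logb 2 σ / w⌉₊ with hz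
  have hw' : (0 : ℝ) < w := by exact_mod_cast hw
  have hlog : 1 ≤ Real.logb 2 σ := by
    rw [Real.le_logb_iff_rpow_le one_lt_two (by positivity), Real.rpow_one]
    exact_mod_cast hσ
  have hm' : (1 : ℝ) ≤ m := by exact_mod_cast hm
  -- rounding up `log₂ σ ≥ 1`, and rounding down `w / ⌈log₂ σ⌉ ≥ 1`, lose a factor of at most two each
  have hclog : (Nat.clog 2 σ : ℝ) ≤ 2 * Real.logb 2 σ := by
    have h₁ := Real.natCeil_logb_natCast 2 σ
    have h₂ := Nat.ceil_lt_add_one (zero_le_one.trans hlog)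
    rw [Nat.cast_two] at h₁
    rw [← h₁]
    linarith
  have hwp : w ≤ 2 * Nat.clog 2 σ * p := by
    have h₁ := Nat.lt_mul_div_succ w (Nat.clog_pos one_lt_two hσ)
    have h₂ : Nat.clog 2 σ * (w / Nat.clog 2 σ + 1) ≤ Nat.clog 2 σ * (2 * p) :=
      Nat.mul_le_mul_left _ (by rw [hpdef] at hp ⊢; unfold charsPerWord at hp ⊢; omega)
    nlinarith
  have hz1 : 1 ≤ z := Nat.one_le_iff_ne_zero.2 (Nat.ceil_pos.2 (by positivity)).ne'
  have hzw : (m : ℝ) * Real.logb 2 σ ≤ z * w := by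
    rw [← div_le_iff₀ hw']
    exact Nat.le_ceil _
  have hkey : (3 * m : ℝ) ≤ 12 * z * p := by
    have h₁ : (w : ℝ) ≤ 2 * (2 * Real.logb 2 σ) * p := by
      have h₀ : (w : ℝ) ≤ 2 * (Nat.clog 2 σ : ℝ) * p := by exact_mod_cast hwp
      refine h₀.trans ?_
      gcongr
    have h₂ : (3 * m : ℝ) * w ≤ 12 * z * p * w := by
      calc (3 * m : ℝ) * w ≤ 3 * m * (2 * (2 * Real.logb 2 σ) * p) := by gcongr
        _ = 12 * p * (m * Real.logb 2 σ) := by ring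
        _ ≤ 12 * p * (z * w) := by gcongr
        _ = _ := by ring
    exact le_of_mul_le_mul_right h₂ hw'
  have hkey' : 3 * m ≤ 12 * z * p := by exact_mod_cast hkey
  have hW : wordCount w σ (m + 2) ≤ 12 * z + 1 := by
    rw [wordCount]
    refine Nat.le_of_lt_succ ((Nat.div_lt_iff_lt_mul hp).2 ?_)
    rw [← hpdef]
    nlinarith [Nat.sub_lt hp one_pos]
  omega

end TwoErrorDict

open TwoErrorDict in
theorem mainTheorem3 (α : ℝ) (hα₀ : 0 < α) (hα₁ : α < 1) (δ : ℕ) (hδ : 1 ≤ δ) (r c κ : ℕ) :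
    ∃ C : ℝ, ∀ (σ : ℕ) (D : List (Str σ)) (cfg : Config r) (T : HashCost σ) (range : TableId → ℕ)
      (Ω : Type u) [MeasurableSpace Ω] (μ : Measure Ω) [IsProbabilityMeasure μ]
      (h : Ω → Key σ → ℕ),
      cfg.cap = capacity α → cfg.δ = δ →
      2 ≤ σ → σ ≤ 2 ^ cfg.w → totalLength D ≤ 2 ^ (κ * cfg.w) →
      D.Nodup → SingletonLists D →
      T.Incremental 2 c →
      (∀ τ, 0 < range τ ∧ tableSize cfg.cap D τ ∣ range τ ∧ range τ ≤ 2 ^ (κ * cfg.w)) →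
      FullyRandom μ h (fun k => range (tableOf k)) →
      (∀ ω x y, y ∈ (query cfg T (h ω) (build cfg T (h ω) D).val x).val ↔
        y ∈ D ∧ editDist x y ≤ 2) ∧
      (∀ x : Str σ, 1 ≤ x.length →
        ∫⁻ ω, ((query cfg T (h ω) (build cfg T (h ω) D).val x).cost : ℝ≥0∞) ∂μ ≤
          ENNReal.ofReal
            (C * ((x.length : ℝ) ^ 2 * ⌈x.length * Real.logb 2 σ / cfg.w⌉₊))) ∧
      ∫⁻ ω, ((build cfg T (h ω) D).cost : ℝ≥0∞) ∂μ ≤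
        ENNReal.ofReal (C * max 1 (pairCount D : ℝ)) := by
  obtain ⟨K, hK⟩ := ENNReal.exists_nat_gt (overloadBound_ne_top hα₁)
  refine ⟨((56 * Setting.queryBound c K δ + Setting.buildBound α c K : ℕ) : ℝ), ?_⟩
  intro σ D cfg T range Ω _ μ _ h hcap hcδ hσ hσw _ hnd hS hT hrange hh
  have hw : 0 < cfg.w := by
    by_contra hw
    obtain hw : cfg.w = 0 := by omega
    rw [hw] at hσw
    omega
  have hp : 0 < charsPerWord cfg.w σ :=
    Nat.div_pos (Nat.clog_le_of_le_pow hσw) (Nat.clog_pos one_lt_two hσ)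
  have hsize : ∀ τ, 0 < tableSize cfg.cap D τ := by
    intro τ
    rw [hcap]
    cases τ <;> exact capacity_pos α _
  have H : Setting α c K cfg T D μ h :=
    { alpha_pos := hα₀
      alpha_lt := hα₁
      w_pos := hw
      delta_pos := by omega
      cap_eq := hcap
      chars_pos := hp
      nodup := hnd
      nodup1 := nodup_keys fun k => (hS k).1
      nodup2 := nodup_keys fun k => (hS k).2
      incremental := hT
      measurable := hh.1
      indep := hh.2.2
      unif := by
        intro k v hv
        obtain ⟨hpos, ⟨q, hq⟩, -⟩ := hrange (tableOf k)
        refine measure_mod_le (hh.1 k) (q := q) (hsize _)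
          (Nat.pos_of_mul_pos_left (hq ▸ hpos)) (fun u hu => ?_) hv
        rw [← hq] at hu ⊢
        exact hh.2.1 k u hu
      bound := hK.le }
  refine ⟨fun ω x y => mem_query hw H.delta_pos hp H.lt_cap, fun x hx => ?_, ?_⟩
  · refine (H.lintegral_query_le x).trans ?_
    rw [← ENNReal.ofReal_natCast]
    refine ENNReal.ofReal_le_ofReal ?_
    have hV := wordCount_add_two_le (w := cfg.w) hσ hw hp hx
    set z := ⌈x.length * Real.logb 2 σ / cfg.w⌉₊
    rw [hcδ]
    have : Setting.queryBound c K δ *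
        ((x.length + 1) ^ 2 * (wordCount cfg.w σ (x.length + 2) + 1)) ≤
        (56 * Setting.queryBound c K δ + Setting.buildBound α c K) * (x.length ^ 2 * z) := by
      -- `m + 1 ≤ 2 m`, as the query is not empty
      calc _ ≤ Setting.queryBound c K δ * ((2 * x.length) ^ 2 * (14 * z)) := by
            gcongr
            omega
        _ = 56 * Setting.queryBound c K δ * (x.length ^ 2 * z) := by ring
        _ ≤ _ := Nat.mul_le_mul_right _ (Nat.le_add_right _ _)
    exact_mod_cast this
  · refine (H.lintegral_build_le hS).trans ?_
    rw [← ENNReal.ofReal_natCast]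
    refine ENNReal.ofReal_le_ofReal ?_
    have : Setting.buildBound α c K * max 1 (pairCount D) ≤
        (56 * Setting.queryBound c K δ + Setting.buildBound α c K) * max 1 (pairCount D) :=
      Nat.mul_le_mul_right _ (Nat.le_add_left _ _)
    exact_mod_cast this
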